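/- Let ${\bf k}$ be a field and $M$ a smooth manifold (Hausdorff, second countable, without boundary). All sheaves are sheaves of ${\bf k}$-vector spaces; $\mathcal{D}^+({\bf k}_X)$ is the bounded below derived category of such sheaves on $X$, a full subcategory of $\mathcal{D}({\bf k}_X)$, and $Rf_!$ is the right derived functor of the direct image with proper supports $f_!$. A smooth function $S: M \times \mathbb{R}^N \to \mathbb{R}$ is a generating function of $L \subset T^*M$ if $$L = \{(m, \partial_m S(m,\xi)) \mid \partial_\xi S(m,\xi) = 0\}.$$ Put $N_S = \{(m,\xi,t) \mid S(m,\xi) + t \geq 0\} \subset M \times \mathbb{R}^N \times \mathbb{R}$, let $p: M \times \mathbb{R}^N \times \mathbb{R} \to M \times \mathbb{R}$ be the projection, and let $\mathcal{F}_S = Rp_!\,{\bf k}_{N_S} \in \mathcal{D}^+({\bf k}_{M \times \mathbb{R}})$. An object isomorphic to $\mathcal{F}_S$ for some generating function $S$ of $L$ (on $M \times \mathbb{R}^N$ for some $N \ge 0$) is called a canonical sheaf of $L$. For $\mathcal{F}, \mathcal{G} \in \mathcal{D}^+({\bf k}_{M \times \mathbb{R}})$ let $\mathcal{F} \ast \mathcal{G}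 = \delta^{-1} Rs_!(\pi_1^{-1}\mathcal{F} \otimes \pi_2^{-1}\mathcal{G})$, where $\pi_i(m_1,m_2,t_1,t_2) = (m_i,t_i)$, $s(m_1,m_2,t_1,t_2) = (m_1,m_2,t_1+t_2)$ and $\delta(m,t) = (m,m,t)$. Let $S_1: M \times \mathbb{R}^{\ell_1} \to \mathbb{R}$ and $S_2: M \times \mathbb{R}^{\ell_2} \to \mathbb{R}$ be generating functions of $L_1$ and $L_2$, put $S(m,\xi_1,\xi_2) = S_1(m,\xi_1) + S_2(m,\xi_2)$ on $M \times \mathbb{R}^{\ell_1+\ell_2}$, and $L_1 +_b L_2 = \{(m,p_1+p_2) \mid (m,p_1) \in L_1,\ (m,p_2) \in L_2\}$. Then there is an isomorphism $\mathcal{F}_{S_1} \ast \mathcal{F}_{S_2} \simeq \mathcal{F}_S$ in $\mathcal{D}^+({\bf k}_{M\times\mathbb{R}})$, and $S$ is a generating function of $L_1 +_b L_2$. Hence $\mathcal{F}_{S_1} \ast \mathcal{F}_{S_2}$ is a canonical sheaf of $L_1 +_b L_2$. -/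

import Mathlib

open CategoryTheory CategoryTheory.Limits TopologicalSpace Opposite
open scoped Manifold ContDiff

universe u

noncomputable section

namespace SheafConvolution

/-- Sheaves of `k`-vector spaces on the space `X`. -/
abbrev Shv (k : Type u) [Field k] (X : TopCat.{u}) : Type (u + 1) :=
  TopCat.Sheaf (ModuleCat.{u} k) X

instance (k : Type u) [Field k] (X : TopCat.{u}) : HasDerivedCategory (Shv k X) :=
  HasDerivedCategory.standard _

/-- The bounded below derived category of sheaves of `k`-vector spaces on `X`, which is a full
subcategory of the derived category `D(k_X)`. -/
abbrev DPlus (k : Type u) [Field k] (X : TopCat.{u}) : Type (u + 1) :=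
  DerivedCategory.Plus (Shv k X)

section Proper
open Filter Topology
variable {k : Type u} [Field k] {X Y : TopCat.{u}}

/-- The support of a section `s ∈ F(V)`: the points of `V` at which the germ of `s` is nonzero. -/
def sectionSupport (F : Shv k X) {V : Opens X} (s : F.presheaf.obj (op V)) : Set X :=
  {x | ∃ hx : x ∈ V, F.presheaf.germ V x hx s ≠ 0}

lemma mapsTo_sectionSupport (f : X ⟶ Y) (F : Shv k X) {U : Opens Y}
    (s : F.presheaf.obj (op ((Opens.map f).obj U))) :
    Set.MapsTo f (sectionSupport F s) U := fun _ hx ↦ hx.1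

/-- The section `s ∈ F(f⁻¹ U)` has proper support over `U`: the map `f : supp s → U` is proper. -/
def HasProperSupport (f : X ⟶ Y) (F : Shv k X) {U : Opens Y}
    (s : F.presheaf.obj (op ((Opens.map f).obj U))) : Prop :=
  IsProperMap (Set.MapsTo.restrict f (sectionSupport F s) U (mapsTo_sectionSupport f F s))

lemma isProperMap_restrict_iff {A B : Type*} [TopologicalSpace A] [TopologicalSpace B]
    {f : A → B} (hf : Continuous f) {S : Set A} {T : Set B} (h : Set.MapsTo f S T) :
    IsProperMap (h.restrict f S T) ↔ ∀ (𝒰 : Ultrafilter A), S ∈ 𝒰 → ∀ y ∈ T,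
      Tendsto f 𝒰 (𝓝 y) → ∃ x ∈ S, f x = y ∧ (𝒰 : Filter A) ≤ 𝓝 x := by
  rw [isProperMap_iff_ultrafilter]
  constructor
  · rintro ⟨-, H⟩ 𝒰 hS y hy hfy
    have hr : S ∈ 𝒰 := hS
    have hSr : Set.range (Subtype.val : S → A) ∈ 𝒰 := by simpa using hS
    let 𝒱 : Ultrafilter S := 𝒰.comap Subtype.val_injective hSr
    have hm : Filter.map (Subtype.val : S → A) (𝒱 : Filter S) = 𝒰 := by
      rw [Ultrafilter.coe_comap]; exact Filter.map_comap_of_mem hSr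
    obtain ⟨x, hx, hle⟩ := @H 𝒱 ⟨y, hy⟩ (by
      rw [tendsto_subtype_rng]
      change Tendsto (f ∘ Subtype.val) _ _
      rw [← tendsto_map'_iff, hm]
      exact hfy)
    refine ⟨x, x.2, congrArg Subtype.val hx, ?_⟩
    rw [← hm]
    exact (Filter.map_mono hle).trans continuous_subtype_val.continuousAt
  · intro H
    refine ⟨hf.restrict h, fun 𝒱 y hy ↦ ?_⟩
    obtain ⟨x, hxS, hxy, hle⟩ := H (𝒱.map Subtype.val) (by
      rw [Ultrafilter.mem_map, Subtype.coe_preimage_self]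
      exact Filter.univ_mem) y y.2 (by
        rw [Ultrafilter.coe_map, tendsto_map'_iff]
        exact (continuous_subtype_val.tendsto y).comp hy)
    refine ⟨⟨x, hxS⟩, Subtype.ext hxy, ?_⟩
    rw [nhds_subtype, ← Filter.map_le_iff_le_comap]
    exact hle

lemma hasProperSupport_iff (f : X ⟶ Y) (F : Shv k X) {U : Opens Y}
    (s : F.presheaf.obj (op ((Opens.map f).obj U))) :
    HasProperSupport f F s ↔ ∀ (𝒰 : Ultrafilter X), sectionSupport F s ∈ 𝒰 → ∀ y ∈ U,
      Tendsto f 𝒰 (𝓝 y) → ∃ x ∈ sectionSupport F s, f x = y ∧ (𝒰 : Filter X) ≤ 𝓝 x :=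
  isProperMap_restrict_iff f.hom.continuous _

lemma sectionSupport_restrict (F : Shv k X) {V W : Opens X} (i : W ⟶ V)
    (s : F.presheaf.obj (op V)) :
    sectionSupport F (F.presheaf.map i.op s) = sectionSupport F s ∩ W := by
  ext x
  simp only [sectionSupport, Set.mem_inter_iff, Set.mem_ofPred_eq, SetLike.mem_coe]
  constructor
  · rintro ⟨hx, h⟩
    rw [TopCat.Presheaf.germ_res_apply] at h
    exact ⟨⟨i.le hx, h⟩, hx⟩
  · rintro ⟨⟨hx, h⟩, hxW⟩
    refine ⟨hxW, ?_⟩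
    rwa [TopCat.Presheaf.germ_res_apply]

/-- The support is closed in the domain of the section. -/
lemma mem_sectionSupport_of_ultrafilter (F : Shv k X) {V : Opens X} (s : F.presheaf.obj (op V))
    {x : X} (hx : x ∈ V) (𝒰 : Ultrafilter X) (hs : sectionSupport F s ∈ 𝒰)
    (hle : (𝒰 : Filter X) ≤ 𝓝 x) : x ∈ sectionSupport F s := by
  by_contra hn
  have h0 : F.presheaf.germ V x hx s = F.presheaf.germ V x hx 0 := by
    rw [map_zero]
    by_contra h
    exact hn ⟨hx, h⟩
  obtain ⟨W, hxW, i, j, hij⟩ := TopCat.Presheaf.germ_eq _ x hx hx _ _ h0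
  rw [map_zero] at hij
  have hW : (W : Set X) ∈ 𝒰 := hle (W.isOpen.mem_nhds hxW)
  obtain ⟨z, hz⟩ := 𝒰.nonempty_of_mem (Filter.inter_mem hs hW)
  rw [← sectionSupport_restrict F i s, hij] at hz
  obtain ⟨_, h⟩ := hz
  exact h (map_zero _)

lemma HasProperSupport.of_subset {f : X ⟶ Y} {F G : Shv k X} {U : Opens Y}
    {s t : F.presheaf.obj (op ((Opens.map f).obj U))}
    {r : G.presheaf.obj (op ((Opens.map f).obj U))}
    (hs : HasProperSupport f F s) (ht : HasProperSupport f F t)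
    (h : sectionSupport G r ⊆ sectionSupport F s ∪ sectionSupport F t) :
    HasProperSupport f G r := by
  rw [hasProperSupport_iff] at hs ht ⊢
  intro 𝒰 hr y hy hfy
  have key : ∃ x, f x = y ∧ (𝒰 : Filter X) ≤ 𝓝 x := by
    rcases Ultrafilter.union_mem_iff.1 (Filter.mem_of_superset hr h) with h' | h'
    · obtain ⟨x, -, hx⟩ := hs 𝒰 h' y hy hfy
      exact ⟨x, hx⟩
    · obtain ⟨x, -, hx⟩ := ht 𝒰 h' y hy hfy
      exact ⟨x, hx⟩
  obtain ⟨x, hxy, hle⟩ := key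
  have hx : x ∈ (Opens.map f).obj U := by
    change f x ∈ U
    rwa [hxy]
  exact ⟨x, mem_sectionSupport_of_ultrafilter G r hx 𝒰 hr hle, hxy, hle⟩

lemma sectionSupport_zero (F : Shv k X) (V : Opens X) :
    sectionSupport F (0 : F.presheaf.obj (op V)) = ∅ := by
  ext x
  simp only [sectionSupport, Set.mem_ofPred_eq, Set.mem_empty_iff_false, iff_false]
  rintro ⟨hx, h⟩
  exact h (map_zero _)

lemma hasProperSupport_zero (f : X ⟶ Y) (F : Shv k X) (U : Opens Y) :
    HasProperSupport f F (0 : F.presheaf.obj (op ((Opens.map f).obj U))) := by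
  rw [hasProperSupport_iff, sectionSupport_zero]
  intro 𝒰 h
  exact (Ultrafilter.empty_notMem h).elim

/-- The submodule of `F(f⁻¹ U)` of the sections whose support is proper over `U`. -/
def properSections (f : X ⟶ Y) (F : Shv k X) (U : Opens Y) :
    Submodule k (F.presheaf.obj (op ((Opens.map f).obj U))) where
  carrier := {s | HasProperSupport f F s}
  zero_mem' := hasProperSupport_zero f F U
  add_mem' {s t} hs ht := HasProperSupport.of_subset hs ht (by
    rintro x ⟨hx, h⟩
    rw [map_add] at h
    by_cases h0 : F.presheaf.germ _ x hx s = 0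
    · exact Or.inr ⟨hx, fun h1 ↦ h (by rw [h0, h1, add_zero])⟩
    · exact Or.inl ⟨hx, h0⟩)
  smul_mem' c s hs := HasProperSupport.of_subset hs hs (by
    rintro x ⟨hx, h⟩
    refine Or.inl ⟨hx, fun h0 ↦ h ?_⟩
    change (F.presheaf.germ _ x hx).hom (c • s) = 0
    rw [map_smul]
    change c • (F.presheaf.germ _ x hx s) = 0
    rw [h0, smul_zero])

lemma HasProperSupport.restrict {f : X ⟶ Y} {F : Shv k X} {U V : Opens Y} (i : V ⟶ U)
    {s : F.presheaf.obj (op ((Opens.map f).obj U))} (hs : HasProperSupport f F s) :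
    HasProperSupport f F (F.presheaf.map ((Opens.map f).map i).op s) := by
  rw [hasProperSupport_iff] at hs ⊢
  rw [sectionSupport_restrict]
  intro 𝒰 h y hy hfy
  obtain ⟨x, hx, hxy, hle⟩ :=
    hs 𝒰 (Filter.mem_of_superset h Set.inter_subset_left) y (i.le hy) hfy
  refine ⟨x, ⟨hx, ?_⟩, hxy, hle⟩
  change f x ∈ V
  rwa [hxy]

/-- The presheaf `U ↦ {s ∈ F(f⁻¹ U) | f : supp s → U is proper}`. -/
def properPushforwardPresheaf (f : X ⟶ Y) (F : Shv k X) : TopCat.Presheaf (ModuleCat.{u} k) Y where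
  obj U := ModuleCat.of k (properSections f F U.unop)
  map i := ModuleCat.ofHom
    ((F.presheaf.map ((Opens.map f).map i.unop).op).hom.restrict
      (fun _ hs ↦ HasProperSupport.restrict i.unop hs))
  map_id U := by
    ext s
    exact ConcreteCategory.congr_hom (F.presheaf.map_id _) s.1
  map_comp i j := by
    ext s
    exact ConcreteCategory.congr_hom
      (F.presheaf.map_comp ((Opens.map f).map i.unop).op ((Opens.map f).map j.unop).op) s.1

lemma isSheaf_properPushforwardPresheaf (f : X ⟶ Y) (F : Shv k X) :
    (properPushforwardPresheaf f F).IsSheaf := by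
  rw [TopCat.Presheaf.isSheaf_iff_isSheaf_comp (forget (ModuleCat.{u} k)),
    TopCat.Presheaf.isSheaf_iff_isSheafUniqueGluing_types]
  intro ι U sf hsf
  let G : Shv k Y := (TopCat.Sheaf.pushforward (ModuleCat.{u} k) f).obj F
  obtain ⟨s', hs, huniq⟩ := TopCat.Sheaf.existsUnique_gluing G U (fun i ↦ (sf i).1)
    (fun i j ↦ congrArg Subtype.val (hsf i j))
  let s : F.presheaf.obj (op ((Opens.map f).obj (iSup U))) := s'
  have hs' : ∀ i, F.presheaf.map ((Opens.map f).map (Opens.leSupr U i)).op s = (sf i).1 := hs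
  have hprop : HasProperSupport f F (U := iSup U) s := by
    rw [hasProperSupport_iff]
    intro 𝒰 h y hy hfy
    obtain ⟨i, hi⟩ := Opens.mem_iSup.1 hy
    have hp := (sf i).2
    change HasProperSupport f F _ at hp
    rw [← hs' i, hasProperSupport_iff, sectionSupport_restrict] at hp
    obtain ⟨x, hx, hxy, hle⟩ := hp 𝒰
      (Filter.inter_mem h (hfy ((U i).isOpen.mem_nhds hi))) y hi hfy
    exact ⟨x, hx.1, hxy, hle⟩
  refine ⟨⟨s, hprop⟩, fun i ↦ Subtype.ext (hs' i), fun t ht ↦ Subtype.ext (huniq t.1 fun i ↦ ?_)⟩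
  exact congrArg Subtype.val (ht i)

lemma HasProperSupport.map {f : X ⟶ Y} {F G : Shv k X} (φ : F ⟶ G) {U : Opens Y}
    {s : F.presheaf.obj (op ((Opens.map f).obj U))} (hs : HasProperSupport f F s) :
    HasProperSupport f G (φ.hom.app (op ((Opens.map f).obj U)) s) := by
  refine HasProperSupport.of_subset hs hs ?_
  rintro x ⟨hx, h⟩
  refine Or.inl ⟨hx, fun h0 ↦ h ?_⟩
  have := TopCat.Presheaf.stalkFunctor_map_germ_apply ((Opens.map f).obj U) x hx
    ((TopCat.Sheaf.forget (ModuleCat.{u} k) X).map φ) s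
  refine this.symm.trans ?_
  refine (congrArg _ h0).trans (map_zero _)

variable (k) in
/-- The direct image with proper supports `f_!`. -/
def properPushforward (f : X ⟶ Y) : Shv k X ⥤ Shv k Y where
  obj F := ⟨properPushforwardPresheaf f F, isSheaf_properPushforwardPresheaf f F⟩
  map φ := ⟨{
    app U := ModuleCat.ofHom ((φ.hom.app (op ((Opens.map f).obj U.unop))).hom.restrict
      (fun _ hs ↦ HasProperSupport.map φ hs))
    naturality U V i := by
      ext s
      apply Subtype.ext
      exact ConcreteCategory.congr_hom (φ.hom.naturality ((Opens.map f).map i.unop).op) s.1 }⟩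
  map_id F := by
    apply Sheaf.hom_ext
    rfl
  map_comp φ ψ := by
    apply Sheaf.hom_ext
    rfl

instance (f : X ⟶ Y) : (properPushforward k f).Additive where
  map_add {F G φ ψ} := by
    apply Sheaf.hom_ext
    rfl

variable (k) in
/-- The right derived functor `R f_! : D⁺(k_X) ⥤ D⁺(k_Y)` of the direct image with proper
supports. -/
def derivedProperPushforward (f : X ⟶ Y) : DPlus k X ⥤ DPlus k Y :=
  (properPushforward k f).rightDerivedFunctorPlus

end Proper

section PullBack
variable (k : Type u) [Field k] {X Y : TopCat.{u}} (f : X ⟶ Y)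

/-- The inverse image functor `f⁻¹` on sheaves. -/
abbrev pullback : Shv k Y ⥤ Shv k X := TopCat.Sheaf.pullback (ModuleCat.{u} k) f

set_option synthInstance.maxHeartbeats 200000 in
instance : PreservesFiniteLimits (pullback k f) := by
  have : PreservesFiniteLimits ((Opens.map f).op.lan : (_ ⥤ _ ⥤ ModuleCat.{u} k)) :=
    lan_preservesFiniteLimits_of_flat _ _
  exact Functor.sheafPullbackConstruction.preservesFiniteLimits (Opens.map f) (ModuleCat.{u} k)
    (Opens.grothendieckTopology Y) (Opens.grothendieckTopology X)

instance : (pullback k f).Additive := Functor.additive_of_preserves_binary_products _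

/-- The functor `f⁻¹ : D⁺(k_Y) ⥤ D⁺(k_X)` given by the exact functor `f⁻¹` on sheaves, applied
degreewise to complexes. -/
def derivedPullback : DPlus k Y ⥤ DPlus k X :=
  ObjectProperty.lift _ (DerivedCategory.Plus.ι ⋙ (pullback k f).mapDerivedCategory) (by
    rintro ⟨K, hK⟩
    obtain ⟨n, hn⟩ := hK
    have : K.IsGE n := hn
    obtain ⟨L, hL, ⟨e⟩⟩ := DerivedCategory.exists_iso_Q_obj_of_isGE K n
    have : DerivedCategory.TStructure.t.IsGE
        (((pullback k f).mapHomologicalComplex (ComplexShape.up ℤ) ⋙ DerivedCategory.Q).obj L) n :=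
      (DerivedCategory.isGE_Q_obj_iff _ n).2 inferInstance
    exact ⟨n, DerivedCategory.TStructure.t.isGE_of_iso
      (((pullback k f).mapDerivedCategoryFactors.app L).symm ≪≫
        (pullback k f).mapDerivedCategory.mapIso e.symm) n⟩)

end PullBack
section ZeroTensor

open MonoidalCategory

lemma zero_whiskerRight_of_essSurj {C D : Type*} [Category* C] [Category* D]
    [MonoidalCategory C] [MonoidalCategory D] [Preadditive C] [Preadditive D]
    (L : C ⥤ D) [L.Monoidal] [L.EssSurj] [L.PreservesZeroMorphisms]
    (hC : ∀ A B X : C, (0 : A ⟶ B) ▷ X = 0)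
    (F F' G : D) : (0 : F ⟶ F') ▷ G = 0 := by
  let a := L.objObjPreimageIso F
  let b := L.objObjPreimageIso F'
  let c := L.objObjPreimageIso G
  have h : (L.map (0 : L.objPreimage F ⟶ L.objPreimage F')) ▷ (L.obj (L.objPreimage G)) = 0 := by
    have := Functor.Monoidal.map_whiskerRight L (0 : L.objPreimage F ⟶ L.objPreimage F')
      (L.objPreimage G)
    rw [hC, L.map_zero] at this
    rw [← cancel_mono (Functor.LaxMonoidal.μ L _ _), ← cancel_epi (Functor.OplaxMonoidal.δ L _ _)]
    simpa using this.symm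
  have e : (0 : F ⟶ F') = a.inv ≫ L.map 0 ≫ b.hom := by simp
  rw [← cancel_mono (_ ◁ c.inv), ← whisker_exchange, e]
  simp only [comp_whiskerRight, h]
  simp

lemma whiskerLeft_zero_of_essSurj {C D : Type*} [Category* C] [Category* D]
    [MonoidalCategory C] [MonoidalCategory D] [Preadditive C] [Preadditive D]
    (L : C ⥤ D) [L.Monoidal] [L.EssSurj] [L.PreservesZeroMorphisms]
    (hC : ∀ A B X : C, X ◁ (0 : A ⟶ B) = 0)
    (F G G' : D) : F ◁ (0 : G ⟶ G') = 0 := by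
  let a := L.objObjPreimageIso F
  let b := L.objObjPreimageIso G
  let c := L.objObjPreimageIso G'
  have h : (L.obj (L.objPreimage F)) ◁ (L.map (0 : L.objPreimage G ⟶ L.objPreimage G')) = 0 := by
    have := Functor.Monoidal.map_whiskerLeft L (L.objPreimage F)
      (0 : L.objPreimage G ⟶ L.objPreimage G')
    rw [hC, L.map_zero] at this
    rw [← cancel_mono (Functor.LaxMonoidal.μ L _ _), ← cancel_epi (Functor.OplaxMonoidal.δ L _ _)]
    simpa using this.symm
  have e : (0 : G ⟶ G') = b.inv ≫ L.map 0 ≫ c.hom := by simp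
  rw [← cancel_mono (a.inv ▷ _), whisker_exchange, e]
  simp only [MonoidalCategory.whiskerLeft_comp, h]
  simp
end ZeroTensor

section Tensor
variable (k : Type u) [Field k] (X : TopCat.{u})

/-- The tensor product over `k` of sheaves of `k`-vector spaces. -/
def tensor : Shv k X ⥤ Shv k X ⥤ Shv k X :=
  letI := Sheaf.monoidalCategory (Opens.grothendieckTopology X) (ModuleCat.{u} k)
  MonoidalCategory.curriedTensor (Sheaf (Opens.grothendieckTopology X) (ModuleCat.{u} k))

instance : (tensor k X).PreservesZeroMorphisms where
  map_zero F G := by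
    let := Sheaf.monoidalCategory (Opens.grothendieckTopology X) (ModuleCat.{u} k)
    have : (presheafToSheaf (Opens.grothendieckTopology X) (ModuleCat.{u} k)).EssSurj :=
      Localization.essSurj _ ((Opens.grothendieckTopology X).W (A := ModuleCat.{u} k))
    ext H : 2
    refine zero_whiskerRight_of_essSurj
      (presheafToSheaf (Opens.grothendieckTopology X) (ModuleCat.{u} k)) (fun A B P ↦ ?_) F G H
    ext U : 2
    exact MonoidalPreadditive.zero_whiskerRight

instance (F : Shv k X) : ((tensor k X).obj F).PreservesZeroMorphisms where
  map_zero G H := by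
    let := Sheaf.monoidalCategory (Opens.grothendieckTopology X) (ModuleCat.{u} k)
    have : (presheafToSheaf (Opens.grothendieckTopology X) (ModuleCat.{u} k)).EssSurj :=
      Localization.essSurj _ ((Opens.grothendieckTopology X).W (A := ModuleCat.{u} k))
    refine whiskerLeft_zero_of_essSurj
      (presheafToSheaf (Opens.grothendieckTopology X) (ModuleCat.{u} k)) (fun A B P ↦ ?_) F G H
    ext U : 2
    exact MonoidalPreadditive.whiskerLeft_zero

/-- The tensor product of two bounded below complexes of sheaves: the total complex of the double
complex `K i ⊗ L j`. -/
def totTensor (K L : CochainComplex.Plus (Shv k X)) : CochainComplex.Plus (Shv k X) :=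
  ⟨HomologicalComplex.mapBifunctor K.obj L.obj (tensor k X) (ComplexShape.up ℤ), by
    obtain ⟨K, a, hK⟩ := K
    obtain ⟨L, b, hL⟩ := L
    refine ⟨a + b, (CochainComplex.isStrictlyGE_iff _ _).2 fun n hn ↦ ?_⟩
    rw [IsZero.iff_id_eq_zero]
    apply HomologicalComplex.mapBifunctor.hom_ext
    intro i j hij
    apply IsZero.eq_of_src
    have hij' : i + j = n := hij
    by_cases hi : i < a
    · exact (((tensor k X).map_isZero (K.isZero_of_isStrictlyGE a i hi)).obj _)
    · exact ((tensor k X).obj (K.X i)).map_isZero (L.isZero_of_isStrictlyGE b j (by lia))⟩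

instance : (DerivedCategory.Plus.Q (C := Shv k X)).EssSurj :=
  inferInstanceAs ((HomotopyCategory.Plus.quotient (Shv k X) ⋙ DerivedCategory.Plus.Qh).EssSurj)

/-- The tensor product of two objects of `D⁺(k_X)`: the class of the tensor product complex of two
bounded below complexes of sheaves that represent them. As `k` is a field, the tensor product of
sheaves is exact in both variables, so that no resolution is needed and, up to isomorphism, the
result does not depend on the representatives. -/
def derivedTensor {k : Type u} [Field k] {X : TopCat.{u}} (F G : DPlus k X) : DPlus k X :=
  DerivedCategory.Plus.Q.obj (totTensor k X (DerivedCategory.Plus.Q.objPreimage F)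
    (DerivedCategory.Plus.Q.objPreimage G))

end Tensor

section Convolution

variable (k : Type u) [Field k]

/-- The sheaf `k_Z` on `X`, for a closed subset `Z` of `X`: the extension by zero of the constant
sheaf with stalk `k` on `Z` (for a closed subset, this is the direct image). -/
def constantSheafOn (X : TopCat.{u}) (Z : Set X) : Shv k X :=
  (TopCat.Sheaf.pushforward (ModuleCat.{u} k)
    (TopCat.ofHom ⟨Subtype.val, continuous_subtype_val⟩ : TopCat.of Z ⟶ X)).obj
      ((constantSheaf (Opens.grothendieckTopology (TopCat.of Z)) (ModuleCat.{u} k)).obj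
        (ModuleCat.of k k))

variable (M : Type u) [TopologicalSpace M]

/-- `π₁(m₁, m₂, t₁, t₂) = (m₁, t₁)`. -/
def projOne : TopCat.of (M × M × ℝ × ℝ) ⟶ TopCat.of (M × ℝ) :=
  TopCat.ofHom ⟨fun x ↦ (x.1, x.2.2.1), by fun_prop⟩

/-- `π₂(m₁, m₂, t₁, t₂) = (m₂, t₂)`. -/
def projTwo : TopCat.of (M × M × ℝ × ℝ) ⟶ TopCat.of (M × ℝ) :=
  TopCat.ofHom ⟨fun x ↦ (x.2.1, x.2.2.2), by fun_prop⟩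

/-- `s(m₁, m₂, t₁, t₂) = (m₁, m₂, t₁ + t₂)`. -/
def sumMap : TopCat.of (M × M × ℝ × ℝ) ⟶ TopCat.of (M × M × ℝ) :=
  TopCat.ofHom ⟨fun x ↦ (x.1, x.2.1, x.2.2.1 + x.2.2.2), by fun_prop⟩

/-- `δ(m, t) = (m, m, t)`. -/
def diagMap : TopCat.of (M × ℝ) ⟶ TopCat.of (M × M × ℝ) :=
  TopCat.ofHom ⟨fun x ↦ (x.1, x.1, x.2), by fun_prop⟩

variable {k M} in
/-- The convolution `F * G = δ⁻¹ R s_! (π₁⁻¹ F ⊗ π₂⁻¹ G)` of two objects of `D⁺(k_{M × ℝ})`. -/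
def convolution (F G : DPlus k (TopCat.of (M × ℝ))) : DPlus k (TopCat.of (M × ℝ)) :=
  (derivedPullback k (diagMap M)).obj ((derivedProperPushforward k (sumMap M)).obj
    (derivedTensor ((derivedPullback k (projOne M)).obj F) ((derivedPullback k (projTwo M)).obj G)))

variable {M} {N : ℕ}

/-- The closed subset `N_S = {(m, ξ, t) | S(m, ξ) + t ≥ 0}` of `M × ℝ^N × ℝ`. -/
def superlevelSet (S : M × EuclideanSpace ℝ (Fin N) → ℝ) :
    Set (M × EuclideanSpace ℝ (Fin N) × ℝ) :=
  {x | 0 ≤ S (x.1, x.2.1) + x.2.2}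

variable (M N) in
/-- The projection `p : M × ℝ^N × ℝ → M × ℝ`. -/
def fiberProj : TopCat.of (M × EuclideanSpace ℝ (Fin N) × ℝ) ⟶ TopCat.of (M × ℝ) :=
  TopCat.ofHom ⟨fun x ↦ (x.1, x.2.2), by fun_prop⟩

/-- The sheaf `F_S = R p_! k_{N_S}`, an object of `D⁺(k_{M × ℝ})`, where `k_{N_S}` is seen as a
complex concentrated in degree `0`. -/
def canonicalSheaf (S : M × EuclideanSpace ℝ (Fin N) → ℝ) : DPlus k (TopCat.of (M × ℝ)) :=
  (derivedProperPushforward k (fiberProj M N)).obj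
    ((DerivedCategory.Plus.singleFunctor (Shv k (TopCat.of (M × EuclideanSpace ℝ (Fin N) × ℝ)))
      0).obj (constantSheafOn k (TopCat.of (M × EuclideanSpace ℝ (Fin N) × ℝ)) (superlevelSet S)))

end Convolution

section GeneratingFunction

variable {n : ℕ} {M : Type u} [TopologicalSpace M] [ChartedSpace (EuclideanSpace ℝ (Fin n)) M]

variable (n M) in
/-- The cotangent bundle `T^*M`, as a set: the pairs of a point `m` of `M` and a covector at `m`. -/
abbrev Cotangent : Type u :=
  Σ m : M, TangentSpace (𝓡 n) m →L[ℝ] ℝ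

/-- The differential at `m` of `S(·, ξ)`, that is `∂_m S(m, ξ)`. -/
def baseDeriv {N : ℕ} (S : M × EuclideanSpace ℝ (Fin N) → ℝ) (m : M)
    (ξ : EuclideanSpace ℝ (Fin N)) : TangentSpace (𝓡 n) m →L[ℝ] ℝ :=
  mfderiv (𝓡 n) 𝓘(ℝ, ℝ) (fun m' ↦ S (m', ξ)) m

/-- `S : M × ℝ^N → ℝ` is a generating function of the subset `L` of `T^*M`: it is smooth, and
`L = {(m, ∂_m S(m, ξ)) | ∂_ξ S(m, ξ) = 0}`. -/
structure IsGeneratingFunction {N : ℕ} (S : M × EuclideanSpace ℝ (Fin N) → ℝ)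
    (L : Set (Cotangent n M)) : Prop where
  smooth : ContMDiff ((𝓡 n).prod (𝓡 N)) 𝓘(ℝ, ℝ) ∞ S
  eq : L = {a | ∃ ξ : EuclideanSpace ℝ (Fin N), fderiv ℝ (fun η ↦ S (a.1, η)) ξ = 0 ∧
    a.2 = baseDeriv S a.1 ξ}

/-- The fiberwise sum `L₁ +_b L₂ = {(m, p₁ + p₂) | (m, p₁) ∈ L₁, (m, p₂) ∈ L₂}`. -/
def fiberwiseSum (L₁ L₂ : Set (Cotangent n M)) : Set (Cotangent n M) :=
  {a | ∃ p₁ p₂ : TangentSpace (𝓡 n) a.1 →L[ℝ] ℝ,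
    ⟨a.1, p₁⟩ ∈ L₁ ∧ ⟨a.1, p₂⟩ ∈ L₂ ∧ a.2 = p₁ + p₂}

/-- The function `S(m, ξ₁, ξ₂) = S₁(m, ξ₁) + S₂(m, ξ₂)` on `M × ℝ^(ℓ₁ + ℓ₂)`. -/
def fiberSumFunction {M : Type u} {l₁ l₂ : ℕ} (S₁ : M × EuclideanSpace ℝ (Fin l₁) → ℝ)
    (S₂ : M × EuclideanSpace ℝ (Fin l₂) → ℝ) : M × EuclideanSpace ℝ (Fin (l₁ + l₂)) → ℝ :=
  fun x ↦ S₁ (x.1, (EuclideanSpace.finAddEquivProd x.2).1) +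
    S₂ (x.1, (EuclideanSpace.finAddEquivProd x.2).2)

/-- `F` is a canonical sheaf of `L ⊆ T^*M`: it is isomorphic to `F_S` for some generating
function `S` of `L`. -/
def IsCanonicalSheafOf (k : Type u) [Field k] (F : DPlus k (TopCat.of (M × ℝ)))
    (L : Set (Cotangent n M)) : Prop :=
  ∃ (N : ℕ) (S : M × EuclideanSpace ℝ (Fin N) → ℝ),
    IsGeneratingFunction S L ∧ Nonempty (F ≅ canonicalSheaf k S)

end GeneratingFunction

end SheafConvolution

end

/-! Write X_i = M × ℝ^(l_i) × ℝ and resolve the constant sheaf on N_(S_i) by a complex A_i of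
injective sheaves. Then F_(S_i) is p_i! A_i, and the convolution is δ⁻¹ s_! of the total complex of
π₁⁻¹ p₁! A₁ ⊗ π₂⁻¹ p₂! A₂: the tensor product over a field needs no resolution, and these tensor
products are c-soft, so s_! needs none either. Let Z be the fibre product of X₁ and X₂ over M, with
coordinates ((m, ξ, t), t₁) where t = t₁ + t₂. A natural Künneth morphism of sheaves goes from this
complex, before δ⁻¹, to the proper direct image on M × M × ℝ of the external tensor product of A₁
and A₂ on Z. It is bijective on stalks over the diagonal, hence an isomorphism after δ⁻¹. The map
from Z to M × M × ℝ is the projection pr forgetting t₁, followed by p and then δ; as δ⁻¹ δ_! is the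
identity, the convolution becomes p_! pr_! of the external tensor product.

That product resolves the constant sheaf on the set S₁(m, ξ₁) + t₁ ≥ 0, S₂(m, ξ₂) + t - t₁ ≥ 0. Its
fibre under pr is the interval -S₁ ≤ t₁ ≤ S₂ + t, which is compact, and nonempty exactly when S + t
≥ 0. A compact interval has only the cohomology k in degree 0, so pr_! gives a c-soft resolution of
the constant sheaf on N_S, and p_! of it is F_S. For the generating function, ξ is critical for S if
and only if ξ₁ and ξ₂ are critical for S₁ and S₂, and the derivatives along M add.

The sheaf theory is carried by `exactAt_properPushforward` (proper direct images of acyclic c-soft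
complexes), `Fine.of_injective` and `Fine.exists_boxMap` (cut-off operators, giving c-softness of
the tensor products), `quasiIso_mapBifunctorMap_tensor` (exactness of the tensor product),
`injective_stmap_kunnethHom` and `surjective_stmap_kunnethHom` (Künneth), and
`exists_quasiIso_lineProj` (fibres that are intervals). Constant sheaves on closed sets are
recognized by a single global section, see `IsCharSection`, so that they are never compared through
their construction. -/

noncomputable section

namespace SheafConvolution

/-! ### Sections, germs and morphisms of sheaves in terms of stalks -/

section Germs

/-- The sections of a sheaf over an open set. -/
abbrev sec {k : Type u} [Field k] {X : TopCat.{u}} (F : Shv k X) (U : Opens X) : Type u :=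
  F.presheaf.obj (op U)

/-- The stalk of a sheaf at a point. -/
abbrev stk {k : Type u} [Field k] {X : TopCat.{u}} (F : Shv k X) (x : X) : Type u :=
  F.presheaf.stalk x

variable {k : Type u} [Field k] {X Y Z : TopCat.{u}}

open Classical in
/-- The germ of a section, extended by zero outside of its domain. -/
def gm {F : Shv k X} {U : Opens X} (s : sec F U) (x : X) : stk F x :=
  if hx : x ∈ U then F.presheaf.germ U x hx s else 0

/-- The restriction of a section to a smaller open set. -/
def res {F : Shv k X} {U V : Opens X} (h : V ≤ U) : sec F U →ₗ[k] sec F V :=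
  (F.presheaf.map (homOfLE h).op).hom

/-- The map induced on sections by a morphism of sheaves. -/
def smap {F G : Shv k X} (φ : F ⟶ G) (U : Opens X) : sec F U →ₗ[k] sec G U :=
  (φ.hom.app (op U)).hom

/-- The map induced on stalks by a morphism of sheaves. -/
def stmap {F G : Shv k X} (φ : F ⟶ G) (x : X) : stk F x →ₗ[k] stk G x :=
  ((TopCat.Presheaf.stalkFunctor (ModuleCat.{u} k) x).map φ.hom).hom

lemma gm_of_mem {F : Shv k X} {U : Opens X} (s : sec F U) {x : X} (hx : x ∈ U) :
    gm s x = F.presheaf.germ U x hx s := dif_pos hx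

lemma gm_of_notMem {F : Shv k X} {U : Opens X} (s : sec F U) {x : X} (hx : x ∉ U) :
    gm s x = 0 := dif_neg hx

@[simp]
lemma gm_zero {F : Shv k X} {U : Opens X} (x : X) : gm (0 : sec F U) x = 0 := by
  by_cases hx : x ∈ U
  · rw [gm_of_mem _ hx, map_zero]
  · rw [gm_of_notMem _ hx]

@[simp]
lemma gm_add {F : Shv k X} {U : Opens X} (s t : sec F U) (x : X) :
    gm (s + t) x = gm s x + gm t x := by
  by_cases hx : x ∈ U
  · simp only [gm_of_mem _ hx, map_add]
  · simp only [gm_of_notMem _ hx, add_zero]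

@[simp]
lemma gm_sub {F : Shv k X} {U : Opens X} (s t : sec F U) (x : X) :
    gm (s - t) x = gm s x - gm t x := by
  by_cases hx : x ∈ U
  · simp only [gm_of_mem _ hx, map_sub]
  · simp only [gm_of_notMem _ hx, sub_zero]

@[simp]
lemma gm_smul {F : Shv k X} {U : Opens X} (c : k) (s : sec F U) (x : X) :
    gm (c • s) x = c • gm s x := by
  by_cases hx : x ∈ U
  · simp only [gm_of_mem _ hx]
    exact (F.presheaf.germ U x hx).hom.map_smul c s
  · simp only [gm_of_notMem _ hx, smul_zero]

lemma gm_sum {F : Shv k X} {U : Opens X} {ι : Type*} (I : Finset ι) (s : ι → sec F U) (x : X) :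
    gm (∑ i ∈ I, s i) x = ∑ i ∈ I, gm (s i) x := by
  classical
  induction I using Finset.induction_on with
  | empty => simp
  | insert i I hi h => simp [Finset.sum_insert hi, h]

@[simp]
lemma gm_res {F : Shv k X} {U V : Opens X} (h : V ≤ U) (s : sec F U) {x : X} (hx : x ∈ V) :
    gm (res h s) x = gm s x := by
  rw [gm_of_mem _ hx, gm_of_mem _ (h hx)]
  exact TopCat.Presheaf.germ_res_apply F.presheaf (homOfLE h) x hx s

lemma gm_smap {F G : Shv k X} (φ : F ⟶ G) {U : Opens X} (s : sec F U) (x : X) :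
    gm (smap φ U s) x = stmap φ x (gm s x) := by
  by_cases hx : x ∈ U
  · rw [gm_of_mem _ hx, gm_of_mem _ hx]
    exact (TopCat.Presheaf.stalkFunctor_map_germ_apply U x hx φ.hom s).symm
  · rw [gm_of_notMem _ hx, gm_of_notMem _ hx, map_zero]

lemma sec_ext {F : Shv k X} {U : Opens X} {s t : sec F U} (h : ∀ x ∈ U, gm s x = gm t x) :
    s = t := by
  refine TopCat.Presheaf.section_ext F U s t fun x hx ↦ ?_
  have := h x hx
  rwa [gm_of_mem _ hx, gm_of_mem _ hx] at this

lemma exists_gm {F : Shv k X} {x : X} (e : stk F x) :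
    ∃ (U : Opens X) (_ : x ∈ U) (s : sec F U), gm s x = e := by
  obtain ⟨U, hx, s, rfl⟩ := TopCat.Presheaf.exists_germ_eq F.presheaf e
  exact ⟨U, hx, s, gm_of_mem s hx⟩

lemma exists_gm_le {F : Shv k X} {x : X} (e : stk F x) {V : Opens X} (hV : x ∈ V) :
    ∃ (U : Opens X) (_ : x ∈ U) (_ : U ≤ V) (s : sec F U), gm s x = e := by
  obtain ⟨U, hx, s, rfl⟩ := exists_gm e
  exact ⟨U ⊓ V, ⟨hx, hV⟩, inf_le_right, res inf_le_left s, gm_res _ _ ⟨hx, hV⟩⟩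

lemma exists_gm_eq {F : Shv k X} {U V : Opens X} {x : X} (hU : x ∈ U) (hV : x ∈ V) {s : sec F U}
    {t : sec F V} (h : gm s x = gm t x) :
    ∃ W : Opens X, x ∈ W ∧ W ≤ U ∧ W ≤ V ∧ ∀ y ∈ W, gm s y = gm t y := by
  rw [gm_of_mem _ hU, gm_of_mem _ hV] at h
  obtain ⟨W, hW, i, j, hij⟩ := TopCat.Presheaf.germ_eq F.presheaf x hU hV s t h
  refine ⟨W, hW, i.le, j.le, fun y hy ↦ ?_⟩
  rw [← gm_res i.le s hy, ← gm_res j.le t hy]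
  exact congrArg (fun r : sec F W ↦ gm r y) hij

lemma exists_gm_eq_zero {F : Shv k X} {U : Opens X} {x : X} (hU : x ∈ U) {s : sec F U}
    (h : gm s x = 0) : ∃ W : Opens X, x ∈ W ∧ W ≤ U ∧ ∀ y ∈ W, gm s y = 0 := by
  obtain ⟨W, hW, h1, -, h2⟩ := exists_gm_eq (t := (0 : sec F U)) hU hU (by rw [h, gm_zero])
  exact ⟨W, hW, h1, fun y hy ↦ by rw [h2 y hy, gm_zero]⟩

lemma mem_sectionSupport {F : Shv k X} {U : Opens X} {s : sec F U} {x : X} :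
    x ∈ sectionSupport F s ↔ gm s x ≠ 0 := by
  constructor
  · rintro ⟨hx, h⟩
    rwa [gm_of_mem _ hx]
  · intro h
    have hx : x ∈ U := by
      by_contra hx
      exact h (gm_of_notMem _ hx)
    exact ⟨hx, by rwa [gm_of_mem _ hx] at h⟩

/-- A family of germs which is locally given by sections is given by a section. -/
lemma exists_section {F : Shv k X} (V : Opens X) (e : ∀ x : X, stk F x)
    (h : ∀ x ∈ V, ∃ (U : Opens X) (_ : x ∈ U) (s : sec F U), ∀ y ∈ U, y ∈ V → gm s y = e y) :
    ∃ t : sec F V, ∀ x ∈ V, gm t x = e x := by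
  choose U hU s hs using h
  let W : V → Opens X := fun x ↦ U x.1 x.2 ⊓ V
  let r : ∀ x : V, sec F (W x) := fun x ↦ res inf_le_left (s x.1 x.2)
  have hr : ∀ (x : V) (y : X) (_ : y ∈ W x), gm (r x) y = e y := fun x y hy ↦ by
    rw [gm_res _ _ hy, hs x.1 x.2 y hy.1 hy.2]
  obtain ⟨t, ht, -⟩ := TopCat.Sheaf.existsUnique_gluing' F W V (fun x ↦ homOfLE inf_le_right)
    (fun x hx ↦ Opens.mem_iSup.2 ⟨⟨x, hx⟩, hU x hx, hx⟩) r (by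
      intro x y
      refine sec_ext (F := F) (U := W x ⊓ W y) fun z hz ↦ ?_
      refine (gm_res (F := F) (inf_le_left : W x ⊓ W y ≤ W x) (r x) hz).trans ?_
      refine Eq.trans ?_ (gm_res (F := F) (inf_le_right : W x ⊓ W y ≤ W y) (r y) hz).symm
      rw [hr x z hz.1, hr y z hz.2])
  refine ⟨t, fun x hx ↦ ?_⟩
  have hxW : x ∈ W ⟨x, hx⟩ := ⟨hU x hx, hx⟩
  rw [← hr ⟨x, hx⟩ x hxW, ← ht ⟨x, hx⟩]
  exact (gm_res (F := F) (inf_le_right : W ⟨x, hx⟩ ≤ V) t hxW).symm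

@[simp]
lemma stmap_id (F : Shv k X) (x : X) : stmap (𝟙 F) x = LinearMap.id := by
  change ((TopCat.Presheaf.stalkFunctor (ModuleCat.{u} k) x).map (𝟙 F.obj)).hom = _
  rw [CategoryTheory.Functor.map_id]
  rfl

@[simp]
lemma stmap_comp {F G H : Shv k X} (φ : F ⟶ G) (ψ : G ⟶ H) (x : X) :
    stmap (φ ≫ ψ) x = stmap ψ x ∘ₗ stmap φ x := by
  change ((TopCat.Presheaf.stalkFunctor (ModuleCat.{u} k) x).map (φ.hom ≫ ψ.hom)).hom = _
  rw [CategoryTheory.Functor.map_comp]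
  rfl

lemma hom_ext_stmap {F G : Shv k X} {φ ψ : F ⟶ G} (h : ∀ x, stmap φ x = stmap ψ x) : φ = ψ := by
  apply Sheaf.hom_ext
  ext U s
  change smap φ U.unop s = smap ψ U.unop s
  refine sec_ext fun x _ ↦ ?_
  rw [gm_smap, gm_smap, h]

lemma hom_ext_smap {F G : Shv k X} {φ ψ : F ⟶ G} (h : ∀ U, smap φ U = smap ψ U) : φ = ψ := by
  apply Sheaf.hom_ext
  ext U s
  exact LinearMap.congr_fun (h U.unop) s

lemma stmap_ext {F G : Shv k X} {x : X} {φ ψ : stk F x →ₗ[k] stk G x}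
    (h : ∀ (U : Opens X) (_ : x ∈ U) (s : sec F U), φ (gm s x) = ψ (gm s x)) : φ = ψ := by
  ext e
  obtain ⟨U, hU, s, rfl⟩ := exists_gm e
  exact h U hU s

/-- The stalk at a point, as a functor on sheaves. -/
abbrev stalkAt (k : Type u) [Field k] {X : TopCat.{u}} (x : X) : Shv k X ⥤ ModuleCat.{u} k :=
  TopCat.Sheaf.forget (ModuleCat.{u} k) X ⋙ TopCat.Presheaf.stalkFunctor (ModuleCat.{u} k) x

lemma stalkAt_map_hom {F G : Shv k X} (φ : F ⟶ G) (x : X) :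
    ((stalkAt k x).map φ).hom = stmap φ x := rfl

@[simp]
lemma stmap_zero (F G : Shv k X) (x : X) : stmap (0 : F ⟶ G) x = 0 := by
  rw [← stalkAt_map_hom, Functor.map_zero]
  rfl

@[simp]
lemma stmap_add {F G : Shv k X} (φ ψ : F ⟶ G) (x : X) :
    stmap (φ + ψ) x = stmap φ x + stmap ψ x := by
  simp only [← stalkAt_map_hom, Functor.map_add]
  rfl

@[simp]
lemma stmap_sub {F G : Shv k X} (φ ψ : F ⟶ G) (x : X) :
    stmap (φ - ψ) x = stmap φ x - stmap ψ x := by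
  simp only [← stalkAt_map_hom, Functor.map_sub]
  rfl

lemma isIso_of_stmap_bijective {F G : Shv k X} {φ : F ⟶ G}
    (h : ∀ x, Function.Bijective (stmap φ x)) : IsIso φ := by
  rw [TopCat.Presheaf.isIso_iff_stalkFunctor_map_iso]
  intro x
  rw [ConcreteCategory.isIso_iff_bijective]
  exact h x

lemma exact_iff_stmap (S : ShortComplex (Shv k X)) :
    S.Exact ↔ ∀ x, Function.Exact (stmap S.f x) (stmap S.g x) := by
  rw [TopCat.Sheaf.exact_iff_stalkFunctor_map_exact]
  refine forall_congr' fun x ↦ ?_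
  rw [ShortComplex.ShortExact.moduleCat_exact_iff_function_exact]
  rfl

lemma mono_iff_stmap {F G : Shv k X} (φ : F ⟶ G) :
    Mono φ ↔ ∀ x, Function.Injective (stmap φ x) := by
  rw [TopCat.Presheaf.mono_iff_stalk_mono]
  exact forall_congr' fun x ↦ ModuleCat.mono_iff_injective _

/-- A family of maps on stalks which is locally compatible with sections. -/
def IsContinuousFamily (f : Z ⟶ Y) (F : Shv k Y) (G : Shv k Z)
    (φ : ∀ z : Z, stk F (f z) →ₗ[k] stk G z) : Prop :=
  ∀ (z : Z) (e : stk F (f z)), ∃ (U : Opens Y) (s : sec F U) (V : Opens Z) (t : sec G V),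
    f z ∈ U ∧ z ∈ V ∧ gm s (f z) = e ∧ ∀ y ∈ V, gm t y = φ y (gm s (f y))

lemma IsContinuousFamily.exists_section {f : Z ⟶ Y} {F : Shv k Y} {G : Shv k Z}
    {φ : ∀ z : Z, stk F (f z) →ₗ[k] stk G z} (h : IsContinuousFamily f F G φ) {U : Opens Y}
    (s : sec F U) :
    ∃ t : sec G ((Opens.map f).obj U), ∀ z : Z, gm t z = φ z (gm s (f z)) := by
  obtain ⟨t, ht⟩ := SheafConvolution.exists_section (F := G) ((Opens.map f).obj U)
    (fun z ↦ φ z (gm s (f z))) (fun z hz ↦ by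
      obtain ⟨U', s', V, t, hU', hV, hs', ht⟩ := h z (gm s (f z))
      obtain ⟨W, hW, -, -, hWe⟩ := exists_gm_eq (U := U') (V := U) hU' hz hs'
      refine ⟨V ⊓ (Opens.map f).obj W, ⟨hV, hW⟩, res inf_le_left t, fun y hy _ ↦ ?_⟩
      rw [gm_res _ _ hy, ht y hy.1, hWe _ hy.2])
  refine ⟨t, fun z ↦ ?_⟩
  by_cases hz : z ∈ (Opens.map f).obj U
  · exact ht z hz
  · rw [gm_of_notMem _ hz, gm_of_notMem (F := F) _ (x := f z) hz, map_zero]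

/-- The morphism of sheaves given by compatible maps on sections. -/
def homMk {F G : Shv k X} (φ : ∀ U : Opens X, sec F U →ₗ[k] sec G U)
    (h : ∀ {U V : Opens X} (hUV : V ≤ U) (s : sec F U), φ V (res hUV s) = res hUV (φ U s)) :
    F ⟶ G :=
  ⟨{ app U := ModuleCat.ofHom (φ U.unop)
     naturality U V i := by
      ext s
      exact h i.unop.le s }⟩

/-- A continuous family of maps on stalks is given by a morphism of sheaves. -/
lemma exists_hom_of_stalks {F G : Shv k X} (φ : ∀ x : X, stk F x →ₗ[k] stk G x)
    (h : IsContinuousFamily (𝟙 X) F G φ) : ∃ Φ : F ⟶ G, ∀ x, stmap Φ x = φ x := by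
  have h' : ∀ (U : Opens X) (s : sec F U), ∃ t : sec G U, ∀ x, gm t x = φ x (gm s x) :=
    fun U s ↦ h.exists_section s
  choose t ht using h'
  let Φ : F ⟶ G := homMk (fun U ↦
    { toFun := t U
      map_add' := fun a b ↦ sec_ext fun x _ ↦ by simp [ht]
      map_smul' := fun a b ↦ sec_ext fun x _ ↦ by simp [ht] })
    (fun hUV s ↦ sec_ext fun x hx ↦ by simp [ht, gm_res _ _ hx])
  refine ⟨Φ, fun x ↦ stmap_ext fun U hU s ↦ ?_⟩
  rw [← gm_smap, ← ht]
  rfl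

end Germs

end SheafConvolution

end

noncomputable section

namespace SheafConvolution

/-! ### The tensor product of sheaves as a sheafified presheaf tensor product -/

section SheafTensor

open MonoidalCategory

attribute [local instance] CategoryTheory.Sheaf.monoidalCategory

variable {C : Type*} [Category* C] (J : GrothendieckTopology C) {A : Type*} [Category* A]
  [MonoidalCategory A] [(J.W (A := A)).IsMonoidal] [HasSheafify J A]

/-- The canonical isomorphism between the sheafified tensor product of the underlying presheaves
of two sheaves and their tensor product. -/
def sheafifyTensorIso (F G : Sheaf J A) :
    (presheafToSheaf J A).obj (F.obj ⊗ G.obj) ≅ F ⊗ G :=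
  (Functor.Monoidal.μIso (presheafToSheaf J A) F.obj G.obj).symm ≪≫
    (asIso ((sheafificationAdjunction J A).counit.app F) ⊗ᵢ
      asIso ((sheafificationAdjunction J A).counit.app G))

lemma sheafifyTensorIso_hom_naturality {F F' G G' : Sheaf J A} (φ : F ⟶ F') (ψ : G ⟶ G') :
    (presheafToSheaf J A).map (φ.hom ⊗ₘ ψ.hom) ≫ (sheafifyTensorIso J F' G').hom =
      (sheafifyTensorIso J F G).hom ≫ (φ ⊗ₘ ψ) := by
  have hφ := (sheafificationAdjunction J A).counit.naturality φ
  have hψ := (sheafificationAdjunction J A).counit.naturality ψ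
  dsimp at hφ hψ
  simp only [sheafifyTensorIso, Iso.trans_hom, Iso.symm_hom, Functor.Monoidal.μIso_inv,
    tensorIso_hom, asIso_hom, Category.assoc, tensorHom_comp_tensorHom]
  rw [← hφ, ← hψ, ← tensorHom_comp_tensorHom, Functor.OplaxMonoidal.δ_natural_assoc]

/-- The canonical morphism from the tensor product of the underlying presheaves of two sheaves to
their tensor product. -/
def tensorToSheafTensor (F G : Sheaf J A) : F.obj ⊗ G.obj ⟶ (F ⊗ G).obj :=
  toSheafify J _ ≫ (sheafToPresheaf J A).map (sheafifyTensorIso J F G).hom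

lemma tensorToSheafTensor_naturality {F F' G G' : Sheaf J A} (φ : F ⟶ F') (ψ : G ⟶ G') :
    tensorToSheafTensor J F G ≫ (sheafToPresheaf J A).map (φ ⊗ₘ ψ) =
      (φ.hom ⊗ₘ ψ.hom) ≫ tensorToSheafTensor J F' G' := by
  have h := (sheafificationAdjunction J A).unit.naturality (φ.hom ⊗ₘ ψ.hom)
  dsimp at h
  simp only [tensorToSheafTensor, Category.assoc, ← Functor.map_comp,
    ← sheafifyTensorIso_hom_naturality]
  rw [Functor.map_comp]
  exact (reassoc_of% h.symm) _

end SheafTensor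

/-! ### Stalks of tensor products -/

section TensorStalk

open MonoidalCategory GrothendieckTopology

variable {k : Type u} [Field k] {X : TopCat.{u}}

/-- The comparison between the two definitions of the stalk of a presheaf. -/
def stalkIsoFiber (P : TopCat.Presheaf (ModuleCat.{u} k) X) (x : X) :
    P.stalk x ≅ (Opens.pointGrothendieckTopology x).presheafFiber.obj P where
  hom := colimit.desc _
    { pt := _
      ι :=
        { app U := (Opens.pointGrothendieckTopology x).toPresheafFiber U.unop.1
            ⟨⟨U.unop.2⟩⟩ P
          naturality U V i := by
            refine Eq.trans ?_ (Category.comp_id _).symm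
            exact (Opens.pointGrothendieckTopology x).toPresheafFiber_w
              ((OpenNhds.inclusion x).map i.unop) ⟨⟨V.unop.2⟩⟩ P } }
  inv := (Opens.pointGrothendieckTopology x).presheafFiberDesc
    (fun U h ↦ P.germ U x h.down.down)
    (fun U V f h ↦ P.germ_res f x h.down.down)
  hom_inv_id := by
    refine P.stalk_hom_ext fun U hU ↦ ?_
    rw [Category.comp_id]
    erw [colimit.ι_desc_assoc]
    exact (Opens.pointGrothendieckTopology x).toPresheafFiber_presheafFiberDesc _ _ U ⟨⟨hU⟩⟩
  inv_hom_id := by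
    refine GrothendieckTopology.Point.presheafFiber_hom_ext _ fun U h ↦ ?_
    rw [Category.comp_id]
    refine (GrothendieckTopology.Point.toPresheafFiber_presheafFiberDesc_assoc _ _ _ U h _).trans ?_
    exact colimit.ι_desc _ _

lemma stalkIsoFiber_hom_germ (P : TopCat.Presheaf (ModuleCat.{u} k) X) {x : X} {U : Opens X}
    (hU : x ∈ U) (s : P.obj (op U)) :
    (stalkIsoFiber P x).hom (P.germ U x hU s) =
      (Opens.pointGrothendieckTopology x).toPresheafFiber U ⟨⟨hU⟩⟩ P s := by
  have : P.germ U x hU ≫ (stalkIsoFiber P x).hom =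
      (Opens.pointGrothendieckTopology x).toPresheafFiber U ⟨⟨hU⟩⟩ P := colimit.ι_desc _ _
  exact ConcreteCategory.congr_hom this s

/-- The tensor product of presheaves. -/
abbrev presheafTensor (P Q : TopCat.Presheaf (ModuleCat.{u} k) X) :
    TopCat.Presheaf (ModuleCat.{u} k) X :=
  MonoidalCategory.tensorObj (C := (Opens X)ᵒᵖ ⥤ ModuleCat.{u} k) P Q

/-- The canonical isomorphism between the stalk of the tensor product of two presheaves and the
tensor product of their stalks. -/
def presheafTensorStalk (P Q : TopCat.Presheaf (ModuleCat.{u} k) X) (x : X) :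
    (presheafTensor P Q).stalk x ≅ P.stalk x ⊗ Q.stalk x :=
  stalkIsoFiber _ x ≪≫
    asIso (Functor.OplaxMonoidal.δ (Opens.pointGrothendieckTopology x).presheafFiber P Q) ≪≫
    (stalkIsoFiber P x ⊗ᵢ stalkIsoFiber Q x).symm

lemma presheafTensorStalk_hom_germ (P Q : TopCat.Presheaf (ModuleCat.{u} k) X) {x : X}
    {U : Opens X} (hU : x ∈ U) (s : P.obj (op U)) (t : Q.obj (op U)) :
    (presheafTensorStalk P Q x).hom ((presheafTensor P Q).germ U x hU (s ⊗ₜ[k] t)) =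
      P.germ U x hU s ⊗ₜ[k] Q.germ U x hU t := by
  let i := stalkIsoFiber P x ⊗ᵢ stalkIsoFiber Q x
  have h : i.inv (i.hom (P.germ U x hU s ⊗ₜ[k] Q.germ U x hU t)) =
      P.germ U x hU s ⊗ₜ[k] Q.germ U x hU t :=
    ConcreteCategory.congr_hom i.hom_inv_id (P.germ U x hU s ⊗ₜ[k] Q.germ U x hU t)
  rw [← h]
  refine congrArg i.inv ?_
  have h2 : i.hom (P.germ U x hU s ⊗ₜ[k] Q.germ U x hU t) =
      (stalkIsoFiber P x).hom (P.germ U x hU s) ⊗ₜ[k]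
        (stalkIsoFiber Q x).hom (Q.germ U x hU t) := rfl
  rw [h2, stalkIsoFiber_hom_germ, stalkIsoFiber_hom_germ]
  refine (congrArg (Functor.OplaxMonoidal.δ
    (Opens.pointGrothendieckTopology x).presheafFiber P Q)
    (stalkIsoFiber_hom_germ (presheafTensor P Q) hU (s ⊗ₜ[k] t))).trans ?_
  exact ConcreteCategory.congr_hom
    ((Opens.pointGrothendieckTopology x).toPresheafFiber_δ U ⟨⟨hU⟩⟩ P Q) (s ⊗ₜ[k] t)

/-- The tensor product of sheaves. -/
abbrev tens (F G : Shv k X) : Shv k X := ((tensor k X).obj F).obj G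

/-- The morphism induced on tensor products of sheaves. -/
abbrev tensMap {F F' G G' : Shv k X} (φ : F ⟶ F') (ψ : G ⟶ G') : tens F G ⟶ tens F' G' :=
  ((tensor k X).map φ).app G ≫ ((tensor k X).obj F').map ψ

/-- The canonical morphism from the tensor product of the underlying presheaves of two sheaves to
their tensor product. -/
def presheafTensorTo (F G : Shv k X) : presheafTensor F.obj G.obj ⟶ (tens F G).obj :=
  tensorToSheafTensor (Opens.grothendieckTopology X) F G

lemma presheafTensorTo_naturality {F F' G G' : Shv k X} (φ : F ⟶ F') (ψ : G ⟶ G') :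
    presheafTensorTo F G ≫ (tensMap φ ψ).hom =
      MonoidalCategory.tensorHom (C := (Opens X)ᵒᵖ ⥤ ModuleCat.{u} k) φ.hom ψ.hom ≫
        presheafTensorTo F' G' := by
  let := Sheaf.monoidalCategory (Opens.grothendieckTopology X) (ModuleCat.{u} k)
  have e : tensMap φ ψ = MonoidalCategory.tensorHom
      (C := Sheaf (Opens.grothendieckTopology X) (ModuleCat.{u} k)) φ ψ :=
    (MonoidalCategory.tensorHom_def
      (C := Sheaf (Opens.grothendieckTopology X) (ModuleCat.{u} k)) φ ψ).symm
  rw [e]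
  exact tensorToSheafTensor_naturality (Opens.grothendieckTopology X) φ ψ

/-- The morphism is a sheafification, which is bijective on stalks, followed by an isomorphism of
sheaves. -/
lemma isIso_stalk_presheafTensorTo (F G : Shv k X) (x : X) :
    IsIso ((TopCat.Presheaf.stalkFunctor (ModuleCat.{u} k) x).map (presheafTensorTo F G)) := by
  have h := TopCat.Presheaf.stalkFunctor_map_unit_toSheafify_isIso x (ModuleCat.{u} k)
    (presheafTensor F.obj G.obj)
  have h2 : IsIso ((sheafToPresheaf _ _).map
      (sheafifyTensorIso (Opens.grothendieckTopology X) F G).hom) := inferInstance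
  have h3 := Functor.map_isIso (TopCat.Presheaf.stalkFunctor (ModuleCat.{u} k) x)
      ((sheafToPresheaf _ _).map (sheafifyTensorIso (Opens.grothendieckTopology X) F G).hom)
  have h4 := @IsIso.comp_isIso _ _ _ _ _ _ _ h h3
  rwa [← Functor.map_comp] at h4

/-- The isomorphism between the tensor product of the stalks of two sheaves and the stalk of their
tensor product. -/
def tensStalk (F G : Shv k X) (x : X) :
    TensorProduct k (stk F x) (stk G x) ≃ₗ[k] stk (tens F G) x :=
  ((presheafTensorStalk F.obj G.obj x).symm ≪≫
    @asIso _ _ _ _ ((TopCat.Presheaf.stalkFunctor (ModuleCat.{u} k) x).map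
      (presheafTensorTo F G)) (isIso_stalk_presheafTensorTo F G x)).toLinearEquiv

/-- The section of a tensor product of sheaves given by two sections. -/
def tensSec {F G : Shv k X} {U : Opens X} (s : sec F U) (t : sec G U) : sec (tens F G) U :=
  (presheafTensorTo F G).app (op U) (s ⊗ₜ[k] t)

lemma gm_tensSec {F G : Shv k X} {U : Opens X} (s : sec F U) (t : sec G U) (x : X) :
    gm (tensSec s t) x = tensStalk F G x (gm s x ⊗ₜ[k] gm t x) := by
  by_cases hx : x ∈ U
  · rw [gm_of_mem _ hx, gm_of_mem _ hx, gm_of_mem _ hx]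
    rw [← presheafTensorStalk_hom_germ F.obj G.obj hx s t]
    have h : (presheafTensorStalk F.obj G.obj x).inv ((presheafTensorStalk F.obj G.obj x).hom
        ((presheafTensor F.obj G.obj).germ U x hx (s ⊗ₜ[k] t))) =
          (presheafTensor F.obj G.obj).germ U x hx (s ⊗ₜ[k] t) :=
      ConcreteCategory.congr_hom (presheafTensorStalk F.obj G.obj x).hom_inv_id _
    refine Eq.trans ?_ (congrArg ((TopCat.Presheaf.stalkFunctor (ModuleCat.{u} k) x).map
      (presheafTensorTo F G)) h).symm
    exact (TopCat.Presheaf.stalkFunctor_map_germ_apply U x hx (presheafTensorTo F G) _).symm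
  · rw [gm_of_notMem _ hx, gm_of_notMem _ hx, TensorProduct.zero_tmul, map_zero]

lemma smap_tensSec {F F' G G' : Shv k X} (φ : F ⟶ F') (ψ : G ⟶ G') {U : Opens X} (s : sec F U)
    (t : sec G U) :
    smap (tensMap φ ψ) U (tensSec s t) = tensSec (smap φ U s) (smap ψ U t) := by
  have h := NatTrans.congr_app (presheafTensorTo_naturality φ ψ) (op U)
  exact ConcreteCategory.congr_hom h (TensorProduct.tmul k s t)

/-- Pure tensors of germs suffice, and two germs at `x` come from sections over a common open set,
where `smap_tensSec` applies. -/
lemma stmap_tensMap {F F' G G' : Shv k X} (φ : F ⟶ F') (ψ : G ⟶ G') (x : X)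
    (e : TensorProduct k (stk F x) (stk G x)) :
    stmap (tensMap φ ψ) x (tensStalk F G x e) =
      tensStalk F' G' x (TensorProduct.map (stmap φ x) (stmap ψ x) e) := by
  induction e using TensorProduct.induction_on with
  | zero => simp only [map_zero]
  | add a b ha hb => simp only [map_add, ha, hb]
  | tmul a b =>
    obtain ⟨U, hU, s, rfl⟩ := exists_gm a
    obtain ⟨V, hV, hVU, t, rfl⟩ := exists_gm_le b hU
    rw [← gm_res hVU s hV, ← gm_tensSec, ← gm_smap, smap_tensSec, gm_tensSec, gm_smap, gm_smap,
      TensorProduct.map_tmul]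

end TensorStalk

end SheafConvolution

end

noncomputable section

namespace SheafConvolution

/-! ### Stalks of inverse images -/

section PullbackStalk

variable {k : Type u} [Field k] {X Y : TopCat.{u}} (f : X ⟶ Y)

/-- The inverse image of a section. -/
def pbSec {G : Shv k Y} {U : Opens Y} (s : sec G U) :
    sec ((pullback k f).obj G) ((Opens.map f).obj U) :=
  smap ((TopCat.Sheaf.pullbackPushforwardAdjunction (ModuleCat.{u} k) f).unit.app G) U s

/-- The sections of a skyscraper sheaf are given by a case distinction, so the units of the
adjunctions involve transports. With the two targets as variables, the transports can be substituted
away. -/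
lemma comp_eq_comp_of_eqToHom {C : Type*} [Category* C] {A B D E S S' : C} {a : A ⟶ B}
    {e : B ⟶ E} {b : A ⟶ D} {g : D ⟶ E} (p : B = S) (q : E = S')
    (h : (a ≫ 𝟙 _ ≫ eqToHom p) ≫ (eqToHom p.symm ≫ e ≫ eqToHom q) =
      b ≫ (g ≫ 𝟙 _ ≫ eqToHom q)) : a ≫ e = b ≫ g := by
  subst p q
  simpa using h

section

variable (x : X) [∀ U : Opens X, Decidable (x ∈ U)]

variable (k) in
/-- The direct image of a skyscraper sheaf is right adjoint to the stalk functor. -/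
def stalkPushforwardSkyscraperAdjunction :
    stalkAt k (f x) ⊣ skyscraperSheafFunctor (C := ModuleCat.{u} k) x ⋙
      TopCat.Sheaf.pushforward (ModuleCat.{u} k) f :=
  -- With this choice of decidability, the direct image of the skyscraper at `x` is definitionally
  -- the skyscraper at `f x`.
  letI : ∀ U : Opens Y, Decidable (f x ∈ U) :=
    fun U ↦ inferInstanceAs (Decidable (x ∈ (Opens.map f).obj U))
  stalkSkyscraperSheafAdjunction (C := ModuleCat.{u} k) (f x)

variable (k) in
/-- The stalk of the inverse image of a sheaf. -/
def pbStalkIso : stalkAt k (f x) ≅ pullback k f ⋙ stalkAt k x :=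
  (stalkPushforwardSkyscraperAdjunction k f x).leftAdjointUniq
    ((TopCat.Sheaf.pullbackPushforwardAdjunction (ModuleCat.{u} k) f).comp
      (stalkSkyscraperSheafAdjunction (C := ModuleCat.{u} k) x))

/-- The stalk isomorphism comes from uniqueness of left adjoints, so it intertwines the two units;
evaluating this identity over `U` describes it on germs. -/
lemma germ_pbStalkIso (G : Shv k Y) {U : Opens Y} (hU : f x ∈ U) :
    G.presheaf.germ U (f x) hU ≫ (pbStalkIso k f x).hom.app G =
      (((TopCat.Sheaf.pullbackPushforwardAdjunction (ModuleCat.{u} k) f).unit.app G).hom.app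
        (op U) : G.presheaf.obj (op U) ⟶ ((pullback k f).obj G).presheaf.obj _) ≫
        ((pullback k f).obj G).presheaf.germ ((Opens.map f).obj U) x hU := by
  have h := (stalkPushforwardSkyscraperAdjunction k f x).unit_leftAdjointUniq_hom_app
    ((TopCat.Sheaf.pullbackPushforwardAdjunction (ModuleCat.{u} k) f).comp
      (stalkSkyscraperSheafAdjunction (C := ModuleCat.{u} k) x)) G
  have h1 := NatTrans.congr_app (congrArg (fun φ ↦ φ.hom) h) (op U)
  have hx : x ∈ (Opens.map f).obj U := hU
  have a1 : ((stalkPushforwardSkyscraperAdjunction k f x).unit.app G).hom.app (op U) =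
      G.presheaf.germ U (f x) hU ≫ 𝟙 _ ≫ eqToHom (if_pos hx).symm := dif_pos hx
  have a2 : (((skyscraperSheafFunctor (C := ModuleCat.{u} k) x ⋙
      TopCat.Sheaf.pushforward (ModuleCat.{u} k) f).map ((pbStalkIso k f x).hom.app G)).hom.app
        (op U)) = eqToHom (if_pos hx) ≫ (pbStalkIso k f x).hom.app G ≫
          eqToHom (if_pos hx).symm := dif_pos hx
  have a3 : (((stalkSkyscraperSheafAdjunction (C := ModuleCat.{u} k) x).unit.app
      ((pullback k f).obj G)).hom.app (op ((Opens.map f).obj U))) =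
        ((pullback k f).obj G).presheaf.germ ((Opens.map f).obj U) x hx ≫ 𝟙 _ ≫
          eqToHom (if_pos hx).symm := dif_pos hx
  have a4 : ((((TopCat.Sheaf.pullbackPushforwardAdjunction (ModuleCat.{u} k) f).comp
      (stalkSkyscraperSheafAdjunction (C := ModuleCat.{u} k) x)).unit.app G).hom.app (op U)) =
      ((TopCat.Sheaf.pullbackPushforwardAdjunction (ModuleCat.{u} k) f).unit.app G).hom.app
        (op U) ≫ (((stalkSkyscraperSheafAdjunction (C := ModuleCat.{u} k) x).unit.app
      ((pullback k f).obj G)).hom.app (op ((Opens.map f).obj U))) := by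
    rw [Adjunction.comp_unit_app]
    rfl
  rw [a3] at a4
  have h2 := h1.trans a4
  have h3 := congrArg₂ (fun a b ↦ CategoryStruct.comp a b) a1 a2
  replace h2 := h3.symm.trans h2
  exact comp_eq_comp_of_eqToHom _ _ h2

end

open Classical in
/-- The isomorphism between the stalks of a sheaf and the stalks of its inverse image. -/
def pbStalk (G : Shv k Y) (x : X) : stk G (f x) ≃ₗ[k] stk ((pullback k f).obj G) x :=
  ((pbStalkIso k f x).app G).toLinearEquiv

lemma gm_pbSec {G : Shv k Y} {U : Opens Y} (s : sec G U) (x : X) :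
    gm (pbSec f s) x = pbStalk f G x (gm s (f x)) := by
  classical
  by_cases hx : f x ∈ U
  · have hx' : x ∈ (Opens.map f).obj U := hx
    rw [gm_of_mem _ hx, gm_of_mem _ hx']
    exact (ConcreteCategory.congr_hom (germ_pbStalkIso f x G hx) s).symm
  · have hx' : x ∉ (Opens.map f).obj U := hx
    rw [gm_of_notMem _ hx, gm_of_notMem _ hx', map_zero]

lemma stmap_pullback {G H : Shv k Y} (φ : G ⟶ H) (x : X) (e : stk G (f x)) :
    stmap ((pullback k f).map φ) x (pbStalk f G x e) = pbStalk f H x (stmap φ (f x) e) := by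
  classical
  exact (ConcreteCategory.congr_hom ((pbStalkIso k f x).hom.naturality φ) e).symm

end PullbackStalk
end SheafConvolution

end

noncomputable section

namespace SheafConvolution

/-! ### Sections with proper support and the functor f_! -/

section ProperSections

open Filter Topology

variable {k : Type u} [Field k] {X Y Z : TopCat.{u}}

/-- The section of `F` underlying a section of `f_! F`. -/
def psVal {f : X ⟶ Y} {F : Shv k X} {U : Opens Y} :
    sec ((properPushforward k f).obj F) U →ₗ[k] sec F ((Opens.map f).obj U) :=
  (properSections f F U).subtype

lemma psVal_injective {f : X ⟶ Y} {F : Shv k X} {U : Opens Y} :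
    Function.Injective (psVal (f := f) (F := F) (U := U)) := Subtype.val_injective

lemma hasProperSupport_psVal {f : X ⟶ Y} {F : Shv k X} {U : Opens Y}
    (s : sec ((properPushforward k f).obj F) U) : HasProperSupport f F (psVal s) := s.2

/-- The section of `f_! F` given by a section of `F` with proper support. -/
def psMk {f : X ⟶ Y} {F : Shv k X} {U : Opens Y} (s : sec F ((Opens.map f).obj U))
    (hs : HasProperSupport f F s) : sec ((properPushforward k f).obj F) U := ⟨s, hs⟩

@[simp]
lemma psVal_psMk {f : X ⟶ Y} {F : Shv k X} {U : Opens Y} (s : sec F ((Opens.map f).obj U))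
    (hs : HasProperSupport f F s) : psVal (psMk s hs) = s := rfl

lemma gm_psVal_res {f : X ⟶ Y} {F : Shv k X} {U V : Opens Y} (h : V ≤ U)
    (s : sec ((properPushforward k f).obj F) U) {x : X} (hx : f x ∈ V) :
    gm (psVal (res h s)) x = gm (psVal s) x :=
  gm_res (F := F) (U := (Opens.map f).obj U) (V := (Opens.map f).obj V) (fun _ hy ↦ h hy)
    (psVal s) hx

lemma psVal_smap {f : X ⟶ Y} {F G : Shv k X} (φ : F ⟶ G) {U : Opens Y}
    (s : sec ((properPushforward k f).obj F) U) :
    psVal (smap ((properPushforward k f).map φ) U s) = smap φ _ (psVal s) := rfl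

lemma gm_psVal_smap {f : X ⟶ Y} {F G : Shv k X} (φ : F ⟶ G) {U : Opens Y}
    (s : sec ((properPushforward k f).obj F) U) (x : X) :
    gm (psVal (smap ((properPushforward k f).map φ) U s)) x = stmap φ x (gm (psVal s) x) := by
  rw [psVal_smap, gm_smap]

/-- When the target is Hausdorff, a limit of the ultrafilter automatically lies over `y`, and it
lies in the support because the support is closed in the domain. Only the existence of a limit
remains to be checked. -/
lemma hasProperSupport_iff' [T2Space Y] {f : X ⟶ Y} {F : Shv k X} {U : Opens Y}
    {s : sec F ((Opens.map f).obj U)} :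
    HasProperSupport f F s ↔ ∀ 𝒰 : Ultrafilter X, {x | gm s x ≠ 0} ∈ 𝒰 → ∀ y ∈ U,
      Tendsto f 𝒰 (𝓝 y) → ∃ x, (𝒰 : Filter X) ≤ 𝓝 x := by
  have hS : {x | gm s x ≠ 0} = sectionSupport F s := by
    ext x
    exact mem_sectionSupport.symm
  rw [hasProperSupport_iff, hS]
  constructor
  · intro h 𝒰 h𝒰 y hy hf
    obtain ⟨x, -, -, hx⟩ := h 𝒰 h𝒰 y hy hf
    exact ⟨x, hx⟩
  · intro h 𝒰 h𝒰 y hy hf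
    obtain ⟨x, hx⟩ := h 𝒰 h𝒰 y hy hf
    have hfx : f x = y :=
      tendsto_nhds_unique ((f.hom.continuous.tendsto x).mono_left hx) hf
    have hxU : x ∈ (Opens.map f).obj U := by
      change f x ∈ U
      rwa [hfx]
    exact ⟨x, mem_sectionSupport_of_ultrafilter F s hxU 𝒰 h𝒰 hx, hfx, hx⟩

lemma hasProperSupport_of_compact [T2Space Y] {f : X ⟶ Y} {F : Shv k X} {U : Opens Y}
    {s : sec F ((Opens.map f).obj U)}
    (h : ∀ y ∈ U, ∃ N ∈ 𝓝 y, ∃ C : Set X, IsCompact C ∧ ∀ x, f x ∈ N → gm s x ≠ 0 → x ∈ C) :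
    HasProperSupport f F s := by
  rw [hasProperSupport_iff']
  intro 𝒰 h𝒰 y hy hf
  obtain ⟨N, hN, C, hC, hNC⟩ := h y hy
  have h1 : C ∈ 𝒰 := by
    filter_upwards [h𝒰, hf hN] with x hx hx' using hNC x hx' hx
  obtain ⟨x, -, hx⟩ := hC.ultrafilter_le_nhds 𝒰 (le_principal_iff.2 h1)
  exact ⟨x, hx⟩

lemma HasProperSupport.isCompact [T2Space Y] {f : X ⟶ Y} {F : Shv k X} {U : Opens Y}
    {s : sec F ((Opens.map f).obj U)} (h : HasProperSupport f F s) {K : Set Y}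
    (hK : IsCompact K) (hKU : K ⊆ U) : IsCompact {x | gm s x ≠ 0 ∧ f x ∈ K} := by
  rw [isCompact_iff_ultrafilter_le_nhds]
  intro 𝒰 h𝒰
  rw [le_principal_iff] at h𝒰
  have h1 : K ∈ 𝒰.map f := Ultrafilter.mem_map.2 (mem_of_superset h𝒰 fun x hx ↦ hx.2)
  obtain ⟨y, hy, hle⟩ := hK.ultrafilter_le_nhds (𝒰.map f) (le_principal_iff.2 h1)
  rw [hasProperSupport_iff] at h
  obtain ⟨x, hx, hxy, hle'⟩ := h 𝒰 (by
    filter_upwards [h𝒰] with x hx using mem_sectionSupport.2 hx.1) y (hKU hy) hle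
  exact ⟨x, ⟨mem_sectionSupport.1 hx, hxy ▸ hy⟩, hle'⟩

/-- A section of `f_! F` has zero germ at `y` if and only if the underlying section of `F` has zero
germs at all points over `y`. -/
lemma gm_eq_zero_iff_psVal {f : X ⟶ Y} {F : Shv k X} {U : Opens Y} {y : Y} (hy : y ∈ U)
    (s : sec ((properPushforward k f).obj F) U) :
    gm s y = 0 ↔ ∀ x, f x = y → gm (psVal s) x = 0 := by
  constructor
  · rintro h x rfl
    obtain ⟨W, hW, hWU, h⟩ := exists_gm_eq_zero hy h
    have h0 : res hWU s = 0 := sec_ext fun z hz ↦ by rw [gm_res _ _ hz, h z hz, gm_zero]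
    rw [← gm_psVal_res hWU s hW, h0, map_zero, gm_zero]
  · intro h
    have hs := hasProperSupport_psVal s
    rw [hasProperSupport_iff] at hs
    -- Otherwise some ultrafilter on the support tends to `y` under `f`, and properness yields a
    -- point of the support over `y`.
    obtain ⟨N, hN, hNs⟩ : ∃ N ∈ 𝓝 y, ∀ x, f x ∈ N → gm (psVal s) x = 0 := by
      by_contra! hcon
      have hne : (comap f (𝓝 y) ⊓ 𝓟 (sectionSupport F (psVal s))).NeBot := by
        rw [inf_principal_neBot_iff]
        intro A hA
        obtain ⟨N, hN, hNA⟩ := hA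
        obtain ⟨x, hx, hx'⟩ := hcon N hN
        exact ⟨x, hNA hx, mem_sectionSupport.2 hx'⟩
      let 𝒰 := Ultrafilter.of (comap f (𝓝 y) ⊓ 𝓟 (sectionSupport F (psVal s)))
      have hle := Ultrafilter.of_le (comap f (𝓝 y) ⊓ 𝓟 (sectionSupport F (psVal s)))
      obtain ⟨x, hx, hxy, -⟩ := hs 𝒰 (le_principal_iff.1 (hle.trans inf_le_right)) y hy
        (tendsto_iff_comap.2 (hle.trans inf_le_left))
      exact mem_sectionSupport.1 hx (h x hxy)
    obtain ⟨W, hWN, hWo, hyW⟩ := mem_nhds_iff.1 hN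
    let W' : Opens Y := ⟨W, hWo⟩ ⊓ U
    have hW' : W' ≤ U := inf_le_right
    have hyW' : y ∈ W' := ⟨hyW, hy⟩
    rw [← gm_res hW' s hyW']
    have h0 : res hW' s = 0 := psVal_injective (sec_ext fun x hx ↦ by
      rw [gm_psVal_res hW' s hx, map_zero, gm_zero]
      exact hNs x (hWN hx.1))
    rw [h0, gm_zero]

lemma gm_eq_iff_psVal {f : X ⟶ Y} {F : Shv k X} {U V : Opens Y} {y : Y} (hy : y ∈ U)
    (hy' : y ∈ V) (s : sec ((properPushforward k f).obj F) U)
    (t : sec ((properPushforward k f).obj F) V) :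
    gm s y = gm t y ↔ ∀ x, f x = y → gm (psVal s) x = gm (psVal t) x := by
  have hyW : y ∈ U ⊓ V := ⟨hy, hy'⟩
  rw [← gm_res (inf_le_left : U ⊓ V ≤ U) s hyW, ← gm_res (inf_le_right : U ⊓ V ≤ V) t hyW,
    ← sub_eq_zero, ← gm_sub, gm_eq_zero_iff_psVal hyW]
  refine forall_congr' fun x ↦ forall_congr' fun hx ↦ ?_
  subst hx
  rw [map_sub, gm_sub, sub_eq_zero, gm_psVal_res _ _ hyW, gm_psVal_res _ _ hyW]

/-- The map from the stalks of `f_! F` to the stalks of `F`. -/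
def psEval (f : X ⟶ Y) (F : Shv k X) (x : X) :
    stk ((properPushforward k f).obj F) (f x) →ₗ[k] stk F x :=
  ((TopCat.Presheaf.stalkFunctor (ModuleCat.{u} k) (f x)).map
    ((homMk (F := (properPushforward k f).obj F)
      (G := (TopCat.Sheaf.pushforward (ModuleCat.{u} k) f).obj F)
      (fun _ ↦ psVal) (fun _ _ ↦ rfl)).hom) ≫
    TopCat.Presheaf.stalkPushforward (ModuleCat.{u} k) f F.presheaf x).hom

lemma psEval_gm {f : X ⟶ Y} {F : Shv k X} {U : Opens Y}
    (s : sec ((properPushforward k f).obj F) U) (x : X) :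
    psEval f F x (gm s (f x)) = gm (psVal s) x := by
  by_cases hx : f x ∈ U
  · have hx' : x ∈ (Opens.map f).obj U := hx
    rw [gm_of_mem _ hx, gm_of_mem _ hx']
    have h1 := TopCat.Presheaf.stalkFunctor_map_germ_apply U (f x) hx
      ((homMk (F := (properPushforward k f).obj F)
      (G := (TopCat.Sheaf.pushforward (ModuleCat.{u} k) f).obj F)
      (fun _ ↦ psVal) (fun _ _ ↦ rfl)).hom) s
    refine (congrArg (TopCat.Presheaf.stalkPushforward (ModuleCat.{u} k) f F.presheaf x)
      h1).trans ?_
    exact ConcreteCategory.congr_hom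
      (TopCat.Presheaf.stalkPushforward_germ (ModuleCat.{u} k) f F.presheaf U x hx) (psVal s)
  · have hx' : x ∉ (Opens.map f).obj U := hx
    rw [gm_of_notMem _ hx, gm_of_notMem _ hx', map_zero]

/-- The stalk of f_! F at `y` embeds in the product of the stalks of `F` along the fibre over `y`.
This replaces the usual description by sections with compact support in the fibre. -/
lemma eq_zero_of_psEval {f : X ⟶ Y} {F : Shv k X} {y : Y}
    (e : stk ((properPushforward k f).obj F) y)
    (h : ∀ x (hx : f x = y), psEval f F x (hx ▸ e) = 0) : e = 0 := by
  obtain ⟨U, hU, s, rfl⟩ := exists_gm e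
  rw [gm_eq_zero_iff_psVal hU]
  rintro x rfl
  rw [← psEval_gm]
  exact h x rfl

lemma psEval_stmap {f : X ⟶ Y} {F G : Shv k X} (φ : F ⟶ G) (x : X)
    (e : stk ((properPushforward k f).obj F) (f x)) :
    psEval f G x (stmap ((properPushforward k f).map φ) (f x) e) = stmap φ x (psEval f F x e) := by
  obtain ⟨U, hU, s, rfl⟩ := exists_gm e
  rw [← gm_smap, psEval_gm, gm_psVal_smap, psEval_gm]

/-- A continuous family of maps on stalks is given by a morphism of sheaves to the direct image with
proper supports, if it takes local sections to sections with proper supports. -/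
lemma exists_hom_properPushforward {f : X ⟶ Y} {F : Shv k Y} {G : Shv k X}
    (φ : ∀ x : X, stk F (f x) →ₗ[k] stk G x) (h : IsContinuousFamily f F G φ)
    (hp : ∀ (U : Opens Y) (s : sec F U) (t : sec G ((Opens.map f).obj U)),
      (∀ x, gm t x = φ x (gm s (f x))) → HasProperSupport f G t) :
    ∃ Φ : F ⟶ (properPushforward k f).obj G, ∀ (U : Opens Y) (s : sec F U) (x : X),
      gm (psVal (smap Φ U s)) x = φ x (gm s (f x)) := by
  choose t ht using fun (U : Opens Y) (s : sec F U) ↦ h.exists_section s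
  let Φ : F ⟶ (properPushforward k f).obj G := homMk (fun U ↦
    { toFun := fun s ↦ psMk (t U s) (hp U s _ (ht U s))
      map_add' := fun a b ↦ psVal_injective (sec_ext fun x _ ↦ by simp [ht])
      map_smul' := fun a b ↦ psVal_injective (sec_ext fun x _ ↦ by simp [ht]) })
    (fun {U V} hUV s ↦ psVal_injective (sec_ext fun x hx ↦ by
      rw [gm_psVal_res hUV _ hx]
      change gm (t V (res hUV s)) x = gm (t U s) x
      rw [ht, ht, gm_res hUV s hx]))
  exact ⟨Φ, fun U s x ↦ ht U s x⟩

/-- The support of `s` as a section of f_! F is the image under `f` of its support in `X`. From left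
to right, ultrafilters on this image are lifted to the support upstairs; from right to left, limits
are taken in `Y` and then in `X`. -/
lemma hasProperSupport_comp_iff [T2Space Y] [T2Space Z] {f : X ⟶ Y} {g : Y ⟶ Z} {F : Shv k X}
    {U : Opens Z} (s : sec F ((Opens.map f).obj ((Opens.map g).obj U))) :
    HasProperSupport (f ≫ g) F (U := U) s ↔
      ∃ h : HasProperSupport f F (U := (Opens.map g).obj U) s,
        HasProperSupport g ((properPushforward k f).obj F) (U := U) (psMk s h) := by
  constructor
  · intro H
    have h1 : HasProperSupport f F (U := (Opens.map g).obj U) s := by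
      refine hasProperSupport_iff'.2 fun 𝒰 h𝒰 y hy hf ↦ ?_
      exact (hasProperSupport_iff' (f := f ≫ g) (U := U) (s := s)).1 H 𝒰 h𝒰 (g y) hy ((g.hom.continuous.tendsto y).comp hf)
    refine ⟨h1, ?_⟩
    replace H := (hasProperSupport_iff (f ≫ g) F (U := U) s).1 H
    rw [hasProperSupport_iff]
    intro 𝒰 h𝒰 z hz hg
    have hsub : sectionSupport _ (psMk s h1 : sec ((properPushforward k f).obj F) _) ⊆
        f '' sectionSupport F s := by
      intro y hy
      rw [mem_sectionSupport] at hy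
      have hyU : y ∈ (Opens.map g).obj U := by
        by_contra hyU
        exact hy (gm_of_notMem _ hyU)
      by_contra hcon
      refine hy ((gm_eq_zero_iff_psVal hyU _).2 fun x hx ↦ ?_)
      by_contra hne
      exact hcon ⟨x, mem_sectionSupport.2 hne, hx⟩
    obtain ⟨𝒱, h𝒱, rfl⟩ : ∃ 𝒱 : Ultrafilter X, sectionSupport F s ∈ 𝒱 ∧ 𝒱.map f = 𝒰 := by
      have hne : (comap f (𝒰 : Filter Y) ⊓ 𝓟 (sectionSupport F s)).NeBot := by
        rw [inf_principal_neBot_iff]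
        rintro A ⟨B, hB, hBA⟩
        obtain ⟨y, hy1, hy2⟩ := 𝒰.nonempty_of_mem (inter_mem hB h𝒰)
        obtain ⟨x, hx, rfl⟩ := hsub hy2
        exact ⟨x, hBA hy1, hx⟩
      have hle := Ultrafilter.of_le (comap f (𝒰 : Filter Y) ⊓ 𝓟 (sectionSupport F s))
      refine ⟨Ultrafilter.of _, le_principal_iff.1 (hle.trans inf_le_right), ?_⟩
      exact Ultrafilter.eq_of_le (map_le_iff_le_comap.2 (hle.trans inf_le_left))
    obtain ⟨x, hx, hxz, hle⟩ := H 𝒱 h𝒱 z hz hg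
    refine ⟨f x, ?_, hxz, (Filter.map_mono hle).trans (f.hom.continuous.tendsto x)⟩
    rw [mem_sectionSupport]
    intro h0
    have hfx : f x ∈ (Opens.map g).obj U := by
      change g (f x) ∈ U
      rw [← hxz] at hz
      exact hz
    exact mem_sectionSupport.1 hx ((gm_eq_zero_iff_psVal hfx _).1 h0 x rfl)
  · rintro ⟨h1, h2⟩
    rw [hasProperSupport_iff'] at h1 h2
    refine (hasProperSupport_iff' (f := f ≫ g) (U := U) (s := s)).2 fun 𝒰 h𝒰 z hz hfg ↦ ?_
    obtain ⟨y, hy⟩ := h2 (𝒰.map f) (by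
      refine Ultrafilter.mem_map.2 (mem_of_superset h𝒰 fun x hx ↦ ?_)
      intro h0
      have hfx : f x ∈ (Opens.map g).obj U := by
        by_contra hfx
        exact hx (gm_of_notMem _ hfx)
      exact hx ((gm_eq_zero_iff_psVal hfx _).1 h0 x rfl)) z hz hfg
    refine h1 𝒰 h𝒰 y ?_ hy
    have : g y = z :=
      tendsto_nhds_unique ((g.hom.continuous.tendsto y).mono_left hy) hfg
    change g y ∈ U
    rwa [this]

/-- The canonical morphism `g_! f_! F ⟶ (g f)_! F`. -/
def properPushforwardCompHom [T2Space Y] [T2Space Z] (f : X ⟶ Y) (g : Y ⟶ Z) (F : Shv k X) :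
    (properPushforward k g).obj ((properPushforward k f).obj F) ⟶
      (properPushforward k (f ≫ g)).obj F :=
  homMk (fun U ↦
    { toFun := fun s ↦ psMk (f := f ≫ g) (U := U)
        (psVal (f := f) (U := (Opens.map g).obj U) (psVal (f := g) (U := U) s))
        ((hasProperSupport_comp_iff _).2 ⟨hasProperSupport_psVal _, hasProperSupport_psVal s⟩)
      map_add' := fun _ _ ↦ rfl
      map_smul' := fun _ _ ↦ rfl }) (fun _ _ ↦ rfl)

lemma isIso_properPushforwardCompHom [T2Space Y] [T2Space Z] (f : X ⟶ Y) (g : Y ⟶ Z)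
    (F : Shv k X) : IsIso (properPushforwardCompHom f g F) := by
  refine ⟨homMk (fun U ↦
    { toFun := fun s ↦ psMk (f := g) (U := U) (psMk (f := f) (U := (Opens.map g).obj U)
        (psVal (f := f ≫ g) (U := U) s)
        ((hasProperSupport_comp_iff _).1 (hasProperSupport_psVal s)).choose)
        ((hasProperSupport_comp_iff _).1 (hasProperSupport_psVal s)).choose_spec
      map_add' := fun _ _ ↦ rfl
      map_smul' := fun _ _ ↦ rfl }) (fun _ _ ↦ rfl), ?_, ?_⟩
  · apply hom_ext_smap
    intro U
    rfl
  · apply hom_ext_smap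
    intro U
    rfl

/-- The direct images with proper supports compose. -/
def properPushforwardComp [T2Space Y] [T2Space Z] (f : X ⟶ Y) (g : Y ⟶ Z) :
    properPushforward k f ⋙ properPushforward k g ≅ properPushforward k (f ≫ g) :=
  NatIso.ofComponents (fun F ↦ @asIso _ _ _ _ (properPushforwardCompHom f g F)
    (isIso_properPushforwardCompHom f g F))
    (fun φ ↦ by
      apply hom_ext_smap
      intro U
      rfl)

/-- For a closed embedding `f`, the functor `f⁻¹ f_!` is isomorphic to the identity. -/
lemma nonempty_properPushforward_pullback_iso [T2Space Y] (f : X ⟶ Y) (hf : IsClosedEmbedding f) :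
    Nonempty (properPushforward k f ⋙ pullback k f ≅ 𝟭 (Shv k X)) := by
  have key : ∀ F : Shv k X, ∃ Φ : (pullback k f).obj ((properPushforward k f).obj F) ⟶ F,
      ∀ x, stmap Φ x = psEval f F x ∘ₗ (pbStalk f _ x).symm.toLinearMap := by
    intro F
    apply exists_hom_of_stalks
    intro x e
    obtain ⟨e', rfl⟩ := (pbStalk f _ x).surjective e
    obtain ⟨U, hU, s, rfl⟩ := exists_gm e'
    refine ⟨(Opens.map f).obj U, pbSec f s, (Opens.map f).obj U, psVal s, hU, hU,
      gm_pbSec f s x, fun y hy ↦ ?_⟩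
    change _ = psEval f F y ((pbStalk f _ y).symm (gm (pbSec f s) y))
    rw [gm_pbSec, LinearEquiv.symm_apply_apply, psEval_gm]
  choose Φ hΦ using key
  have hiso : ∀ F, IsIso (Φ F) := by
    intro F
    apply isIso_of_stmap_bijective
    intro x
    rw [hΦ]
    have hb : Function.Bijective (psEval f F x) := by
      refine ⟨?_, ?_⟩
      · rw [injective_iff_map_eq_zero]
        intro e he
        refine eq_zero_of_psEval e fun x' hx' ↦ ?_
        obtain rfl := hf.injective hx'
        exact he
      · intro e
        obtain ⟨U, hU, s, rfl⟩ := exists_gm e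
        obtain ⟨V, hV, hVU⟩ := hf.isInducing.isOpen_iff.1 U.isOpen
        let V' : Opens Y := ⟨V, hV⟩
        have hUV : (Opens.map f).obj V' = U := Opens.ext hVU
        have hx : f x ∈ V' := by
          change x ∈ (Opens.map f).obj V'
          rwa [hUV]
        let s' : sec F ((Opens.map f).obj V') := res hUV.le s
        -- The range of `f` is closed, so a limit in `Y` of points of the range has a preimage; as
        -- `f` is inducing, the ultrafilter converges there. Hence every section has proper support.
        have hs' : HasProperSupport f F s' := by
          rw [hasProperSupport_iff']
          intro 𝒰 _ y _ hy
          obtain ⟨x, rfl⟩ : y ∈ Set.range f :=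
            hf.isClosed_range.mem_of_tendsto hy (Eventually.of_forall fun x ↦ ⟨x, rfl⟩)
          refine ⟨x, ?_⟩
          rw [hf.isInducing.nhds_eq_comap]
          exact tendsto_iff_comap.1 hy
        refine ⟨gm (psMk s' hs') (f x), ?_⟩
        rw [psEval_gm, psVal_psMk]
        exact gm_res (F := F) hUV.le s hx
    exact hb.comp (pbStalk f ((properPushforward k f).obj F) x).symm.bijective
  refine ⟨NatIso.ofComponents (fun F ↦ @asIso _ _ _ _ (Φ F) (hiso F)) (fun {F G} φ ↦ ?_)⟩
  change (pullback k f).map ((properPushforward k f).map φ) ≫ Φ G = Φ F ≫ φ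
  apply hom_ext_stmap
  intro x
  ext e
  obtain ⟨e, rfl⟩ := (pbStalk f _ x).surjective e
  rw [stmap_comp, stmap_comp, LinearMap.comp_apply, LinearMap.comp_apply, stmap_pullback, hΦ, hΦ]
  simp only [LinearMap.comp_apply, LinearEquiv.coe_coe, LinearEquiv.symm_apply_apply]
  exact psEval_stmap φ x e

end ProperSections

end SheafConvolution

end

noncomputable section

namespace SheafConvolution

/-! ### C-soft sheaves and exactness of f_! -/

section CSoft

open Filter Topology

variable {k : Type u} [Field k] {X Y : TopCat.{u}}

lemma isOpen_setOf_gm_eq {F : Shv k X} {U V : Opens X} (s : sec F U) (t : sec F V) :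
    IsOpen {x | x ∈ U ∧ x ∈ V ∧ gm s x = gm t x} := by
  rw [isOpen_iff_forall_mem_open]
  rintro x ⟨hU, hV, h⟩
  obtain ⟨W, hW, h1, h2, h3⟩ := exists_gm_eq hU hV h
  exact ⟨W, fun y hy ↦ ⟨h1 hy, h2 hy, h3 y hy⟩, W.isOpen, hW⟩

/-- Two sections which agree on the intersection of their domains glue. -/
lemma exists_glue {F : Shv k X} {U V : Opens X} (s : sec F U) (t : sec F V)
    (h : ∀ x ∈ U, x ∈ V → gm s x = gm t x) :
    ∃ r : sec F (U ⊔ V), (∀ x ∈ U, gm r x = gm s x) ∧ ∀ x ∈ V, gm r x = gm t x := by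
  classical
  obtain ⟨r, hr⟩ := exists_section (F := F) (U ⊔ V) (fun x ↦ if x ∈ U then gm s x else gm t x) (by
    rintro x hx
    rcases Opens.mem_sup.1 hx with hx | hx
    · exact ⟨U, hx, s, fun y hy _ ↦ by rw [if_pos hy]⟩
    · refine ⟨V, hx, t, fun y hy _ ↦ ?_⟩
      split_ifs with hyU
      · exact (h y hyU hy).symm
      · rfl)
  refine ⟨r, fun x hx ↦ ?_, fun x hx ↦ ?_⟩
  · rw [hr x (Opens.mem_sup.2 (Or.inl hx)), if_pos hx]
  · rw [hr x (Opens.mem_sup.2 (Or.inr hx))]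
    split_ifs with hxU
    · exact h x hxU hx
    · rfl

/-- A section which vanishes on the boundary of an open set `O` can be cut off outside of `O`. -/
lemma exists_cut {F : Shv k X} {V : Opens X} (s : sec F V) (O : Opens X)
    (h : ∀ x ∈ V, x ∈ closure (O : Set X) → x ∉ O → gm s x = 0) :
    ∃ t : sec F V, (∀ x ∈ V, x ∈ O → gm t x = gm s x) ∧ ∀ x ∉ O, gm t x = 0 := by
  classical
  obtain ⟨t, ht⟩ := exists_section (F := F) V (fun x ↦ if x ∈ O then gm s x else 0) (by
    intro x hx
    by_cases hxO : x ∈ O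
    · exact ⟨O ⊓ V, ⟨hxO, hx⟩, res inf_le_right s, fun y hy _ ↦ by
        rw [gm_res _ _ hy, if_pos (show y ∈ O from hy.1)]⟩
    by_cases hxc : x ∈ closure (O : Set X)
    · obtain ⟨W, hW, hWV, h0⟩ := exists_gm_eq_zero hx (h x hx hxc hxO)
      exact ⟨W, hW, 0, fun y hy _ ↦ by rw [gm_zero, h0 y hy, ite_self]⟩
    · exact ⟨⟨(closure (O : Set X))ᶜ, isClosed_closure.isOpen_compl⟩, hxc, 0, fun y hy _ ↦ by
        rw [gm_zero, if_neg fun hyO : y ∈ O ↦ hy (subset_closure hyO)]⟩)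
  refine ⟨t, fun x hx hxO ↦ by rw [ht x hx, if_pos hxO], fun x hxO ↦ ?_⟩
  by_cases hx : x ∈ V
  · rw [ht x hx, if_neg hxO]
  · exact gm_of_notMem _ hx

/-- The kernel of a morphism of sheaves is c-soft: the sections over neighbourhoods of a compact
set extend to global sections. -/
def KerSoft {B C : Shv k X} (β : B ⟶ C) : Prop :=
  ∀ (K : Set X), IsCompact K → ∀ (U : Opens X), K ⊆ U → ∀ s : sec B U,
    (∀ x ∈ U, stmap β x (gm s x) = 0) →
    ∃ t : sec B ⊤, (∀ x, stmap β x (gm t x) = 0) ∧ ∀ x ∈ K, gm t x = gm s x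

/-- A sheaf is c-soft if sections over neighbourhoods of a compact set extend to global
sections. -/
def CSoft (F : Shv k X) : Prop :=
  ∀ (K : Set X), IsCompact K → ∀ (U : Opens X), K ⊆ U → ∀ s : sec F U,
    ∃ t : sec F ⊤, ∀ x ∈ K, gm t x = gm s x

/-- Each component of a section is extended separately and the results are added. It serves for the
terms of mapping cones and of total complexes. -/
lemma CSoft.of_sum {ι : Type*} (I : Finset ι) {F : Shv k X} {G : ι → Shv k X}
    (π : ∀ i, F ⟶ G i) (j : ∀ i, G i ⟶ F) (h : ∑ i ∈ I, π i ≫ j i = 𝟙 F)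
    (hG : ∀ i ∈ I, CSoft (G i)) : CSoft F := by
  classical
  intro K hK U hKU s
  have h1 : ∀ i, ∃ t : sec (G i) ⊤, i ∈ I → ∀ x ∈ K, gm t x = gm (smap (π i) U s) x := by
    intro i
    by_cases hi : i ∈ I
    · obtain ⟨t, ht⟩ := hG i hi K hK U hKU (smap (π i) U s)
      exact ⟨t, fun _ ↦ ht⟩
    · exact ⟨0, fun hi' ↦ (hi hi').elim⟩
  choose t ht using h1
  refine ⟨∑ i ∈ I, smap (j i) ⊤ (t i), fun x hx ↦ ?_⟩
  have h2 : (∑ i ∈ I, stmap (π i ≫ j i) x) = LinearMap.id := by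
    rw [← stmap_id, ← h]
    simp only [← stalkAt_map_hom, Functor.map_sum, ModuleCat.hom_sum]
    rfl
  rw [gm_sum, ← LinearMap.id_apply (R := k) (gm s x), ← h2, LinearMap.sum_apply]
  refine Finset.sum_congr rfl fun i hi ↦ ?_
  rw [gm_smap, ht i hi x hx, gm_smap, stmap_comp, LinearMap.comp_apply]

lemma KerSoft.of_isZero {F G : Shv k X} (β : F ⟶ G) (h : IsZero F) : KerSoft β := by
  intro K hK U hKU s hs
  refine ⟨0, fun x ↦ by rw [gm_zero, map_zero], fun x hx ↦ ?_⟩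
  have : stmap (𝟙 F) x = 0 := by rw [h.eq_of_src (𝟙 F) 0, stmap_zero]
  rw [gm_zero, ← LinearMap.id_apply (R := k) (gm s x), ← stmap_id, this, LinearMap.zero_apply]

variable [T2Space X] [LocallyCompactSpace X]

/-- If the kernel of `α : A ⟶ B` is c-soft and `A` is c-soft, a section of `B` which is locally in
the image of `α` near a compact set lifts near this compact set. -/
lemma exists_lift_of_isCompact {A B : Shv k X} {α : A ⟶ B} (hα : KerSoft α) (hA : CSoft A)
    {U : Opens X} (s : sec B U) {K : Set X} (hK : IsCompact K) (hKU : K ⊆ U)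
    (hs : ∀ x ∈ K, gm s x ∈ LinearMap.range (stmap α x)) :
    ∃ a : sec A ⊤, ∀ x ∈ K, stmap α x (gm a x) = gm s x := by
  -- The induction runs over arbitrary subsets, whereas softness concerns compact sets; hence the
  -- compact enlargement `L`.
  let P : Set X → Prop := fun S ↦ ∃ L : Set X, IsCompact L ∧ S ⊆ L ∧ L ⊆ U ∧
    ∃ a : sec A ⊤, ∀ x ∈ L, stmap α x (gm a x) = gm s x
  suffices h : P K by
    obtain ⟨L, -, hKL, -, a, ha⟩ := h
    exact ⟨a, fun x hx ↦ ha x (hKL hx)⟩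
  refine hK.induction_on (p := P) ⟨∅, isCompact_empty, subset_rfl, Set.empty_subset _, 0,
    fun x hx ↦ hx.elim⟩ ?_ ?_ ?_
  · rintro S T hST ⟨L, hL, hTL, h⟩
    exact ⟨L, hL, hST.trans hTL, h⟩
  · rintro S T ⟨L, hL, hSL, hLU, a, ha⟩ ⟨L', hL', hTL', hLU', a', ha'⟩
    refine ⟨L ∪ L', hL.union hL', Set.union_subset_union hSL hTL', Set.union_subset hLU hLU', ?_⟩
    -- Two lifts differ near `L ∩ L'` by a section of the kernel, which softness of the kernel
    -- extends to a global correction `c` of `a'`.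
    let W : Opens X := ⟨_, isOpen_setOf_gm_eq (smap α ⊤ (a - a')) (0 : sec B ⊤)⟩
    have hLW : L ∩ L' ⊆ W := fun x hx ↦ ⟨trivial, trivial, by
      rw [gm_smap, gm_sub, map_sub, ha x hx.1, ha' x hx.2, sub_self, gm_zero]⟩
    obtain ⟨c, hc, hc'⟩ := hα (L ∩ L') (hL.inter hL') W hLW (res le_top (a - a')) (fun x hx ↦ by
      rw [gm_res _ _ hx, ← gm_smap, hx.2.2, gm_zero])
    have hb : ∀ x ∈ L', stmap α x (gm (a' + c) x) = gm s x := fun x hx ↦ by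
      rw [gm_add, map_add, hc, add_zero, ha' x hx]
    -- The lifts now agree on `O`, which contains `L ∩ L'`. The compact sets `L \ O` and `L' \ O`
    -- have disjoint neighbourhoods, so the lifts glue near `L ∪ L'`.
    let O : Opens X := ⟨_, isOpen_setOf_gm_eq a (a' + c)⟩
    have hLO : ∀ x ∈ L, x ∈ L' → x ∈ O := fun x hx hx' ↦ ⟨trivial, trivial, by
      rw [gm_add, hc' x ⟨hx, hx'⟩, gm_res _ _ (hLW ⟨hx, hx'⟩), gm_sub]
      abel⟩
    obtain ⟨O₁, O₂, ho₁, ho₂, h₁, h₂, hd⟩ := SeparatedNhds.of_isCompact_isCompact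
      (hL.diff O.isOpen) (hL'.diff O.isOpen) (by
        rw [Set.disjoint_left]
        rintro x ⟨hx, hxO⟩ ⟨hx', -⟩
        exact hxO (hLO x hx hx'))
    let W₁ : Opens X := ⟨O₁, ho₁⟩ ⊔ O
    let W₂ : Opens X := ⟨O₂, ho₂⟩ ⊔ O
    have hLW₁ : ∀ x ∈ L, x ∈ W₁ := fun x hx ↦ by
      by_cases hxO : x ∈ O
      · exact Opens.mem_sup.2 (Or.inr hxO)
      · exact Opens.mem_sup.2 (Or.inl (h₁ ⟨hx, hxO⟩))
    have hLW₂ : ∀ x ∈ L', x ∈ W₂ := fun x hx ↦ by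
      by_cases hxO : x ∈ O
      · exact Opens.mem_sup.2 (Or.inr hxO)
      · exact Opens.mem_sup.2 (Or.inl (h₂ ⟨hx, hxO⟩))
    obtain ⟨r, hr, hr'⟩ := exists_glue (U := W₁) (V := W₂) (res le_top a) (res le_top (a' + c))
      (fun x hx hx' ↦ by
        rw [gm_res _ _ hx, gm_res _ _ hx']
        rcases Opens.mem_sup.1 hx with h | h
        · rcases Opens.mem_sup.1 hx' with h' | h'
          · exact (Set.disjoint_left.1 hd h h').elim
          · exact h'.2.2
        · exact h.2.2)
    obtain ⟨t, ht⟩ := hA (L ∪ L') (hL.union hL') (W₁ ⊔ W₂) (by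
      rintro x (hx | hx)
      · exact Opens.mem_sup.2 (Or.inl (hLW₁ x hx))
      · exact Opens.mem_sup.2 (Or.inr (hLW₂ x hx))) r
    refine ⟨t, fun x hx ↦ ?_⟩
    rw [ht x hx]
    rcases hx with hx | hx
    · rw [hr x (hLW₁ x hx), gm_res _ _ (hLW₁ x hx), ha x hx]
    · rw [hr' x (hLW₂ x hx), gm_res _ _ (hLW₂ x hx), hb x hx]
  · intro x hx
    obtain ⟨e, he⟩ := hs x hx
    obtain ⟨V, hV, a, rfl⟩ := exists_gm e
    rw [← gm_smap] at he
    obtain ⟨W, hW, hWV, hWU, hWe⟩ := exists_gm_eq hV (hKU hx) he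
    obtain ⟨L, hL, hxL, hLW⟩ := exists_compact_subset W.isOpen hW
    obtain ⟨t, ht⟩ := hA L hL V (hLW.trans hWV) a
    refine ⟨L, mem_nhdsWithin_of_mem_nhds (mem_interior_iff_mem_nhds.1 hxL), L, hL, subset_rfl,
      hLW.trans hWU, t, fun y hy ↦ ?_⟩
    rw [ht y hy, ← gm_smap, hWe y (hLW hy)]

/-- A section of the kernel of `β` lifts locally to `A`, hence near a compact set by
`exists_lift_of_isCompact`, and the image of a global lift is a global section of the kernel. This
is the inductive step that carries softness of the cocycles up a complex. -/
lemma KerSoft.of_exact {A B C : Shv k X} {α : A ⟶ B} {β : B ⟶ C} (hα : KerSoft α) (hA : CSoft A)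
    (h : ∀ x, Function.Exact (stmap α x) (stmap β x)) : KerSoft β := by
  intro K hK U hKU s hs
  obtain ⟨a, ha⟩ := exists_lift_of_isCompact hα hA s hK hKU fun x hx ↦ (h x _).1 (hs x (hKU hx))
  refine ⟨smap α ⊤ a, fun x ↦ ?_, fun x hx ↦ ?_⟩
  · rw [gm_smap]
    exact (h x).apply_apply_eq_zero _
  · rw [gm_smap, ha x hx]

variable [T2Space Y] [LocallyCompactSpace Y]

/-- Over a compact neighbourhood of `y` the support of `s` is compact, and `s` lifts on the closure
of a relatively compact open set `O` around it. On the boundary of `O` the lift lies in the kernel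
of `α`; once a global section of the kernel is subtracted it vanishes there, and it can be cut off
outside `O`. -/
lemma exists_proper_lift (f : X ⟶ Y) {A B : Shv k X} {α : A ⟶ B} (hα : KerSoft α) (hA : CSoft A)
    {V : Opens Y} {y : Y} (hy : y ∈ V) (s : sec ((properPushforward k f).obj B) V)
    (hs : ∀ x, f x ∈ V → gm (psVal s) x ∈ LinearMap.range (stmap α x)) :
    gm s y ∈ LinearMap.range (stmap ((properPushforward k f).map α) y) := by
  obtain ⟨N, hN, hyN, hNV⟩ := exists_compact_subset V.isOpen hy
  have hL := (hasProperSupport_psVal s).isCompact hN hNV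
  obtain ⟨O, hO, hLO, hOV, hOc⟩ := exists_open_between_and_isCompact_closure hL
    ((Opens.map f).obj V).isOpen (fun x hx ↦ hNV hx.2)
  obtain ⟨a, ha⟩ := exists_lift_of_isCompact hα hA (psVal s) hOc hOV (fun x hx ↦ hs x (hOV hx))
  let W : Opens X := ⟨_, isOpen_setOf_gm_eq (smap α ⊤ a) (0 : sec B ⊤)⟩
  have hNc : IsClosed (f ⁻¹' N) := hN.isClosed.preimage f.hom.continuous
  have hD : IsCompact ((closure O \ O) ∩ f ⁻¹' N) := (hOc.diff hO).inter_right hNc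
  have hDW : (closure O \ O) ∩ f ⁻¹' N ⊆ W := fun x hx ↦ ⟨trivial, trivial, by
    rw [gm_smap, ha x hx.1.1, gm_zero]
    by_contra hne
    exact hx.1.2 (hLO ⟨hne, hx.2⟩)⟩
  obtain ⟨c, hc, hc'⟩ := hα _ hD W hDW (res le_top a) (fun x hx ↦ by
    rw [gm_res _ _ hx, ← gm_smap, hx.2.2, gm_zero])
  let V' : Opens Y := ⟨interior N, isOpen_interior⟩
  have hV'V : V' ≤ V := interior_subset.trans hNV
  obtain ⟨t, ht, ht'⟩ := exists_cut (V := (Opens.map f).obj V') (res le_top (a - c)) ⟨O, hO⟩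
    (fun x hx hxc hxO ↦ by
      have hxD : x ∈ (closure O \ O) ∩ f ⁻¹' N := ⟨⟨hxc, hxO⟩, interior_subset (s := N) hx⟩
      rw [gm_res _ _ hx, gm_sub, hc' x hxD, gm_res _ _ (hDW hxD), sub_self])
  have htp : HasProperSupport f A t := hasProperSupport_of_compact fun z hz ↦
    ⟨V', V'.isOpen.mem_nhds hz, closure O, hOc, fun x hx hne ↦ by
      by_contra hxO
      exact hne (ht' x fun h ↦ hxO (subset_closure h))⟩
  refine ⟨gm (psMk t htp) y, ?_⟩
  rw [← gm_smap, gm_eq_iff_psVal (U := V') hyN hy]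
  intro x hx
  have hxV' : x ∈ (Opens.map f).obj V' := by
    change f x ∈ V'
    rw [hx]
    exact hyN
  rw [gm_psVal_smap, psVal_psMk]
  by_cases hxO : x ∈ O
  · rw [ht x hxV' hxO, gm_res _ _ hxV', gm_sub, map_sub, hc, sub_zero, ha x (subset_closure hxO)]
  · rw [ht' x hxO, map_zero]
    by_contra hne
    exact hxO (hLO ⟨Ne.symm hne, interior_subset hxV'⟩)

/-- The section of `F` is glued with zero off its support. The extension is required to agree with
the result over `K` inside a relatively compact open set `O`, and also on the boundary of `O`, where
it therefore vanishes and can be cut off. -/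
lemma CSoft.properPushforward (f : X ⟶ Y) {F : Shv k X} (hF : CSoft F) :
    CSoft ((properPushforward k f).obj F) := by
  intro K hK V hKV s
  obtain ⟨N, hN, hKN, hNV⟩ := exists_compact_between hK V.isOpen hKV
  have hL := (hasProperSupport_psVal s).isCompact hN hNV
  obtain ⟨O, hO, hLO, -, hOc⟩ := exists_open_between_and_isCompact_closure hL isOpen_univ
    (Set.subset_univ _)
  let V' : Opens Y := ⟨interior N, isOpen_interior⟩
  have hV'V : V' ≤ V := interior_subset.trans hNV
  let E : Opens X := ⟨_, hL.isClosed.isOpen_compl⟩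
  obtain ⟨r, hr, hr'⟩ := exists_glue (U := (Opens.map f).obj V') (V := E)
    (psVal (res hV'V s)) 0 (fun x hx hxE ↦ by
      rw [gm_psVal_res _ _ hx, gm_zero]
      by_contra hne
      exact hxE ⟨hne, interior_subset hx⟩)
  have hKc : IsClosed (f ⁻¹' K) := hK.isClosed.preimage f.hom.continuous
  obtain ⟨t, ht⟩ := hF (closure O ∩ f ⁻¹' K ∪ closure O \ O)
    ((hOc.inter_right hKc).union (hOc.diff hO)) ((Opens.map f).obj V' ⊔ E) (by
      rintro x (hx | hx)
      · exact Opens.mem_sup.2 (Or.inl (hKN hx.2))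
      · exact Opens.mem_sup.2 (Or.inr fun h ↦ hx.2 (hLO h))) r
  obtain ⟨t', ht₁, ht₂⟩ := exists_cut (V := (Opens.map f).obj ⊤) (res le_top t) ⟨O, hO⟩ (fun x hx hxc hxO ↦ by
    rw [gm_res _ _ hx, ht x (Or.inr ⟨hxc, hxO⟩), hr' x fun h ↦ hxO (hLO h), gm_zero])
  have htp : HasProperSupport f F (U := ⊤) t' := hasProperSupport_of_compact fun z hz ↦
    ⟨Set.univ, univ_mem, closure O, hOc, fun x hx hne ↦ by
      by_contra hxO
      exact hne (ht₂ x fun h ↦ hxO (subset_closure h))⟩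
  refine ⟨psMk t' htp, fun y hy ↦ ?_⟩
  rw [gm_eq_iff_psVal (U := ⊤) trivial (hKV hy)]
  rintro x rfl
  rw [psVal_psMk]
  by_cases hxO : x ∈ O
  · rw [ht₁ x trivial hxO, gm_res (V := (Opens.map f).obj ⊤) le_top t trivial, ht x (Or.inl ⟨subset_closure hxO, hy⟩), hr x (hKN hy),
      gm_psVal_res _ _ (hKN hy)]
  · rw [ht₂ x hxO]
    by_contra hne
    exact hxO (hLO ⟨Ne.symm hne, interior_subset (hKN hy)⟩)

lemma exact_stmap_properPushforward (f : X ⟶ Y) {A B C : Shv k X} {α : A ⟶ B} {β : B ⟶ C}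
    (hα : KerSoft α) (hA : CSoft A) (h : ∀ x, Function.Exact (stmap α x) (stmap β x)) (y : Y) :
    Function.Exact (stmap ((SheafConvolution.properPushforward k f).map α) y)
      (stmap ((SheafConvolution.properPushforward k f).map β) y) := by
  intro e
  constructor
  · intro he
    obtain ⟨V, hV, s, rfl⟩ := exists_gm e
    rw [← gm_smap] at he
    obtain ⟨W, hW, hWV, h0⟩ := exists_gm_eq_zero hV he
    have h2 := exists_proper_lift f hα hA hW (res hWV s) (fun x hx ↦ by
      rw [gm_psVal_res _ _ hx]
      refine (h x _).1 ?_
      rw [← gm_psVal_smap]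
      exact (gm_eq_zero_iff_psVal (hWV hx) _).1 (h0 _ hx) x rfl)
    rwa [gm_res _ _ hW] at h2
  · rintro ⟨a, rfl⟩
    have h1 : α ≫ β = 0 := hom_ext_stmap fun x ↦ by
      rw [stmap_comp, stmap_zero, (h x).linearMap_comp_eq_zero]
    rw [← LinearMap.comp_apply, ← stmap_comp, ← Functor.map_comp, h1, Functor.map_zero, stmap_zero,
      LinearMap.zero_apply]

/-- The direct image with proper supports of an acyclic bounded below complex of c-soft sheaves is
acyclic. -/
lemma exactAt_properPushforward (f : X ⟶ Y) (K : CochainComplex (Shv k X) ℤ) (n₀ : ℤ)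
    [K.IsStrictlyGE n₀] (hs : ∀ i, CSoft (K.X i)) (hK : ∀ i, K.ExactAt i) (i : ℤ) :
    (((properPushforward k f).mapHomologicalComplex (ComplexShape.up ℤ)).obj K).ExactAt i := by
  have hex : ∀ n : ℤ, ∀ x, Function.Exact (stmap (K.d n (n + 1)) x)
      (stmap (K.d (n + 1) (n + 2)) x) := fun n x ↦ by
    have h := hK (n + 1)
    rw [HomologicalComplex.exactAt_iff' K n (n + 1) (n + 2) (by simp) (by simp; ring)] at h
    exact (exact_iff_stmap _).1 h x
  -- The induction starts in degree `n₀ - 1`, where the complex is zero.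
  have hker : ∀ m : ℕ, KerSoft (K.d (n₀ - 1 + m) (n₀ - 1 + m + 1)) := by
    intro m
    induction m with
    | zero => exact KerSoft.of_isZero _ (K.isZero_of_isStrictlyGE n₀ _ (by simp))
    | succ m ih =>
      have := KerSoft.of_exact ih (hs _) (hex _)
      convert this using 2 <;> push_cast <;> ring
  have hker' : ∀ n : ℤ, KerSoft (K.d n (n + 1)) := by
    intro n
    by_cases hn : n < n₀
    · exact KerSoft.of_isZero _ (K.isZero_of_isStrictlyGE n₀ _ hn)
    · obtain ⟨m, hm⟩ := Int.eq_ofNat_of_zero_le (a := n - (n₀ - 1)) (by lia)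
      obtain rfl : n = n₀ - 1 + m := by lia
      exact hker m
  obtain ⟨n, rfl⟩ : ∃ n, i = n + 1 := ⟨i - 1, by ring⟩
  rw [HomologicalComplex.exactAt_iff' _ n (n + 1) (n + 2) (by simp) (by simp; ring),
    exact_iff_stmap]
  exact exact_stmap_properPushforward f (hker' n) (hs n) (hex n)

end CSoft

end SheafConvolution

end

noncomputable section

namespace SheafConvolution

/-! ### Cut-off operators; injective sheaves are fine -/

section Fine

open Filter Topology

variable {k : Type u} [Field k] {X Y Z : TopCat.{u}}

/-- A sheaf is fine if there are endomorphisms which cut off sections along open sets. -/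
def Fine (F : Shv k X) : Prop :=
  ∀ U : Opens X, ∃ e : F ⟶ F, (∀ x ∈ U, stmap e x = LinearMap.id) ∧
    ∀ x ∉ closure (U : Set X), stmap e x = 0

/-- A sheaf has bump operators if there are endomorphisms which are the identity near a given point
and vanish outside of a given neighbourhood. -/
def HasBump (F : Shv k X) : Prop :=
  ∀ (U : Opens X), ∀ x ∈ U, ∃ (e : F ⟶ F) (V : Opens X) (C : Set X), x ∈ V ∧ IsClosed C ∧ C ⊆ U ∧
    (∀ y ∈ V, stmap e y = LinearMap.id) ∧ ∀ y ∉ C, stmap e y = 0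

lemma HasBump.exists_of_isCompact {F : Shv k X} (hF : HasBump F) {K : Set X} (hK : IsCompact K)
    {U : Opens X} (hKU : K ⊆ U) : ∃ (e : F ⟶ F) (C : Set X), IsClosed C ∧ C ⊆ U ∧
      (∀ y ∈ K, stmap e y = LinearMap.id) ∧ ∀ y ∉ C, stmap e y = 0 := by
  refine hK.induction_on (p := fun S ↦ ∃ (e : F ⟶ F) (C : Set X), IsClosed C ∧ C ⊆ U ∧
      (∀ y ∈ S, stmap e y = LinearMap.id) ∧ ∀ y ∉ C, stmap e y = 0)
    ⟨0, ∅, isClosed_empty, Set.empty_subset _, fun y hy ↦ hy.elim, fun y _ ↦ stmap_zero _ _ _⟩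
    ?_ ?_ ?_
  · rintro S T hST ⟨e, C, hC, hCU, h1, h2⟩
    exact ⟨e, C, hC, hCU, fun y hy ↦ h1 y (hST hy), h2⟩
  · rintro S T ⟨e, C, hC, hCU, h1, h2⟩ ⟨e', C', hC', hCU', h1', h2'⟩
    -- This is 1 - (1 - e)(1 - e'), which is the identity wherever one of the two operators is.
    refine ⟨e + e' - e ≫ e', C ∪ C', hC.union hC', Set.union_subset hCU hCU', ?_, ?_⟩
    · rintro y (hy | hy)
      · simp [h1 y hy]
      · simp [h1' y hy]
    · intro y hy
      rw [Set.mem_union, not_or] at hy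
      simp [h2 y hy.1, h2' y hy.2]
  · intro x hx
    obtain ⟨e, V, C, hxV, hC, hCU, h1, h2⟩ := hF U x (hKU hx)
    exact ⟨V, mem_nhdsWithin_of_mem_nhds (V.isOpen.mem_nhds hxV), e, C, hC, hCU, h1, h2⟩

/-- An operator which is the identity on `K` and vanishes off a closed subset of `U` turns a section
over `U` into one that extends by zero. -/
lemma HasBump.cSoft {F : Shv k X} (hF : HasBump F) : CSoft F := by
  intro K hK U hKU s
  obtain ⟨e, C, hC, hCU, h1, h2⟩ := hF.exists_of_isCompact hK hKU
  obtain ⟨r, hr, -⟩ := exists_glue (U := U) (V := ⟨Cᶜ, hC.isOpen_compl⟩) (smap e U s) 0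
    (fun x hx hx' ↦ by rw [gm_smap, h2 x hx', LinearMap.zero_apply, gm_zero])
  have htop : (⊤ : Opens X) ≤ U ⊔ ⟨Cᶜ, hC.isOpen_compl⟩ := fun x _ ↦ by
    by_cases hx : x ∈ C
    · exact Opens.mem_sup.2 (Or.inl (hCU hx))
    · exact Opens.mem_sup.2 (Or.inr hx)
  refine ⟨res htop r, fun x hx ↦ ?_⟩
  rw [gm_res htop r (show x ∈ (⊤ : Opens X) from trivial), hr x (hKU hx), gm_smap, h1 x hx, LinearMap.id_apply]

lemma exists_opens_closure_subset [RegularSpace X] {U : Opens X} {x : X} (hx : x ∈ U) :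
    ∃ V : Opens X, x ∈ V ∧ closure (V : Set X) ⊆ U := by
  obtain ⟨T, hT, hTc, hTU⟩ := exists_mem_nhds_isClosed_subset (U.isOpen.mem_nhds hx)
  exact ⟨⟨interior T, isOpen_interior⟩, mem_interior_iff_mem_nhds.2 hT,
    (closure_minimal interior_subset hTc).trans hTU⟩

lemma Fine.hasBump [RegularSpace X] {F : Shv k X} (hF : Fine F) : HasBump F := by
  intro U x hx
  obtain ⟨V, hxV, hVU⟩ := exists_opens_closure_subset hx
  obtain ⟨e, h1, h2⟩ := hF V
  exact ⟨e, V, _, hxV, isClosed_closure, hVU, h1, h2⟩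

/-- A cut-off along the preimage of `U` induces a cut-off along `U`, since the closure of the
preimage lies over the closure of `U`. -/
lemma Fine.properPushforward (f : X ⟶ Y) {F : Shv k X} (hF : Fine F) :
    Fine ((properPushforward k f).obj F) := by
  intro U
  obtain ⟨e, h1, h2⟩ := hF ((Opens.map f).obj U)
  refine ⟨(SheafConvolution.properPushforward k f).map e, fun y hy ↦ ?_, fun y hy ↦ ?_⟩
  · refine stmap_ext fun V hV s ↦ ?_
    rw [LinearMap.id_apply, ← gm_smap, gm_eq_iff_psVal hV hV]
    rintro x rfl
    rw [gm_psVal_smap, h1 x hy, LinearMap.id_apply]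
  · refine stmap_ext fun V hV s ↦ ?_
    rw [LinearMap.zero_apply, ← gm_smap, gm_eq_zero_iff_psVal hV]
    rintro x rfl
    rw [gm_psVal_smap, h2 x, LinearMap.zero_apply]
    exact fun hx ↦ hy ((f.hom.continuous.closure_preimage_subset U) hx)

lemma stmap_tensMap_id {F G : Shv k X} {φ : F ⟶ F} {ψ : G ⟶ G} {x : X}
    (hφ : stmap φ x = LinearMap.id) (hψ : stmap ψ x = LinearMap.id) :
    stmap (tensMap φ ψ) x = LinearMap.id := by
  ext e
  obtain ⟨e, rfl⟩ := (tensStalk F G x).surjective e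
  rw [stmap_tensMap, hφ, hψ, TensorProduct.map_id]
  rfl

lemma stmap_tensMap_zero {F F' G G' : Shv k X} {φ : F ⟶ F'} {ψ : G ⟶ G'} {x : X}
    (h : stmap φ x = 0 ∨ stmap ψ x = 0) : stmap (tensMap φ ψ) x = 0 := by
  ext e
  obtain ⟨e, rfl⟩ := (tensStalk F G x).surjective e
  rw [stmap_tensMap]
  rcases h with h | h <;> simp [h]

lemma stmap_pullback_id {f : X ⟶ Y} {G : Shv k Y} {φ : G ⟶ G} {x : X}
    (hφ : stmap φ (f x) = LinearMap.id) : stmap ((pullback k f).map φ) x = LinearMap.id := by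
  ext e
  obtain ⟨e, rfl⟩ := (pbStalk f G x).surjective e
  rw [stmap_pullback, hφ]
  rfl

lemma stmap_pullback_zero {f : X ⟶ Y} {G H : Shv k Y} {φ : G ⟶ H} {x : X}
    (hφ : stmap φ (f x) = 0) : stmap ((pullback k f).map φ) x = 0 := by
  ext e
  obtain ⟨e, rfl⟩ := (pbStalk f G x).surjective e
  rw [stmap_pullback, hφ]
  simp

/-- As `(f, g)` is inducing, preimages of boxes form a basis of `Z`, and the tensor product of two
cut-offs is a cut-off along a box. The operators are kept in product form, because the Künneth
morphism commutes with operators of this form. -/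
lemma Fine.exists_boxMap [RegularSpace X] [RegularSpace Y] (f : Z ⟶ X) (g : Z ⟶ Y)
    (hfg : IsInducing fun z ↦ (f z, g z)) {A : Shv k X} {B : Shv k Y} (hA : Fine A)
    (hB : Fine B) {U : Opens Z} {z : Z} (hz : z ∈ U) :
    ∃ (e₁ : A ⟶ A) (e₂ : B ⟶ B) (V : Opens Z) (C : Set Z), z ∈ V ∧ IsClosed C ∧ C ⊆ U ∧
      (∀ y ∈ V, stmap (tensMap ((pullback k f).map e₁) ((pullback k g).map e₂)) y =
        LinearMap.id) ∧
      ∀ y ∉ C, stmap (tensMap ((pullback k f).map e₁) ((pullback k g).map e₂)) y = 0 := by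
  obtain ⟨W, hW, hWU⟩ := hfg.isOpen_iff.1 U.isOpen
  have hzW : (f z, g z) ∈ W := by
    change z ∈ (fun z ↦ (f z, g z)) ⁻¹' W
    rw [hWU]
    exact hz
  obtain ⟨W₁, W₂, hW₁, hW₂, hz₁, hz₂, hsub⟩ := isOpen_prod_iff.1 hW _ _ hzW
  obtain ⟨V₁, hzV₁, hV₁⟩ := exists_opens_closure_subset (U := ⟨W₁, hW₁⟩) hz₁
  obtain ⟨V₂, hzV₂, hV₂⟩ := exists_opens_closure_subset (U := ⟨W₂, hW₂⟩) hz₂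
  obtain ⟨e₁, h₁, h₁'⟩ := hA V₁
  obtain ⟨e₂, h₂, h₂'⟩ := hB V₂
  refine ⟨e₁, e₂,
    (Opens.map f).obj V₁ ⊓ (Opens.map g).obj V₂,
    f ⁻¹' (closure V₁) ∩ g ⁻¹' (closure V₂), ⟨hzV₁, hzV₂⟩,
    (isClosed_closure.preimage f.hom.continuous).inter
      (isClosed_closure.preimage g.hom.continuous), ?_, ?_, ?_⟩
  · intro y hy
    rw [← hWU]
    exact hsub ⟨hV₁ hy.1, hV₂ hy.2⟩
  · intro y hy
    exact stmap_tensMap_id (stmap_pullback_id (h₁ _ hy.1)) (stmap_pullback_id (h₂ _ hy.2))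
  · intro y hy
    rw [Set.mem_inter_iff, not_and_or] at hy
    refine stmap_tensMap_zero (hy.imp (fun h ↦ ?_) (fun h ↦ ?_))
    · exact stmap_pullback_zero (h₁' _ h)
    · exact stmap_pullback_zero (h₂' _ h)

lemma Fine.hasBump_tens [RegularSpace X] [RegularSpace Y] (f : Z ⟶ X) (g : Z ⟶ Y)
    (hfg : IsInducing fun z ↦ (f z, g z)) {A : Shv k X} {B : Shv k Y} (hA : Fine A)
    (hB : Fine B) : HasBump (tens ((pullback k f).obj A) ((pullback k g).obj B)) := by
  intro U z hz
  obtain ⟨e₁, e₂, V, C, h⟩ := Fine.exists_boxMap f g hfg hA hB hz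
  exact ⟨_, V, C, h⟩

/-- The Godement sheaf of a sheaf: the sections are all the families of germs. -/
def godement (F : Shv k X) : Shv k X :=
  ⟨{ obj U := ModuleCat.of k (∀ x : U.unop, stk F x.1)
     map i := ModuleCat.ofHom
      { toFun := fun s x ↦ s ⟨x.1, i.unop.le x.2⟩
        map_add' := fun _ _ ↦ rfl
        map_smul' := fun _ _ ↦ rfl } }, by
    rw [← TopCat.Presheaf.IsSheaf,
      TopCat.Presheaf.isSheaf_iff_isSheaf_comp (forget (ModuleCat.{u} k))]
    exact TopCat.Presheaf.toTypes_isSheaf X (fun x : X ↦ stk F x)⟩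

/-- The canonical morphism from a sheaf to its Godement sheaf. -/
def toGodement (F : Shv k X) : F ⟶ godement F :=
  homMk (G := godement F) (fun U ↦
    { toFun := fun s (x : U) ↦ gm s x.1
      map_add' := fun s t ↦ funext fun x ↦ gm_add s t x.1
      map_smul' := fun c s ↦ funext fun x ↦ gm_smul c s x.1 })
    (fun hUV s ↦ funext fun x ↦ gm_res hUV s x.2)

open Classical in
/-- The endomorphism of the Godement sheaf which sets the germs outside of `U` to zero. -/
def godementCut (F : Shv k X) (U : Opens X) : godement F ⟶ godement F :=
  homMk (F := godement F) (G := godement F) (fun V ↦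
    { toFun := fun (s : ∀ x : V, stk F x.1) (x : V) ↦ if x.1 ∈ U then s x else 0
      map_add' := fun s t ↦ funext fun (x : V) ↦ by
        change (if x.1 ∈ U then s x + t x else 0) =
          (if x.1 ∈ U then s x else 0) + if x.1 ∈ U then t x else 0
        split_ifs
        · rfl
        · rw [add_zero]
      map_smul' := fun c s ↦ funext fun (x : V) ↦ by
        change (if x.1 ∈ U then c • s x else 0) = c • if x.1 ∈ U then s x else 0
        split_ifs
        · rfl
        · rw [smul_zero] })
    (fun hUV s ↦ rfl)

instance (F : Shv k X) : Mono (toGodement F) := by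
  rw [mono_iff_stmap]
  intro x
  rw [injective_iff_map_eq_zero]
  intro e he
  obtain ⟨U, hU, s, rfl⟩ := exists_gm e
  rw [← gm_smap] at he
  obtain ⟨W, hW, hWU, h0⟩ := exists_gm_eq_zero hU he
  have h1 : res hWU (smap (toGodement F) U s) = 0 := sec_ext fun y hy ↦ by
    rw [gm_res _ _ hy, h0 y hy, gm_zero]
  exact congrFun (show (fun y : W ↦ gm s y.1) = fun _ ↦ 0 from h1) ⟨x, hW⟩

/-- Injective sheaves are fine. -/
lemma Fine.of_injective (I : Shv k X) [Injective I] : Fine I := by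
  intro U
  let r : godement I ⟶ I := Injective.factorThru (𝟙 I) (toGodement I)
  have hr : toGodement I ≫ r = 𝟙 I := Injective.comp_factorThru _ _
  -- A germ of the Godement sheaf is not determined by its value at the point, so the cut is
  -- computed on whole open sets, contained in `U` or disjoint from it. This is why nothing is
  -- claimed on the boundary of `U`.
  have key : ∀ (V : Opens X) (s : sec I V) (V' : Opens X) (hV : V' ≤ V),
      ((V' ≤ U) → res hV (smap (toGodement I ≫ godementCut I U) V s) =
        res hV (smap (toGodement I) V s)) ∧
      ((∀ x ∈ V', x ∉ U) → res hV (smap (toGodement I ≫ godementCut I U) V s) = 0) := by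
    intro V s V' hV
    constructor
    · intro h
      exact funext fun x : V' ↦ if_pos (h x.2)
    · intro h
      exact funext fun x : V' ↦ if_neg (h x.1 x.2)
  refine ⟨(toGodement I ≫ godementCut I U) ≫ r, fun x hx ↦ stmap_ext fun V hV s ↦ ?_,
    fun x hx ↦ stmap_ext fun V hV s ↦ ?_⟩
  · have hx' : x ∈ V ⊓ U := ⟨hV, hx⟩
    rw [stmap_comp, LinearMap.comp_apply, ← gm_smap, ← gm_res inf_le_left _ hx',
      (key V s (V ⊓ U) inf_le_left).1 inf_le_right, gm_res _ _ hx', gm_smap,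
      ← LinearMap.comp_apply, ← stmap_comp, hr, stmap_id]
  · let O : Opens X := ⟨(closure (U : Set X))ᶜ, isClosed_closure.isOpen_compl⟩
    have hx' : x ∈ V ⊓ O := ⟨hV, hx⟩
    rw [stmap_comp, LinearMap.comp_apply, ← gm_smap, ← gm_res inf_le_left _ hx',
      (key V s (V ⊓ O) inf_le_left).2 (fun y hy h ↦ hy.2 (subset_closure h)), gm_zero, map_zero,
      LinearMap.zero_apply]

lemma CSoft.of_injective [RegularSpace X] (I : Shv k X) [Injective I] : CSoft I :=
  (Fine.of_injective I).hasBump.cSoft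

end Fine

end SheafConvolution

end

noncomputable section

namespace SheafConvolution

/-! ### Mapping cones and injective resolutions -/

section Cone

variable {C : Type*} [Category* C] [Abelian C]

/-- Additive functors commute with mapping cones, so this reduces the preservation of
quasi-isomorphisms to the preservation of acyclicity. -/
lemma quasiIso_iff_acyclic_mappingCone {K L : CochainComplex C ℤ} (φ : K ⟶ L) :
    QuasiIso φ ↔ (CochainComplex.mappingCone φ).Acyclic := by
  have h := (HomotopyCategory.subcategoryAcyclic C).trW_iff_of_distinguished _
    (HomotopyCategory.mappingCone_triangleh_distinguished φ)
  rw [← HomotopyCategory.quasiIso_eq_trW_subcategoryAcyclic] at h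
  refine (HomotopyCategory.quotient_map_mem_quasiIso_iff φ).symm.trans (h.trans ?_)
  exact HomotopyCategory.quotient_obj_mem_subcategoryAcyclic_iff_acyclic _

variable [HasDerivedCategory C]

lemma isIso_plusQ_map {K L : CochainComplex.Plus C} (φ : K ⟶ L) [QuasiIso φ.hom] :
    IsIso (DerivedCategory.Plus.Q.map φ) := by
  have : IsIso (DerivedCategory.Plus.ι.map (DerivedCategory.Plus.Q.map φ)) :=
    inferInstanceAs (IsIso (DerivedCategory.Q.map φ.hom))
  exact isIso_of_fully_faithful DerivedCategory.Plus.ι _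

/-- Two isomorphic objects of the bounded below derived category are given by complexes which are
quasi-isomorphic to the same complex of injective objects. -/
lemma exists_roof_of_iso [EnoughInjectives C] {K L : CochainComplex.Plus C}
    (e : DerivedCategory.Plus.Q.obj K ≅ DerivedCategory.Plus.Q.obj L) :
    ∃ (I : CochainComplex.Plus C) (a : K ⟶ I) (b : L ⟶ I), (∀ n, Injective (I.obj.X n)) ∧
      QuasiIso a.hom ∧ QuasiIso b.hom := by
  obtain ⟨L, n, hn⟩ := L
  obtain ⟨J, hJ, b, hb⟩ := CochainComplex.Plus.exists_quasiIso_injective ⟨L, n, hn⟩ n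
  let I := (InjectiveObject.ι C).mapCochainComplexPlus.obj J
  have hb' : QuasiIso b.hom := hb
  have hQb := isIso_plusQ_map b
  have hI : CochainComplex.IsKInjective I.obj :=
    inferInstanceAs (CochainComplex.IsKInjective
      (((InjectiveObject.ι C).mapHomologicalComplex (.up ℤ)).obj J.obj))
  -- Morphisms of the derived category into a K-injective complex are homotopy classes of morphisms
  -- of complexes, so the given isomorphism is realized by an actual morphism `a`.
  obtain ⟨g, hg⟩ := (DerivedCategory.Plus.Qh_map_bijective_of_isKInjective
    ((HomotopyCategory.Plus.quotient C).obj K) ((HomotopyCategory.Plus.quotient C).obj I)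
    hI).surjective (e.hom ≫ DerivedCategory.Plus.Q.map b)
  obtain ⟨a, rfl⟩ := (HomotopyCategory.Plus.quotient C).map_surjective g
  refine ⟨I, a, b, fun n ↦ inferInstanceAs (Injective (J.obj.X n).obj), ?_, hb'⟩
  have h1 : IsIso (DerivedCategory.Plus.Q.map a) := by
    change IsIso (DerivedCategory.Plus.Qh.map ((HomotopyCategory.Plus.quotient C).map a))
    rw [hg]
    exact @IsIso.comp_isIso _ _ _ _ _ _ _ e.isIso_hom hQb
  have h2 : IsIso (DerivedCategory.Q.map a.hom) :=
    inferInstanceAs (IsIso (DerivedCategory.Plus.ι.map (DerivedCategory.Plus.Q.map a)))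
  exact (DerivedCategory.isIso_Q_map_iff_quasiIso _ _).1 h2

end Cone

/-! ### Computing Rf_! by c-soft complexes -/

section Derived

variable {k : Type u} [Field k] {X Y : TopCat.{u}}

lemma quasiIso_map_pullback (f : X ⟶ Y) {K L : CochainComplex.Plus (Shv k Y)} (φ : K ⟶ L)
    [QuasiIso φ.hom] : QuasiIso ((pullback k f).mapCochainComplexPlus.map φ).hom :=
  inferInstanceAs (QuasiIso (((pullback k f).mapHomologicalComplex _).map φ.hom))

/-- The inverse image on the derived category is computed by the inverse image of complexes. -/
def derivedPullbackQIso (f : X ⟶ Y) (K : CochainComplex.Plus (Shv k Y)) :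
    (derivedPullback k f).obj (DerivedCategory.Plus.Q.obj K) ≅
      DerivedCategory.Plus.Q.obj ((pullback k f).mapCochainComplexPlus.obj K) :=
  DerivedCategory.Plus.ι.preimageIso ((pullback k f).mapDerivedCategoryFactors.app K.obj)

variable [T2Space X] [LocallyCompactSpace X] [T2Space Y] [LocallyCompactSpace Y]

/-- The direct image with proper supports preserves quasi-isomorphisms between bounded below
complexes of c-soft sheaves. -/
lemma quasiIso_map_properPushforward (f : X ⟶ Y) {K L : CochainComplex.Plus (Shv k X)}
    (φ : K ⟶ L) [QuasiIso φ.hom] (hK : ∀ i, CSoft (K.obj.X i)) (hL : ∀ i, CSoft (L.obj.X i)) :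
    QuasiIso ((properPushforward k f).mapCochainComplexPlus.map φ).hom := by
  change QuasiIso (((properPushforward k f).mapHomologicalComplex _).map φ.hom)
  obtain ⟨K, a, ha⟩ := K
  obtain ⟨L, b, hb⟩ := L
  obtain ⟨φ, rfl⟩ := ObjectProperty.homMk_surjective φ
  have : QuasiIso φ := inferInstanceAs (QuasiIso (ObjectProperty.homMk φ).hom)
  change QuasiIso (((properPushforward k f).mapHomologicalComplex _).map φ)
  have h1 : (CochainComplex.mappingCone φ).IsStrictlyGE (min a b - 1) := by
    have := CochainComplex.isStrictlyGE_of_ge K (min a b) a (by lia)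
    have := CochainComplex.isStrictlyGE_of_ge L (min a b - 1) b (by lia)
    exact CochainComplex.isStrictlyGE_mappingCone φ (min a b) (min a b - 1) _ (by lia) (by lia)
  have h2 := (quasiIso_iff_acyclic_mappingCone φ).1 this
  rw [quasiIso_iff_acyclic_mappingCone]
  intro i
  -- In degree `i` the cone is the direct sum of the terms `K.X (i + 1)` and `L.X i`.
  have h3 : ∀ i, CSoft ((CochainComplex.mappingCone φ).X i) := fun i ↦
    CSoft.of_sum (Finset.univ : Finset Bool)
      (G := fun j ↦ match j with | true => K.X (i + 1) | false => L.X i)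
      (fun j ↦ match j with
        | true => (CochainComplex.mappingCone.fst φ).1.v i (i + 1) rfl
        | false => (CochainComplex.mappingCone.snd φ).v i i (add_zero i))
      (fun j ↦ match j with
        | true => (CochainComplex.mappingCone.inl φ).v (i + 1) i (by lia)
        | false => (CochainComplex.mappingCone.inr φ).f i)
      (by rw [Fintype.sum_bool]; exact CochainComplex.mappingCone.id_X φ i (i + 1) rfl)
      (fun j _ ↦ match j with
        | true => hK (i + 1)
        | false => hL i)
  exact (exactAt_properPushforward f _ (min a b - 1) h3 h2 i).of_iso
    (CochainComplex.mappingCone.mapHomologicalComplexIso φ (properPushforward k f))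

/-- The derived functor is computed by an injective resolution; its terms are c-soft too, so f_!
preserves the quasi-isomorphism from `K` to it. -/
lemma nonempty_derivedProperPushforward_iso (f : X ⟶ Y) {K : CochainComplex.Plus (Shv k X)}
    (hK : ∀ i, CSoft (K.obj.X i)) :
    Nonempty ((derivedProperPushforward k f).obj (DerivedCategory.Plus.Q.obj K) ≅
      DerivedCategory.Plus.Q.obj ((properPushforward k f).mapCochainComplexPlus.obj K)) := by
  obtain ⟨K, n, hn⟩ := K
  obtain ⟨J, hJ, b, hb⟩ := CochainComplex.Plus.exists_quasiIso_injective ⟨K, n, hn⟩ n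
  let I := (InjectiveObject.ι (Shv k X)).mapCochainComplexPlus.obj J
  have hb' : QuasiIso b.hom := hb
  have h1 := isIso_plusQ_map b
  have hI : ∀ i, CSoft (I.obj.X i) := fun i ↦
    have : Injective (I.obj.X i) := inferInstanceAs (Injective (J.obj.X i).obj)
    CSoft.of_injective _
  have h2 := quasiIso_map_properPushforward f b hK hI
  have h3 := isIso_plusQ_map ((properPushforward k f).mapCochainComplexPlus.map b)
  have h4 : IsIso ((properPushforward k f).rightDerivedFunctorPlusUnit.app
      ((HomotopyCategory.Plus.quotient _).obj I)) := inferInstanceAs (IsIso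
    ((properPushforward k f).rightDerivedFunctorPlusUnit.app
      ((InjectiveObject.ι _).mapHomotopyCategoryPlus.obj
        ((HomotopyCategory.Plus.quotient _).obj J))))
  exact ⟨(derivedProperPushforward k f).mapIso (@asIso _ _ _ _ _ h1) ≪≫
    (@asIso _ _ _ _ _ h4).symm ≪≫ (@asIso _ _ _ _ _ h3).symm⟩

/-- The single complex, as a bounded below complex. -/
def singlePlus (F : Shv k X) : CochainComplex.Plus (Shv k X) :=
  ⟨(HomologicalComplex.single (Shv k X) (ComplexShape.up ℤ) 0).obj F, 0,
    inferInstanceAs (((CochainComplex.singleFunctor (Shv k X) 0).obj F).IsStrictlyGE 0)⟩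

/-- The single functor to the derived category is given by single complexes. -/
def singlePlusIso (F : Shv k X) : (DerivedCategory.Plus.singleFunctor (Shv k X) 0).obj F ≅
    DerivedCategory.Plus.Q.obj (singlePlus F) :=
  DerivedCategory.Plus.ι.preimageIso ((DerivedCategory.singleFunctorIsoCompQ (Shv k X) 0).app F)

/-- The derived direct image with proper supports of a sheaf is computed by a c-soft resolution. -/
lemma nonempty_derivedProperPushforward_single_iso (f : X ⟶ Y) {F : Shv k X}
    {K : CochainComplex.Plus (Shv k X)} (φ : singlePlus F ⟶ K) [QuasiIso φ.hom]
    (hK : ∀ i, CSoft (K.obj.X i)) :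
    Nonempty ((derivedProperPushforward k f).obj
        ((DerivedCategory.Plus.singleFunctor (Shv k X) 0).obj F) ≅
      DerivedCategory.Plus.Q.obj ((properPushforward k f).mapCochainComplexPlus.obj K)) := by
  obtain ⟨e⟩ := nonempty_derivedProperPushforward_iso f hK
  exact ⟨(derivedProperPushforward k f).mapIso (singlePlusIso F ≪≫
    @asIso _ _ _ _ _ (isIso_plusQ_map φ)) ≪≫ e⟩

end Derived

end SheafConvolution

end

noncomputable section

namespace SheafConvolution

/-! ### Total complexes with finitely many nonzero summands in each degree -/

section Total

open HomologicalComplex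

variable {C₁ C₂ D E : Type*} [Category* C₁] [Category* C₂] [Category* D] [Category* E]
  [HasZeroMorphisms C₁] [HasZeroMorphisms C₂] [Preadditive D] [Preadditive E]
  (K : CochainComplex C₁ ℤ) (L : CochainComplex C₂ ℤ)
  (F : C₁ ⥤ C₂ ⥤ D) [F.PreservesZeroMorphisms] [∀ X, (F.obj X).PreservesZeroMorphisms]

variable {K L F} in
lemma isZero_totSummand [HasZeroObject D] {a b : ℤ} [K.IsStrictlyGE a] [L.IsStrictlyGE b] {i j n : ℤ}
    (h : i + j = n) (hi : i ∉ Finset.Icc a (n - b)) : IsZero ((F.obj (K.X i)).obj (L.X j)) := by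
  by_cases hia : i < a
  · exact (F.map_isZero (K.isZero_of_isStrictlyGE a i hia)).obj _
  · exact (F.obj (K.X i)).map_isZero (L.isZero_of_isStrictlyGE b j (by
      rw [Finset.mem_Icc] at hi
      lia))

variable [HasMapBifunctor K L F (ComplexShape.up ℤ)]

/-- The inclusion of a summand in a total complex. -/
abbrev totι (i j n : ℤ) (h : i + j = n) :
    (F.obj (K.X i)).obj (L.X j) ⟶ (mapBifunctor K L F (ComplexShape.up ℤ)).X n :=
  ιMapBifunctor K L F (ComplexShape.up ℤ) i j n h

/-- The projection to a summand of a total complex. -/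
def totπ (i j n : ℤ) (h : i + j = n) :
    (mapBifunctor K L F (ComplexShape.up ℤ)).X n ⟶ (F.obj (K.X i)).obj (L.X j) :=
  mapBifunctorDesc (fun i' j' (h' : i' + j' = n) ↦ if hi : i' = i then
    eqToHom (by obtain rfl : j' = j := by lia
                rw [hi]) else 0)

lemma totι_totπ_self (i j n : ℤ) (h : i + j = n) :
    totι K L F i j n h ≫ totπ K L F i j n h = 𝟙 _ := by
  rw [totπ, ι_mapBifunctorDesc]
  simp

lemma totι_totπ_of_ne {i j i' j' n : ℤ} (h : i + j = n) (h' : i' + j' = n) (hi : i' ≠ i) :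
    totι K L F i' j' n h' ≫ totπ K L F i j n h = 0 := by
  rw [totπ, ι_mapBifunctorDesc, dif_neg hi]

/-- Since `K` starts in degree `a` and `L` in degree `b`, only the indices `i` from `a` to `n - b`
contribute, and the coproduct is a finite biproduct. -/
lemma sum_totπ_totι [HasZeroObject D] (a b : ℤ) [K.IsStrictlyGE a] [L.IsStrictlyGE b] (n : ℤ) :
    ∑ i ∈ Finset.Icc a (n - b), totπ K L F i (n - i) n (by lia) ≫
      totι K L F i (n - i) n (by lia) = 𝟙 _ := by
  refine mapBifunctor.hom_ext fun i j (h : i + j = n) ↦ ?_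
  by_cases hi : i ∈ Finset.Icc a (n - b)
  · obtain rfl : j = n - i := by lia
    rw [Preadditive.comp_sum, Finset.sum_eq_single i]
    · rw [← Category.assoc, totι_totπ_self, Category.id_comp, Category.comp_id]
    · intro i' _ hne
      rw [← Category.assoc, totι_totπ_of_ne _ _ _ _ _ hne.symm, zero_comp]
    · exact fun h ↦ (h hi).elim
  · exact (isZero_totSummand h hi).eq_of_src _ _

lemma totι_d (i j n : ℤ) (h : i + j = n) :
    totι K L F i j n h ≫ (mapBifunctor K L F (ComplexShape.up ℤ)).d n (n + 1) =
      (F.map (K.d i (i + 1))).app (L.X j) ≫ totι K L F (i + 1) j (n + 1) (by lia) +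
      i.negOnePow • ((F.obj (K.X i)).map (L.d j (j + 1)) ≫
        totι K L F i (j + 1) (n + 1) (by lia)) := by
  rw [mapBifunctor.d_eq, Preadditive.comp_add, mapBifunctor.ι_D₁, mapBifunctor.ι_D₂,
    mapBifunctor.d₁_eq K L F _ (i₁' := i + 1) (by simp) j (n + 1) (by change _ + _ = _; lia),
    mapBifunctor.d₂_eq K L F _ i (i₂' := j + 1) (by simp) (n + 1) (by change _ + _ = _; lia)]
  change (1 : ℤˣ) • _ + i.negOnePow • _ = _
  rw [one_smul]

-- The terms of the total complex are finite biproducts, so any additive functor preserves their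
-- decomposition. No commutation of `G` with infinite coproducts is needed.
variable {K L F} in
lemma map_tot_hom_ext [HasZeroObject D] (a b : ℤ) [K.IsStrictlyGE a] [L.IsStrictlyGE b] (G : D ⥤ E) [G.Additive]
    {n : ℤ} {Z : E} {f g : G.obj ((mapBifunctor K L F (ComplexShape.up ℤ)).X n) ⟶ Z}
    (h : ∀ (i j : ℤ) (h : i + j = n),
      G.map (totι K L F i j n h) ≫ f = G.map (totι K L F i j n h) ≫ g) : f = g := by
  rw [← Category.id_comp f, ← Category.id_comp g, ← G.map_id, ← sum_totπ_totι K L F a b n]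
  simp only [Functor.map_sum, Functor.map_comp, Preadditive.sum_comp, Category.assoc, h]

variable {K L F} {C₁' C₂' D' : Type*} [Category* C₁'] [Category* C₂'] [Category* D']
  [HasZeroMorphisms C₁'] [HasZeroMorphisms C₂'] [Preadditive D']
  {K' : CochainComplex C₁' ℤ} {L' : CochainComplex C₂' ℤ}
  {F' : C₁' ⥤ C₂' ⥤ D'} [F'.PreservesZeroMorphisms] [∀ X, (F'.obj X).PreservesZeroMorphisms]
  [HasMapBifunctor K' L' F' (ComplexShape.up ℤ)]
  {G : D ⥤ E} {G' : D' ⥤ E} [G.Additive] [G'.Additive]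

/-- A morphism between total complexes which is given by morphisms between the summands. -/
lemma exists_totHom [HasZeroObject D] (a b : ℤ) [K.IsStrictlyGE a] [L.IsStrictlyGE b]
    (θ : ∀ i j, G.obj ((F.obj (K.X i)).obj (L.X j)) ⟶ G'.obj ((F'.obj (K'.X i)).obj (L'.X j)))
    (h₁ : ∀ i j, G.map ((F.map (K.d i (i + 1))).app (L.X j)) ≫ θ (i + 1) j =
      θ i j ≫ G'.map ((F'.map (K'.d i (i + 1))).app (L'.X j)))
    (h₂ : ∀ i j, G.map ((F.obj (K.X i)).map (L.d j (j + 1))) ≫ θ i (j + 1) =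
      θ i j ≫ G'.map ((F'.obj (K'.X i)).map (L'.d j (j + 1)))) :
    ∃ Φ : (G.mapHomologicalComplex _).obj (mapBifunctor K L F (ComplexShape.up ℤ)) ⟶
        (G'.mapHomologicalComplex _).obj (mapBifunctor K' L' F' (ComplexShape.up ℤ)),
      ∀ i j n (h : i + j = n), G.map (totι K L F i j n h) ≫ Φ.f n =
        θ i j ≫ G'.map (totι K' L' F' i j n h) := by
  let φ (n : ℤ) : G.obj ((mapBifunctor K L F (ComplexShape.up ℤ)).X n) ⟶
      G'.obj ((mapBifunctor K' L' F' (ComplexShape.up ℤ)).X n) :=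
    ∑ i ∈ Finset.Icc a (n - b), G.map (totπ K L F i (n - i) n (by lia)) ≫ θ i (n - i) ≫
      G'.map (totι K' L' F' i (n - i) n (by lia))
  have hφ : ∀ i j n (h : i + j = n), G.map (totι K L F i j n h) ≫ φ n =
        θ i j ≫ G'.map (totι K' L' F' i j n h) := by
    intro i j n h
    by_cases hi : i ∈ Finset.Icc a (n - b)
    · obtain rfl : j = n - i := by lia
      rw [Preadditive.comp_sum, Finset.sum_eq_single i]
      · rw [← Category.assoc, ← G.map_comp, totι_totπ_self, G.map_id, Category.id_comp]
      · intro i' _ hne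
        rw [← Category.assoc, ← G.map_comp, totι_totπ_of_ne _ _ _ _ _ hne.symm, G.map_zero,
          zero_comp]
      · exact fun h ↦ (h hi).elim
    · exact (G.map_isZero (isZero_totSummand h hi)).eq_of_src _ _
  refine ⟨{ f := φ, comm' := ?_ }, hφ⟩
  rintro n _ rfl
  refine map_tot_hom_ext a b G fun i j h ↦ ?_
  refine (Category.assoc _ _ _).symm.trans ((eq_whisker (hφ i j n h) _).trans ?_)
  change (θ i j ≫ G'.map (totι K' L' F' i j n h)) ≫
    G'.map ((mapBifunctor K' L' F' (ComplexShape.up ℤ)).d n (n + 1)) =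
      G.map (totι K L F i j n h) ≫
        G.map ((mapBifunctor K L F (ComplexShape.up ℤ)).d n (n + 1)) ≫ φ (n + 1)
  rw [Category.assoc, ← G'.map_comp, totι_d, ← Category.assoc, ← G.map_comp, totι_d]
  simp only [Units.smul_def, Functor.map_add, Functor.map_zsmul, Functor.map_comp,
    Preadditive.comp_add, Preadditive.add_comp, Preadditive.comp_zsmul, Preadditive.zsmul_comp,
    Category.assoc, hφ]
  rw [reassoc_of% h₁, reassoc_of% h₂]

/-- An isomorphism between total complexes which is given by isomorphisms between the summands. -/
lemma exists_totIso [HasZeroObject D] [HasZeroObject D'] (a b : ℤ) [K.IsStrictlyGE a] [L.IsStrictlyGE b] (a' b' : ℤ)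
    [K'.IsStrictlyGE a'] [L'.IsStrictlyGE b']
    (θ : ∀ i j, G.obj ((F.obj (K.X i)).obj (L.X j)) ≅ G'.obj ((F'.obj (K'.X i)).obj (L'.X j)))
    (h₁ : ∀ i j, G.map ((F.map (K.d i (i + 1))).app (L.X j)) ≫ (θ (i + 1) j).hom =
      (θ i j).hom ≫ G'.map ((F'.map (K'.d i (i + 1))).app (L'.X j)))
    (h₂ : ∀ i j, G.map ((F.obj (K.X i)).map (L.d j (j + 1))) ≫ (θ i (j + 1)).hom =
      (θ i j).hom ≫ G'.map ((F'.obj (K'.X i)).map (L'.d j (j + 1)))) :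
    ∃ Φ : (G.mapHomologicalComplex _).obj (mapBifunctor K L F (ComplexShape.up ℤ)) ≅
        (G'.mapHomologicalComplex _).obj (mapBifunctor K' L' F' (ComplexShape.up ℤ)),
      ∀ i j n (h : i + j = n), G.map (totι K L F i j n h) ≫ Φ.hom.f n =
        (θ i j).hom ≫ G'.map (totι K' L' F' i j n h) := by
  obtain ⟨Φ, hΦ⟩ := exists_totHom (F := F) (F' := F') a b (fun i j ↦ (θ i j).hom) h₁ h₂
  obtain ⟨Ψ, hΨ⟩ := exists_totHom (F := F') (F' := F) a' b' (fun i j ↦ (θ i j).inv)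
    (fun i j ↦ by rw [Iso.comp_inv_eq, Category.assoc, h₁, Iso.inv_hom_id_assoc])
    (fun i j ↦ by rw [Iso.comp_inv_eq, Category.assoc, h₂, Iso.inv_hom_id_assoc])
  refine ⟨⟨Φ, Ψ, ?_, ?_⟩, hΦ⟩
  · ext n
    refine map_tot_hom_ext a b G fun i j h ↦ ?_
    refine (Category.assoc _ _ _).symm.trans ((eq_whisker (hΦ i j n h) _).trans ?_)
    refine (Category.assoc _ _ _).trans ((whisker_eq _ (hΨ i j n h)).trans ?_)
    exact (Iso.hom_inv_id_assoc _ _).trans (Category.comp_id _).symm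
  · ext n
    refine map_tot_hom_ext a' b' G' fun i j h ↦ ?_
    refine (Category.assoc _ _ _).symm.trans ((eq_whisker (hΨ i j n h) _).trans ?_)
    refine (Category.assoc _ _ _).trans ((whisker_eq _ (hΦ i j n h)).trans ?_)
    exact (Iso.inv_hom_id_assoc _ _).trans (Category.comp_id _).symm

end Total

end SheafConvolution

end

noncomputable section

namespace SheafConvolution

/-! ### Quasi-isomorphisms of sheaves on stalks -/

section StalkComplex

open HomologicalComplex

variable {k : Type u} [Field k] {X : TopCat.{u}}

lemma acyclic_iff_stalk (K : CochainComplex (Shv k X) ℤ) :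
    K.Acyclic ↔ ∀ x : X, (((stalkAt k x).mapHomologicalComplex _).obj K).Acyclic := by
  have h : ∀ n, K.ExactAt n ↔
      ∀ x : X, (((stalkAt k x).mapHomologicalComplex _).obj K).ExactAt n := by
    intro n
    rw [exactAt_iff, TopCat.Sheaf.exact_iff_stalkFunctor_map_exact]
    exact forall_congr' fun x ↦ Iff.rfl
  exact (forall_congr' h).trans forall_comm

lemma quasiIso_iff_stalk {K L : CochainComplex (Shv k X) ℤ} (φ : K ⟶ L) :
    QuasiIso φ ↔ ∀ x : X, QuasiIso (((stalkAt k x).mapHomologicalComplex _).map φ) := by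
  rw [quasiIso_iff_acyclic_mappingCone, acyclic_iff_stalk]
  refine forall_congr' fun x ↦ ?_
  rw [quasiIso_iff_acyclic_mappingCone]
  let e := CochainComplex.mappingCone.mapHomologicalComplexIso φ (stalkAt k x)
  exact ⟨fun h i ↦ (h i).of_iso e, fun h i ↦ (h i).of_iso e.symm⟩

end StalkComplex

/-! ### Tensor products of complexes of vector spaces -/

section VectorSpaces

open HomologicalComplex

variable (k : Type u) [Field k]

/-- The tensor product of vector spaces, as a bifunctor. -/
abbrev vecTensor : ModuleCat.{u} k ⥤ ModuleCat.{u} k ⥤ ModuleCat.{u} k :=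
  MonoidalCategory.curriedTensor (ModuleCat.{u} k)

instance (V : ModuleCat.{u} k) : ((vecTensor k).obj V).Additive :=
  inferInstanceAs ((MonoidalCategory.tensorLeft V).Additive)

variable {k}

instance (V : ModuleCat.{u} k) : Injective V where
  factors {A B} g f _ := by
    obtain ⟨r, hr⟩ := (f.hom).exists_leftInverse_of_injective
      (LinearMap.ker_eq_bot.2 ((ModuleCat.mono_iff_injective f).1 inferInstance))
    refine ⟨ModuleCat.ofHom (g.hom ∘ₗ r), ?_⟩
    ext x
    exact congrArg g.hom (LinearMap.congr_fun hr x)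

lemma mapBifunctorMap_comp {C₁ C₂ D : Type*} [Category* C₁] [Category* C₂] [Category* D]
    [HasZeroMorphisms C₁] [HasZeroMorphisms C₂] [Preadditive D]
    {F : C₁ ⥤ C₂ ⥤ D} [F.PreservesZeroMorphisms] [∀ X, (F.obj X).PreservesZeroMorphisms]
    {K₁ K₂ K₃ : CochainComplex C₁ ℤ} {L₁ L₂ L₃ : CochainComplex C₂ ℤ}
    [HasMapBifunctor K₁ L₁ F (ComplexShape.up ℤ)] [HasMapBifunctor K₂ L₂ F (ComplexShape.up ℤ)]
    [HasMapBifunctor K₃ L₃ F (ComplexShape.up ℤ)]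
    (f₁ : K₁ ⟶ K₂) (f₂ : K₂ ⟶ K₃) (g₁ : L₁ ⟶ L₂) (g₂ : L₂ ⟶ L₃) :
    mapBifunctorMap f₁ g₁ F (ComplexShape.up ℤ) ≫ mapBifunctorMap f₂ g₂ F (ComplexShape.up ℤ) =
      mapBifunctorMap (f₁ ≫ f₂) (g₁ ≫ g₂) F (ComplexShape.up ℤ) := by
  ext n : 1
  refine mapBifunctor.hom_ext fun i j h ↦ ?_
  rw [comp_f, ι_mapBifunctorMap_assoc, ι_mapBifunctorMap, ι_mapBifunctorMap]
  simp

lemma mapBifunctorMap_id {C₁ C₂ D : Type*} [Category* C₁] [Category* C₂] [Category* D]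
    [HasZeroMorphisms C₁] [HasZeroMorphisms C₂] [Preadditive D]
    {F : C₁ ⥤ C₂ ⥤ D} [F.PreservesZeroMorphisms] [∀ X, (F.obj X).PreservesZeroMorphisms]
    (K : CochainComplex C₁ ℤ) (L : CochainComplex C₂ ℤ)
    [HasMapBifunctor K L F (ComplexShape.up ℤ)] :
    mapBifunctorMap (𝟙 K) (𝟙 L) F (ComplexShape.up ℤ) = 𝟙 _ := by
  ext n : 1
  refine mapBifunctor.hom_ext fun i j h ↦ ?_
  rw [ι_mapBifunctorMap]
  simp

/-- The tensor product of bounded below complexes of vector spaces preserves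
quasi-isomorphisms. -/
lemma quasiIso_mapBifunctorMap_vecTensor {K K' L L' : CochainComplex (ModuleCat.{u} k) ℤ}
    (φ : K ⟶ K') (ψ : L ⟶ L') [QuasiIso φ] [QuasiIso ψ] (a a' b b' : ℤ) [K.IsStrictlyGE a]
    [K'.IsStrictlyGE a'] [L.IsStrictlyGE b] [L'.IsStrictlyGE b'] :
    QuasiIso (mapBifunctorMap φ ψ (vecTensor k) (ComplexShape.up ℤ)) := by
  -- All vector spaces are injective, so bounded below complexes are K-injective. The two
  -- quasi-isomorphisms are therefore homotopy equivalences, which the tensor product preserves.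
  have := CochainComplex.isKInjective_of_injective K a
  have := CochainComplex.isKInjective_of_injective K' a'
  have := CochainComplex.isKInjective_of_injective L b
  have := CochainComplex.isKInjective_of_injective L' b'
  obtain ⟨e, rfl⟩ := (CochainComplex.IsKInjective.quasiIso_iff φ).1 inferInstance
  obtain ⟨e', rfl⟩ := (CochainComplex.IsKInjective.quasiIso_iff ψ).1 inferInstance
  let E : HomotopyEquiv (mapBifunctor K L (vecTensor k) (ComplexShape.up ℤ))
      (mapBifunctor K' L' (vecTensor k) (ComplexShape.up ℤ)) :=
    { hom := mapBifunctorMap e.hom e'.hom _ _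
      inv := mapBifunctorMap e.inv e'.inv _ _
      homotopyHomInvId := (Homotopy.ofEq (mapBifunctorMap_comp _ _ _ _)).trans
        ((mapBifunctorMapHomotopy₁ e.homotopyHomInvId _ _ _).trans
          ((mapBifunctorMapHomotopy₂ _ e'.homotopyHomInvId _ _).trans
            (Homotopy.ofEq (mapBifunctorMap_id _ _))))
      homotopyInvHomId := (Homotopy.ofEq (mapBifunctorMap_comp _ _ _ _)).trans
        ((mapBifunctorMapHomotopy₁ e.homotopyInvHomId _ _ _).trans
          ((mapBifunctorMapHomotopy₂ _ e'.homotopyInvHomId _ _).trans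
            (Homotopy.ofEq (mapBifunctorMap_id _ _)))) }
  exact homotopyEquivalences_le_quasiIso _ _ _ E.homotopyEquivalences_hom

end VectorSpaces

/-! ### The derived tensor product on bounded below complexes -/

section TotTensor

open HomologicalComplex

variable {k : Type u} [Field k] {X : TopCat.{u}}

/-- The isomorphism between the stalks of a tensor product and the tensor product of the stalks. -/
def tensStalkIso (F G : Shv k X) (x : X) :
    (stalkAt k x).obj (tens F G) ≅
      ((vecTensor k).obj ((stalkAt k x).obj F)).obj ((stalkAt k x).obj G) :=
  (tensStalk F G x).symm.toModuleIso

lemma tensStalkIso_naturality {F F' G G' : Shv k X} (φ : F ⟶ F') (ψ : G ⟶ G') (x : X) :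
    (stalkAt k x).map (tensMap φ ψ) ≫ (tensStalkIso F' G' x).hom =
      (tensStalkIso F G x).hom ≫ ((vecTensor k).map ((stalkAt k x).map φ)).app _ ≫
        ((vecTensor k).obj _).map ((stalkAt k x).map ψ) := by
  rw [← Iso.inv_comp_eq]
  apply ModuleCat.hom_ext
  have h : ∀ e : TensorProduct k (stk F x) (stk G x),
      (tensStalk F' G' x).symm (stmap (tensMap φ ψ) x (tensStalk F G x e)) =
        TensorProduct.map (stmap φ x) (stmap ψ x) e := fun e ↦ by
    rw [stmap_tensMap, LinearEquiv.symm_apply_apply]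
  refine (LinearMap.ext h).trans ?_
  exact TensorProduct.ext' fun a b ↦ rfl

lemma tensStalkIso_naturality_left {F F' : Shv k X} (G : Shv k X) (φ : F ⟶ F') (x : X) :
    (stalkAt k x).map (((tensor k X).map φ).app G) ≫ (tensStalkIso F' G x).hom =
      (tensStalkIso F G x).hom ≫ ((vecTensor k).map ((stalkAt k x).map φ)).app _ := by
  have h := tensStalkIso_naturality φ (𝟙 G) x
  have e : tensMap φ (𝟙 G) = ((tensor k X).map φ).app G :=
    (whisker_eq _ (((tensor k X).obj F').map_id G)).trans (Category.comp_id _)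
  rw [e] at h
  simpa only [CategoryTheory.Functor.map_id, Category.comp_id] using h

lemma tensStalkIso_naturality_right (F : Shv k X) {G G' : Shv k X} (ψ : G ⟶ G') (x : X) :
    (stalkAt k x).map (((tensor k X).obj F).map ψ) ≫ (tensStalkIso F G' x).hom =
      (tensStalkIso F G x).hom ≫ ((vecTensor k).obj _).map ((stalkAt k x).map ψ) := by
  have h := tensStalkIso_naturality (𝟙 F) ψ x
  have e : tensMap (𝟙 F) ψ = ((tensor k X).obj F).map ψ :=
    (eq_whisker (congrArg (fun f ↦ f.app G) ((tensor k X).map_id F)) _).trans (Category.id_comp _)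
  rw [e] at h
  simpa only [CategoryTheory.Functor.map_id, NatTrans.id_app, Category.id_comp] using h

lemma exists_stalk_totIso (K L : CochainComplex (Shv k X) ℤ) (a b : ℤ) [K.IsStrictlyGE a]
    [L.IsStrictlyGE b] (x : X) :
    ∃ Φ : ((stalkAt k x).mapHomologicalComplex _).obj
        (mapBifunctor K L (tensor k X) (ComplexShape.up ℤ)) ≅
      ((𝟭 (ModuleCat.{u} k)).mapHomologicalComplex _).obj
        (mapBifunctor (((stalkAt k x).mapHomologicalComplex _).obj K)
        (((stalkAt k x).mapHomologicalComplex _).obj L) (vecTensor k) (ComplexShape.up ℤ)),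
      ∀ i j n (h : i + j = n), (stalkAt k x).map (totι K L (tensor k X) i j n h) ≫ Φ.hom.f n =
        (tensStalkIso (K.X i) (L.X j) x).hom ≫ (𝟭 (ModuleCat.{u} k)).map
          (totι (((stalkAt k x).mapHomologicalComplex (ComplexShape.up ℤ)).obj K)
            (((stalkAt k x).mapHomologicalComplex (ComplexShape.up ℤ)).obj L)
            (vecTensor k) i j n h) := by
  refine exists_totIso (F := tensor k X) (F' := vecTensor k) (G := stalkAt k x)
    (K' := ((stalkAt k x).mapHomologicalComplex (ComplexShape.up ℤ)).obj K)
    (L' := ((stalkAt k x).mapHomologicalComplex (ComplexShape.up ℤ)).obj L)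
    (G' := 𝟭 (ModuleCat.{u} k)) a b a b (fun i j ↦ tensStalkIso (K.X i) (L.X j) x)
   
    (fun i j ↦ tensStalkIso_naturality_left _ _ x) (fun i j ↦ tensStalkIso_naturality_right _ _ x)

/-- The tensor product of bounded below complexes of sheaves preserves quasi-isomorphisms. -/
lemma quasiIso_mapBifunctorMap_tensor {K K' L L' : CochainComplex (Shv k X) ℤ}
    (φ : K ⟶ K') (ψ : L ⟶ L') [hφ : QuasiIso φ] [hψ : QuasiIso ψ] (a a' b b' : ℤ)
    [K.IsStrictlyGE a] [K'.IsStrictlyGE a'] [L.IsStrictlyGE b] [L'.IsStrictlyGE b'] :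
    QuasiIso (mapBifunctorMap φ ψ (tensor k X) (ComplexShape.up ℤ)) := by
  rw [quasiIso_iff_stalk]
  intro x
  obtain ⟨Φ, hΦ⟩ := exists_stalk_totIso K L a b x
  obtain ⟨Φ', hΦ'⟩ := exists_stalk_totIso K' L' a' b' x
  have h1 := (quasiIso_iff_stalk φ).1 hφ x
  have h2 := (quasiIso_iff_stalk ψ).1 hψ x
  have h3 := quasiIso_mapBifunctorMap_vecTensor (((stalkAt k x).mapHomologicalComplex _).map φ)
    (((stalkAt k x).mapHomologicalComplex _).map ψ) a a' b b'
  have h4 : QuasiIso (((𝟭 (ModuleCat.{u} k)).mapHomologicalComplex _).map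
      (mapBifunctorMap (((stalkAt k x).mapHomologicalComplex _).map φ)
      (((stalkAt k x).mapHomologicalComplex _).map ψ) (vecTensor k) (ComplexShape.up ℤ))) := h3
  -- The stalk of the tensor product of the morphisms is identified with the tensor product of their
  -- stalks; the equality is checked on summands.
  have h5 : ((stalkAt k x).mapHomologicalComplex _).map
      (mapBifunctorMap φ ψ (tensor k X) (ComplexShape.up ℤ)) = Φ.hom ≫
      (((𝟭 (ModuleCat.{u} k)).mapHomologicalComplex _).map
      (mapBifunctorMap (((stalkAt k x).mapHomologicalComplex _).map φ)
      (((stalkAt k x).mapHomologicalComplex _).map ψ) (vecTensor k) (ComplexShape.up ℤ))) ≫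
        Φ'.inv := by
    rw [← Category.assoc, Iso.eq_comp_inv]
    ext n : 1
    refine map_tot_hom_ext a b (stalkAt k x) fun i j h ↦ ?_
    refine (Category.assoc _ _ _).symm.trans ((eq_whisker ((Functor.map_comp _ _ _).symm.trans
      (congrArg (stalkAt k x).map (ι_mapBifunctorMap φ ψ (tensor k X) (ComplexShape.up ℤ)
        i j n h))) _).trans ?_)
    refine Eq.trans ?_ ((Category.assoc _ _ _).symm.trans (eq_whisker (hΦ i j n h) _)).symm
    refine Eq.trans ?_ ((Category.assoc _ _ _).trans (whisker_eq _
      (ι_mapBifunctorMap (((stalkAt k x).mapHomologicalComplex _).map φ)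
        (((stalkAt k x).mapHomologicalComplex _).map ψ) (vecTensor k) (ComplexShape.up ℤ)
        i j n h))).symm
    have h6 := tensStalkIso_naturality (φ.f i) (ψ.f j) x
    have h7 : (stalkAt k x).map (((tensor k X).map (φ.f i)).app (L.X j) ≫
        ((tensor k X).obj (K'.X i)).map (ψ.f j) ≫ totι K' L' (tensor k X) i j n h) =
        (stalkAt k x).map (tensMap (φ.f i) (ψ.f j)) ≫
          (stalkAt k x).map (totι K' L' (tensor k X) i j n h) := by
      rw [← Functor.map_comp, Category.assoc]
    refine (eq_whisker h7 _).trans ((Category.assoc _ _ _).trans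
      ((whisker_eq _ (hΦ' i j n h)).trans ?_))
    refine (Category.assoc _ _ _).symm.trans ((eq_whisker h6 _).trans ?_)
    exact (Category.assoc _ _ _).trans (whisker_eq _ (Category.assoc _ _ _))
  rw [h5]
  infer_instance

/-- The morphism between tensor product complexes induced by two morphisms. -/
def totTensorMap {K K' L L' : CochainComplex.Plus (Shv k X)} (φ : K ⟶ K') (ψ : L ⟶ L') :
    totTensor k X K L ⟶ totTensor k X K' L' :=
  ObjectProperty.homMk (mapBifunctorMap φ.hom ψ.hom (tensor k X) (ComplexShape.up ℤ))

lemma quasiIso_totTensorMap {K K' L L' : CochainComplex.Plus (Shv k X)} (φ : K ⟶ K')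
    (ψ : L ⟶ L') [QuasiIso φ.hom] [QuasiIso ψ.hom] : QuasiIso (totTensorMap φ ψ).hom := by
  obtain ⟨a, ha⟩ := K.2
  obtain ⟨a', ha'⟩ := K'.2
  obtain ⟨b, hb⟩ := L.2
  obtain ⟨b', hb'⟩ := L'.2
  exact quasiIso_mapBifunctorMap_tensor φ.hom ψ.hom a a' b b'

/-- The definition uses chosen representatives. The chosen representative and the given one both map
by quasi-isomorphisms to a common complex, and tensoring preserves quasi-isomorphisms. -/
lemma nonempty_derivedTensor_iso {F G : DPlus k X} {K L : CochainComplex.Plus (Shv k X)}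
    (e : F ≅ DerivedCategory.Plus.Q.obj K) (e' : G ≅ DerivedCategory.Plus.Q.obj L) :
    Nonempty (derivedTensor F G ≅ DerivedCategory.Plus.Q.obj (totTensor k X K L)) := by
  obtain ⟨I, α, β, -, hα, hβ⟩ :=
    exists_roof_of_iso (DerivedCategory.Plus.Q.objObjPreimageIso F ≪≫ e)
  obtain ⟨J, α', β', -, hα', hβ'⟩ :=
    exists_roof_of_iso (DerivedCategory.Plus.Q.objObjPreimageIso G ≪≫ e')
  have h1 := quasiIso_totTensorMap (k := k) (X := X) α α'
  have h2 := quasiIso_totTensorMap (k := k) (X := X) β β'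
  have i1 := isIso_plusQ_map (C := Shv k X) (totTensorMap (k := k) (X := X) α α')
  have i2 := isIso_plusQ_map (C := Shv k X) (totTensorMap (k := k) (X := X) β β')
  let e1 := @asIso (DPlus k X) _ _ _ _ i1
  let e2 := @asIso (DPlus k X) _ _ _ _ i2
  exact ⟨e1.trans e2.symm⟩

lemma CSoft.totTensor {K L : CochainComplex.Plus (Shv k X)}
    (h : ∀ i j, CSoft (tens (K.obj.X i) (L.obj.X j))) (n : ℤ) :
    CSoft ((totTensor k X K L).obj.X n) := by
  obtain ⟨a, ha⟩ := K.2
  obtain ⟨b, hb⟩ := L.2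
  have ha' : K.obj.IsStrictlyGE a := ha
  have hb' : L.obj.IsStrictlyGE b := hb
  exact CSoft.of_sum (Finset.Icc a (n - b)) (G := fun i ↦ tens (K.obj.X i) (L.obj.X (n - i)))
    (fun i ↦ totπ K.obj L.obj (tensor k X) i (n - i) n (by lia))
    (fun i ↦ totι K.obj L.obj (tensor k X) i (n - i) n (by lia))
    (sum_totπ_totι K.obj L.obj (tensor k X) a b n) (fun i _ ↦ h i _)

end TotTensor

end SheafConvolution

end

noncomputable section

namespace SheafConvolution

/-! ### Jointly injective families of linear maps under tensor products -/

section JointlyInjective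

open TensorProduct

variable {k V W : Type*} [Field k] [AddCommGroup V] [Module k V] [AddCommGroup W] [Module k W]

/-- A basis of `V` gives each tensor coordinates in `W`, and the maps act on every coordinate
separately. The index set may be infinite, as it will be for the points of a fibre. -/
lemma eq_zero_of_forall_lTensor {ι : Type*} {W' : ι → Type*} [∀ i, AddCommGroup (W' i)]
    [∀ i, Module k (W' i)] (g : ∀ i, W →ₗ[k] W' i) (hg : ∀ w, (∀ i, g i w = 0) → w = 0)
    (x : V ⊗[k] W) (h : ∀ i, (g i).lTensor V x = 0) : x = 0 := by
  classical
  let b := Module.Basis.ofVectorSpace k V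
  have key : ∀ i (y : V ⊗[k] W) j, TensorProduct.equivFinsuppOfBasisLeft b ((g i).lTensor V y) j =
      g i (TensorProduct.equivFinsuppOfBasisLeft b y j) := by
    intro i y j
    induction y with
    | zero => simp
    | tmul v w => simp
    | add y z hy hz => simp [hy, hz]
  apply (TensorProduct.equivFinsuppOfBasisLeft b).injective
  ext j
  rw [map_zero]
  refine hg _ fun i ↦ ?_
  rw [← key, h, map_zero]
  rfl

lemma eq_zero_of_forall_map {ι ι' : Type*} {V' : ι → Type*} {W' : ι' → Type*}
    [∀ i, AddCommGroup (V' i)] [∀ i, Module k (V' i)] [∀ i, AddCommGroup (W' i)]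
    [∀ i, Module k (W' i)] (f : ∀ i, V →ₗ[k] V' i) (hf : ∀ v, (∀ i, f i v = 0) → v = 0)
    (g : ∀ i, W →ₗ[k] W' i) (hg : ∀ w, (∀ i, g i w = 0) → w = 0)
    (x : V ⊗[k] W) (h : ∀ i j, TensorProduct.map (f i) (g j) x = 0) : x = 0 := by
  have h1 : TensorProduct.comm k V W x = 0 := by
    refine eq_zero_of_forall_lTensor f hf _ fun i ↦ ?_
    have h2 : (f i).rTensor W x = 0 := by
      refine eq_zero_of_forall_lTensor g hg _ fun j ↦ ?_
      have := h i j
      rw [← LinearMap.lTensor_comp_rTensor] at this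
      exact this
    have h3 : ∀ y : V ⊗[k] W, (f i).lTensor W (TensorProduct.comm k V W y) =
        TensorProduct.comm k (V' i) W ((f i).rTensor W y) := fun y ↦ by
      induction y with
      | zero => simp only [map_zero]
      | tmul v w => rfl
      | add y z hy hz => simp only [map_add, hy, hz]
    rw [h3, h2, map_zero]
  exact (TensorProduct.comm k V W).map_eq_zero_iff.1 h1

end JointlyInjective

/-! ### External tensor products -/

section Box

open TensorProduct

variable {k : Type u} [Field k] {X₁ X₂ Z : TopCat.{u}} (f : Z ⟶ X₁) (g : Z ⟶ X₂)

/-- The external tensor product `f⁻¹ A ⊗ g⁻¹ B`. -/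
abbrev boxTens (A : Shv k X₁) (B : Shv k X₂) : Shv k Z :=
  tens ((pullback k f).obj A) ((pullback k g).obj B)

/-- The morphism between external tensor products induced by two morphisms. -/
abbrev boxMap {A A' : Shv k X₁} {B B' : Shv k X₂} (φ : A ⟶ A') (ψ : B ⟶ B') :
    boxTens f g A B ⟶ boxTens f g A' B' :=
  tensMap ((pullback k f).map φ) ((pullback k g).map ψ)

/-- The stalks of an external tensor product. -/
def boxStalk (A : Shv k X₁) (B : Shv k X₂) (z : Z) :
    stk A (f z) ⊗[k] stk B (g z) ≃ₗ[k] stk (boxTens f g A B) z :=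
  (TensorProduct.congr (pbStalk f A z) (pbStalk g B z)).trans (tensStalk _ _ z)

/-- The section of an external tensor product given by two sections. -/
def boxSec {A : Shv k X₁} {B : Shv k X₂} {U₁ : Opens X₁} {U₂ : Opens X₂} (a : sec A U₁)
    (b : sec B U₂) : sec (boxTens f g A B) ((Opens.map f).obj U₁ ⊓ (Opens.map g).obj U₂) :=
  tensSec (res inf_le_left (pbSec f a)) (res inf_le_right (pbSec g b))

variable {A A' : Shv k X₁} {B B' : Shv k X₂} {U₁ : Opens X₁} {U₂ : Opens X₂}

lemma gm_boxSec (a : sec A U₁) (b : sec B U₂) (z : Z) :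
    gm (boxSec f g a b) z = boxStalk f g A B z (gm a (f z) ⊗ₜ[k] gm b (g z)) := by
  by_cases hz : z ∈ (Opens.map f).obj U₁ ⊓ (Opens.map g).obj U₂
  · rw [boxSec, gm_tensSec, gm_res _ _ hz, gm_res _ _ hz, gm_pbSec, gm_pbSec]
    rfl
  · rw [gm_of_notMem _ hz]
    have h : f z ∉ U₁ ∨ g z ∉ U₂ := not_and_or.1 hz
    rcases h with h | h
    · rw [gm_of_notMem a h, zero_tmul, map_zero]
    · rw [gm_of_notMem b h, tmul_zero, map_zero]

lemma stmap_boxMap (φ : A ⟶ A') (ψ : B ⟶ B') (z : Z) (e : stk A (f z) ⊗[k] stk B (g z)) :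
    stmap (boxMap f g φ ψ) z (boxStalk f g A B z e) =
      boxStalk f g A' B' z (TensorProduct.map (stmap φ (f z)) (stmap ψ (g z)) e) := by
  induction e with
  | zero => simp only [map_zero]
  | add x y hx hy => simp only [map_add, hx, hy]
  | tmul a b =>
    change stmap (tensMap _ _) z (tensStalk _ _ z (pbStalk f A z a ⊗ₜ[k] pbStalk g B z b)) = _
    rw [stmap_tensMap, TensorProduct.map_tmul, stmap_pullback, stmap_pullback]
    rfl

/-- Every germ is a sum of germs of products of actual sections. The sections are kept because
continuity and proper support are statements about neighbourhoods. -/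
lemma box_induction {z : Z} {P : stk (boxTens f g A B) z → Prop} (zero : P 0)
    (add : ∀ x y, P x → P y → P (x + y))
    (box : ∀ (U₁ : Opens X₁) (_ : f z ∈ U₁) (a : sec A U₁) (U₂ : Opens X₂) (_ : g z ∈ U₂)
      (b : sec B U₂), P (gm (boxSec f g a b) z)) (e : stk (boxTens f g A B) z) : P e := by
  obtain ⟨e, rfl⟩ := (boxStalk f g A B z).surjective e
  induction e with
  | zero => rwa [map_zero]
  | add x y hx hy => rw [map_add]; exact add _ _ hx hy
  | tmul a b =>
    obtain ⟨U₁, h₁, a, rfl⟩ := exists_gm a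
    obtain ⟨U₂, h₂, b, rfl⟩ := exists_gm b
    rw [← gm_boxSec]
    exact box _ h₁ _ _ h₂ _

end Box

/-! ### Realizing sections by means of bump operators -/

section Bump

variable {k : Type u} [Field k] {X Y Z : TopCat.{u}}

/-- A submodule of the global sections which is stable under bump operators and generates the
stalks realizes every section over a neighbourhood of a compact set. -/
lemma exists_mem_of_bump {G : Shv k Z} (N : Submodule k (sec G ⊤))
    (hN : ∀ (U : Opens Z), ∀ z ∈ U, ∃ (e : G ⟶ G) (V : Opens Z), z ∈ V ∧
      (∀ y ∈ V, stmap e y = LinearMap.id) ∧ (∀ y ∉ U, stmap e y = 0) ∧ ∀ t ∈ N, smap e ⊤ t ∈ N)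
    (hN' : ∀ z (g : stk G z), ∃ t ∈ N, gm t z = g) {O : Opens Z} (w : sec G O) {K : Set Z}
    (hK : IsCompact K) (hKO : K ⊆ O) :
    ∃ t ∈ N, (∀ z ∈ K, gm t z = gm w z) ∧ ∀ z ∈ O, gm w z = 0 → gm t z = 0 := by
  -- For the union of two pieces of `K` the second correction treats the remainder left by the
  -- first. Vanishing wherever the remainder does, it does not spoil what has been achieved.
  have key : ∀ n ∈ N, ∃ t ∈ N, (∀ z ∈ K, z ∈ O → gm t z = gm w z - gm n z) ∧
      ∀ z ∈ O, gm w z - gm n z = 0 → gm t z = 0 := by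
    refine hK.induction_on (p := fun S ↦ ∀ n ∈ N, ∃ t ∈ N,
      (∀ z ∈ S, z ∈ O → gm t z = gm w z - gm n z) ∧ ∀ z ∈ O, gm w z - gm n z = 0 → gm t z = 0) ?_ ?_ ?_ ?_
    · exact fun n _ ↦ ⟨0, N.zero_mem, fun z hz _ ↦ hz.elim, fun z _ _ ↦ gm_zero z⟩
    · intro S T hST h n hn
      obtain ⟨t, ht, h1, h2⟩ := h n hn
      exact ⟨t, ht, fun z hz ↦ h1 z (hST hz), h2⟩
    · intro S T hS hT n hn
      obtain ⟨t, ht, h1, h2⟩ := hS n hn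
      obtain ⟨t', ht', h1', h2'⟩ := hT (n + t) (N.add_mem hn ht)
      refine ⟨t + t', N.add_mem ht ht', ?_, ?_⟩
      · rintro z (hz | hz) hzO
        · have h3 : gm t' z = 0 := by
            refine h2' z hzO ?_
            rw [gm_add, h1 z hz hzO]
            abel
          rw [gm_add, h3, h1 z hz hzO, add_zero]
        · rw [gm_add, h1' z hz hzO, gm_add]
          abel
      · intro z hz h
        have h3 := h2 z hz h
        rw [gm_add, h3, zero_add]
        refine h2' z hz ?_
        rw [gm_add, h3, add_zero, h]
    · intro z hz
      obtain ⟨t₀, ht₀, h0⟩ := hN' z (gm w z)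
      obtain ⟨U, hzU, -, hUO, hU⟩ := exists_gm_eq (V := O) (U := ⊤) trivial (hKO hz) h0
      obtain ⟨e, V, hzV, h1, h2, h3⟩ := hN U z hzU
      -- On `U` the section `t₀` agrees with `w`, and `e` vanishes off `U`; so the image of `t₀ - n`
      -- under `e` equals the remainder near `z` and vanishes wherever it does.
      refine ⟨_, mem_nhdsWithin_of_mem_nhds ((V ⊓ U).isOpen.mem_nhds ⟨hzV, hzU⟩), fun n hn ↦
        ⟨smap e ⊤ (t₀ - n), h3 _ (N.sub_mem ht₀ hn), ?_, ?_⟩⟩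
      · intro y hy _
        rw [gm_smap, h1 y hy.1, LinearMap.id_apply, gm_sub, hU y hy.2]
      · intro y hy h
        rw [gm_smap]
        by_cases hyU : y ∈ U
        · rw [gm_sub, hU y hyU, h, map_zero]
        · rw [h2 y hyU, LinearMap.zero_apply]
  obtain ⟨t, ht, h1, h2⟩ := key 0 N.zero_mem
  refine ⟨t, ht, fun z hz ↦ ?_, fun z hz h ↦ h2 z hz ?_⟩
  · rw [h1 z hz (hKO hz), gm_zero, sub_zero]
  · rw [h, gm_zero, sub_zero]

lemma Fine.exists_compact_section [T2Space X] [LocallyCompactSpace X] {F : Shv k X} (hF : Fine F)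
    {x : X} (a : stk F x) :
    ∃ (t : sec F ⊤) (C : Set X), IsCompact C ∧ gm t x = a ∧ ∀ y ∉ C, gm t y = 0 := by
  obtain ⟨U, hU, s, rfl⟩ := exists_gm a
  obtain ⟨C, hC, hxC, hCU⟩ := exists_compact_subset U.isOpen hU
  let V : Opens X := ⟨interior C, isOpen_interior⟩
  obtain ⟨e, h1, h2⟩ := hF V
  have hVC : closure (V : Set X) ⊆ C := closure_minimal interior_subset hC.isClosed
  obtain ⟨t, ht⟩ := exists_section (F := F) ⊤ (fun y ↦ stmap e y (gm s y)) (by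
    intro y _
    by_cases hy : y ∈ U
    · exact ⟨U, hy, smap e U s, fun z _ _ ↦ gm_smap e s z⟩
    · refine ⟨⟨(closure (V : Set X))ᶜ, isClosed_closure.isOpen_compl⟩,
        fun h ↦ hy (hCU (hVC h)), 0, fun z hz _ ↦ ?_⟩
      rw [gm_zero, h2 z hz, LinearMap.zero_apply])
  refine ⟨t, C, hC, ?_, fun y hy ↦ ?_⟩
  · rw [ht x trivial, h1 x hxC, LinearMap.id_apply]
  · rw [ht y trivial, h2 y (fun h ↦ hy (hVC h)), LinearMap.zero_apply]

end Bump

/-! ### The Künneth morphism and its stalks -/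

section Kunneth

open TensorProduct Filter Topology

variable {k : Type u} [Field k]

/-- The evaluation of the germs of `f_! F` at a point of the fibre. -/
def psEvalOf {X Y : TopCat.{u}} {f : X ⟶ Y} (F : Shv k X) {x : X} {y : Y} (h : f x = y) :
    stk ((properPushforward k f).obj F) y →ₗ[k] stk F x :=
  h ▸ psEval f F x

section

variable {X Y : TopCat.{u}} {f : X ⟶ Y} {F G : Shv k X} {x : X} {y : Y} (h : f x = y)

lemma psEvalOf_gm {U : Opens Y} (s : sec ((properPushforward k f).obj F) U) :
    psEvalOf F h (gm s y) = gm (psVal s) x := by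
  subst h
  exact psEval_gm s x

lemma psEvalOf_stmap (φ : F ⟶ G) (e : stk ((properPushforward k f).obj F) y) :
    psEvalOf G h (stmap ((properPushforward k f).map φ) y e) = stmap φ x (psEvalOf F h e) := by
  subst h
  exact psEval_stmap φ x e

lemma eq_zero_of_psEvalOf (e : stk ((properPushforward k f).obj F) y)
    (h : ∀ x : {x // f x = y}, psEvalOf F x.2 e = 0) : e = 0 := by
  obtain ⟨U, hU, s, rfl⟩ := exists_gm e
  refine (gm_eq_zero_iff_psVal hU s).2 fun x hx ↦ ?_
  rw [← psEvalOf_gm hx]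
  exact h ⟨x, hx⟩

end

variable {X₁ X₂ Y₁ Y₂ Y Z W : TopCat.{u}} {p₁ : X₁ ⟶ Y₁} {p₂ : X₂ ⟶ Y₂} {π₁ : Y ⟶ Y₁}
  {π₂ : Y ⟶ Y₂} {q₁ : Z ⟶ X₁} {q₂ : Z ⟶ X₂} {ε : Z ⟶ Y}
  (c₁ : ∀ z, p₁ (q₁ z) = π₁ (ε z)) (c₂ : ∀ z, p₂ (q₂ z) = π₂ (ε z))

/-- The stalks of the morphism from the external tensor product of the direct images with proper
supports to the direct image with proper supports of the external tensor product. -/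
def kunnethStalk (A : Shv k X₁) (B : Shv k X₂) (z : Z) :
    stk (boxTens π₁ π₂ ((properPushforward k p₁).obj A) ((properPushforward k p₂).obj B)) (ε z)
      →ₗ[k] stk (boxTens q₁ q₂ A B) z :=
  (boxStalk q₁ q₂ A B z).toLinearMap ∘ₗ
    TensorProduct.map (psEvalOf A (c₁ z)) (psEvalOf B (c₂ z)) ∘ₗ
      (boxStalk π₁ π₂ _ _ (ε z)).symm.toLinearMap

variable {A A' : Shv k X₁} {B B' : Shv k X₂}

lemma kunnethStalk_boxStalk (z : Z) (e) :
    kunnethStalk c₁ c₂ A B z (boxStalk π₁ π₂ _ _ (ε z) e) =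
      boxStalk q₁ q₂ A B z (TensorProduct.map (psEvalOf A (c₁ z)) (psEvalOf B (c₂ z)) e) := by
  simp [kunnethStalk]

lemma kunnethStalk_gm_boxSec {U₁ : Opens Y₁} {U₂ : Opens Y₂}
    (a : sec ((properPushforward k p₁).obj A) U₁) (b : sec ((properPushforward k p₂).obj B) U₂)
    (z : Z) : kunnethStalk c₁ c₂ A B z (gm (boxSec π₁ π₂ a b) (ε z)) =
      gm (boxSec q₁ q₂ (psVal a) (psVal b)) z := by
  rw [gm_boxSec, kunnethStalk_boxStalk, TensorProduct.map_tmul, psEvalOf_gm, psEvalOf_gm,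
    gm_boxSec]

lemma kunnethStalk_stmap (φ : A ⟶ A') (ψ : B ⟶ B') (z : Z) (e) :
    kunnethStalk c₁ c₂ A' B' z (stmap (boxMap π₁ π₂ ((properPushforward k p₁).map φ)
      ((properPushforward k p₂).map ψ)) (ε z) e) =
      stmap (boxMap q₁ q₂ φ ψ) z (kunnethStalk c₁ c₂ A B z e) := by
  obtain ⟨e, rfl⟩ := (boxStalk π₁ π₂ _ _ (ε z)).surjective e
  rw [stmap_boxMap, kunnethStalk_boxStalk, kunnethStalk_boxStalk, stmap_boxMap]
  congr 1
  induction e with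
  | zero => simp only [map_zero]
  | add x y hx hy => simp only [map_add, hx, hy]
  | tmul a b => simp only [TensorProduct.map_tmul, psEvalOf_stmap]

lemma isContinuousFamily_kunnethStalk :
    IsContinuousFamily ε (boxTens π₁ π₂ ((properPushforward k p₁).obj A)
      ((properPushforward k p₂).obj B)) (boxTens q₁ q₂ A B) (kunnethStalk c₁ c₂ A B) := by
  intro z e
  induction e using box_induction with
  | zero => exact ⟨⊤, 0, ⊤, 0, trivial, trivial, gm_zero _, fun y _ ↦ by simp⟩
  | add x y hx hy =>
    obtain ⟨U, s, V, t, h1, h2, rfl, h3⟩ := hx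
    obtain ⟨U', s', V', t', h1', h2', rfl, h3'⟩ := hy
    refine ⟨U ⊓ U', res inf_le_left s + res inf_le_right s',
      V ⊓ V' ⊓ (Opens.map ε).obj (U ⊓ U'), res (inf_le_left.trans inf_le_left) t +
      res (inf_le_left.trans inf_le_right) t', ⟨h1, h1'⟩, ⟨⟨h2, h2'⟩, ⟨h1, h1'⟩⟩, ?_, ?_⟩
    · have hz : ε z ∈ U ⊓ U' := ⟨h1, h1'⟩
      rw [gm_add, gm_res _ _ hz, gm_res _ _ hz]
    · intro y hy
      have hy' : ε y ∈ U ⊓ U' := hy.2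
      rw [gm_add, gm_res _ _ hy, gm_res _ _ hy, h3 y hy.1.1, h3' y hy.1.2, gm_add,
        gm_res _ _ hy', gm_res _ _ hy', map_add]
  | box U₁ h₁ a U₂ h₂ b =>
    refine ⟨_, boxSec π₁ π₂ a b, _, boxSec q₁ q₂ (psVal a) (psVal b), ⟨h₁, h₂⟩, ⟨?_, ?_⟩, rfl,
      fun y _ ↦ (kunnethStalk_gm_boxSec c₁ c₂ a b y).symm⟩
    · change p₁ (q₁ z) ∈ U₁
      rwa [c₁]
    · change p₂ (q₂ z) ∈ U₂
      rwa [c₂]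

variable [T2Space Y₁] [T2Space Y₂]

/-- Near `y` the section is a finite sum of products of sections `a` and `b` with proper support,
and the ultrafilter lives on the nonvanishing locus of one product. Properness of `a` and `b` gives
limits under `q₁` and `q₂`, and the closed embedding into the product turns these into a limit in
`Z`. The section varies in the conclusion so that the induction can be on the germ. -/
lemma exists_le_nhds_of_kunnethStalk_ne_zero
    (hq : IsClosedEmbedding fun z ↦ (q₁ z, q₂ z)) {y : Y} (𝒰 : Ultrafilter Z)
    (h𝒰 : Tendsto ε 𝒰 (𝓝 y)) (e : stk (boxTens π₁ π₂ ((properPushforward k p₁).obj A)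
      ((properPushforward k p₂).obj B)) y) : ∀ (U : Opens Y) (_ : y ∈ U)
      (s : sec (boxTens π₁ π₂ ((properPushforward k p₁).obj A)
      ((properPushforward k p₂).obj B)) U), gm s y = e →
    {z | kunnethStalk c₁ c₂ A B z (gm s (ε z)) ≠ 0} ∈ 𝒰 → ∃ z, (𝒰 : Filter Z) ≤ 𝓝 z := by
  induction e using box_induction with
  | zero =>
    intro U hU s hs hne
    obtain ⟨V, hyV, -, hV⟩ := exists_gm_eq_zero hU hs
    have h1 := h𝒰 (V.isOpen.mem_nhds hyV)
    obtain ⟨z, hz, hz'⟩ := 𝒰.nonempty_of_mem (inter_mem hne h1)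
    exact (hz (by rw [hV _ hz', map_zero])).elim
  | add e e' h h' =>
    intro U hU s hs hne
    obtain ⟨V, hV, t, rfl⟩ := exists_gm e
    obtain ⟨V', hV', t', rfl⟩ := exists_gm e'
    have hVV : y ∈ V ⊓ V' := ⟨hV, hV'⟩
    have h1 : gm s y = gm (res inf_le_left t + res inf_le_right t' : sec _ (V ⊓ V')) y := by
      rw [hs, gm_add, gm_res _ _ hVV, gm_res _ _ hVV]
    obtain ⟨O, hyO, hOU, hOV, hO⟩ := exists_gm_eq hU hVV h1
    have h2 : {z | kunnethStalk c₁ c₂ A B z (gm t (ε z)) ≠ 0} ∪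
        {z | kunnethStalk c₁ c₂ A B z (gm t' (ε z)) ≠ 0} ∈ 𝒰 := by
      filter_upwards [hne, h𝒰 (O.isOpen.mem_nhds hyO)] with z hz hz'
      by_contra hcon
      rw [Set.mem_union, not_or] at hcon
      apply hz
      rw [hO _ hz', gm_add, gm_res _ _ (hOV hz'), gm_res _ _ (hOV hz'), map_add,
        not_not.1 hcon.1, not_not.1 hcon.2, add_zero]
    rcases Ultrafilter.union_mem_iff.1 h2 with h3 | h3
    · exact h V hV t rfl h3
    · exact h' V' hV' t' rfl h3
  | box U₁ h₁ a U₂ h₂ b =>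
    intro U hU s hs hne
    obtain ⟨O, hyO, hOU, hOV, hO⟩ := exists_gm_eq hU (V := _ ⊓ _) ⟨h₁, h₂⟩ hs
    have h2 : {z | gm (psVal a) (q₁ z) ≠ 0 ∧ gm (psVal b) (q₂ z) ≠ 0} ∈ 𝒰 := by
      filter_upwards [hne, h𝒰 (O.isOpen.mem_nhds hyO)] with z hz hz'
      rw [hO _ hz', kunnethStalk_gm_boxSec, gm_boxSec] at hz
      refine ⟨fun h ↦ hz ?_, fun h ↦ hz ?_⟩
      · rw [h, zero_tmul, map_zero]
      · rw [h, tmul_zero, map_zero]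
    obtain ⟨x₁, hx₁⟩ := hasProperSupport_iff'.1 (hasProperSupport_psVal a) (𝒰.map q₁)
      (Ultrafilter.mem_map.2 (mem_of_superset h2 fun z hz ↦ hz.1)) (π₁ y) h₁ (by
        have : Tendsto (fun z ↦ π₁ (ε z)) 𝒰 (𝓝 (π₁ y)) := (π₁.hom.continuous.tendsto y).comp h𝒰
        exact (tendsto_congr c₁).2 this)
    obtain ⟨x₂, hx₂⟩ := hasProperSupport_iff'.1 (hasProperSupport_psVal b) (𝒰.map q₂)
      (Ultrafilter.mem_map.2 (mem_of_superset h2 fun z hz ↦ hz.2)) (π₂ y) h₂ (by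
        have : Tendsto (fun z ↦ π₂ (ε z)) 𝒰 (𝓝 (π₂ y)) := (π₂.hom.continuous.tendsto y).comp h𝒰
        exact (tendsto_congr c₂).2 this)
    have h3 : Tendsto (fun z ↦ (q₁ z, q₂ z)) 𝒰 (𝓝 (x₁, x₂)) := Tendsto.prodMk_nhds hx₁ hx₂
    obtain ⟨z, -, hz⟩ := (isProperMap_iff_ultrafilter.1 hq.isProperMap).2 h3
    exact ⟨z, hz⟩

variable [T2Space Y]

variable (A B) in
lemma exists_kunnethHom (hq : IsClosedEmbedding fun z ↦ (q₁ z, q₂ z)) :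
    ∃ Φ : boxTens π₁ π₂ ((properPushforward k p₁).obj A) ((properPushforward k p₂).obj B) ⟶
        (properPushforward k ε).obj (boxTens q₁ q₂ A B),
      ∀ (U : Opens Y) (s : sec _ U) (z : Z),
        gm (psVal (smap Φ U s)) z = kunnethStalk c₁ c₂ A B z (gm s (ε z)) := by
  refine exists_hom_properPushforward _ (isContinuousFamily_kunnethStalk c₁ c₂)
    fun U s t ht ↦ hasProperSupport_iff'.2 fun 𝒰 h𝒰 y hy hε ↦ ?_
  simp only [ht] at h𝒰
  exact exists_le_nhds_of_kunnethStalk_ne_zero c₁ c₂ hq 𝒰 hε _ U hy s rfl h𝒰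

variable [T2Space W] (s : Y ⟶ W)

variable (A B) in
lemma exists_kunnethHom_comp (hq : IsClosedEmbedding fun z ↦ (q₁ z, q₂ z)) :
    ∃ Φ : (properPushforward k s).obj
        (boxTens π₁ π₂ ((properPushforward k p₁).obj A) ((properPushforward k p₂).obj B)) ⟶
        (properPushforward k (ε ≫ s)).obj (boxTens q₁ q₂ A B),
      ∀ (U : Opens W) (t : sec _ U) (z : Z),
        gm (psVal (smap Φ U t)) z = kunnethStalk c₁ c₂ A B z (gm (psVal t) (ε z)) := by
  obtain ⟨Φ, hΦ⟩ := exists_kunnethHom c₁ c₂ A B hq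
  refine ⟨(properPushforward k s).map Φ ≫ properPushforwardCompHom ε s _, fun U t z ↦ ?_⟩
  exact hΦ ((Opens.map s).obj U) (psVal t) z

variable (hq : IsClosedEmbedding fun z ↦ (q₁ z, q₂ z))

variable (A B) in
/-- The morphism from the direct image with proper supports of the external tensor product of direct
images with proper supports to the direct image with proper supports of the external tensor
product. -/
def kunnethHom : (properPushforward k s).obj
      (boxTens π₁ π₂ ((properPushforward k p₁).obj A) ((properPushforward k p₂).obj B)) ⟶
        (properPushforward k (ε ≫ s)).obj (boxTens q₁ q₂ A B) :=
  (exists_kunnethHom_comp c₁ c₂ A B s hq).choose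

lemma gm_psVal_kunnethHom {U : Opens W} (t : sec ((properPushforward k s).obj
      (boxTens π₁ π₂ ((properPushforward k p₁).obj A) ((properPushforward k p₂).obj B))) U) (z : Z) :
    gm (psVal (smap (kunnethHom c₁ c₂ A B s hq) U t)) z =
      kunnethStalk c₁ c₂ A B z (gm (psVal t) (ε z)) :=
  (exists_kunnethHom_comp c₁ c₂ A B s hq).choose_spec U t z

lemma kunnethHom_naturality (φ : A ⟶ A') (ψ : B ⟶ B') :
    (properPushforward k s).map (boxMap π₁ π₂ ((properPushforward k p₁).map φ)
      ((properPushforward k p₂).map ψ)) ≫ kunnethHom c₁ c₂ A' B' s hq =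
      kunnethHom c₁ c₂ A B s hq ≫ (properPushforward k (ε ≫ s)).map (boxMap q₁ q₂ φ ψ) := by
  refine hom_ext_smap fun U ↦ LinearMap.ext fun t ↦ psVal_injective (sec_ext fun z _ ↦ ?_)
  change gm (psVal (smap (kunnethHom c₁ c₂ A' B' s hq) U
    (smap ((properPushforward k s).map (boxMap π₁ π₂ ((properPushforward k p₁).map φ)
      ((properPushforward k p₂).map ψ))) U t))) z = gm (psVal (smap ((properPushforward k
      (ε ≫ s)).map (boxMap q₁ q₂ φ ψ)) U (smap (kunnethHom c₁ c₂ A B s hq) U t))) z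
  rw [gm_psVal_kunnethHom, gm_psVal_smap, gm_psVal_smap, gm_psVal_kunnethHom, kunnethStalk_stmap]

/-- The stalks of p₁! A and p₂! B embed in the products of the stalks along the fibres, and a tensor
killed by all pairs of evaluations is zero by `eq_zero_of_forall_map`. The condition on `w` says
that each pair of points of the two fibres comes from `Z`. -/
lemma injective_stmap_kunnethHom {w : W}
    (hw : ∀ y x₁ x₂, s y = w → p₁ x₁ = π₁ y → p₂ x₂ = π₂ y → ∃ z, q₁ z = x₁ ∧ q₂ z = x₂ ∧ ε z = y) :
    Function.Injective (stmap (kunnethHom c₁ c₂ A B s hq) w) := by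
  rw [injective_iff_map_eq_zero]
  intro e he
  obtain ⟨U, hU, t, rfl⟩ := exists_gm e
  rw [← gm_smap] at he
  refine (gm_eq_zero_iff_psVal hU _).2 fun y hy ↦ ?_
  rw [gm_eq_zero_iff_psVal hU] at he
  obtain ⟨v, hv⟩ := (boxStalk π₁ π₂ _ _ y).surjective (gm (psVal t) y)
  rw [← hv, LinearEquiv.map_eq_zero_iff]
  refine eq_zero_of_forall_map (fun x : {x // p₁ x = π₁ y} ↦ psEvalOf A x.2)
    (fun v hv ↦ eq_zero_of_psEvalOf v hv) (fun x : {x // p₂ x = π₂ y} ↦ psEvalOf B x.2)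
    (fun v hv ↦ eq_zero_of_psEvalOf v hv) v ?_
  rintro ⟨x₁, h₁⟩ ⟨x₂, h₂⟩
  obtain ⟨z, rfl, rfl, rfl⟩ := hw y x₁ x₂ hy h₁ h₂
  have h1 := he z hy
  rw [gm_psVal_kunnethHom, ← hv, kunnethStalk_boxStalk, LinearEquiv.map_eq_zero_iff] at h1
  exact h1

variable [T2Space X₁] [LocallyCompactSpace X₁] [T2Space X₂] [LocallyCompactSpace X₂]

/-- The global sections coming from the source are stable under product bump operators, by
naturality, and they realize all germs, by products of compactly supported sections. Thus
`exists_mem_of_bump` applies to the compact support of a section over `w`. Unlike injectivity, this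
holds at every `w`. -/
lemma surjective_stmap_kunnethHom (hA : Fine A) (hB : Fine B)
    (hπ : IsClosedEmbedding fun y ↦ (π₁ y, π₂ y)) (w : W) :
    Function.Surjective (stmap (kunnethHom c₁ c₂ A B s hq) w) := by
  let Λ := psVal (f := ε ≫ s) (U := ⊤) ∘ₗ smap (kunnethHom c₁ c₂ A B s hq) ⊤
  let N : Submodule k (sec (boxTens q₁ q₂ A B) ⊤) :=
    { carrier := {t | ∃ r, ∀ z, gm t z = gm (Λ r) z}
      zero_mem' := ⟨0, fun z ↦ by rw [map_zero, gm_zero, gm_zero]⟩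
      add_mem' := fun {t t'} ⟨r, hr⟩ ⟨r', hr'⟩ ↦
        ⟨r + r', fun z ↦ by rw [map_add, gm_add, gm_add, hr, hr']⟩
      smul_mem' := fun c t ⟨r, hr⟩ ↦ ⟨c • r, fun z ↦ by rw [map_smul, gm_smul, gm_smul, hr]⟩ }
  have hΛ : ∀ r z, gm (Λ r) z = kunnethStalk c₁ c₂ A B z (gm (psVal r) (ε z)) :=
    fun r z ↦ gm_psVal_kunnethHom c₁ c₂ s hq r z
  have hN : ∀ (U : Opens Z), ∀ z ∈ U, ∃ (e : boxTens q₁ q₂ A B ⟶ boxTens q₁ q₂ A B) (V : Opens Z),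
      z ∈ V ∧ (∀ y ∈ V, stmap e y = LinearMap.id) ∧ (∀ y ∉ U, stmap e y = 0) ∧
        ∀ t ∈ N, smap e ⊤ t ∈ N := by
    intro U z hz
    obtain ⟨e₁, e₂, V, C, hzV, -, hCU, h1, h2⟩ := Fine.exists_boxMap q₁ q₂ hq.isInducing hA hB hz
    refine ⟨boxMap q₁ q₂ e₁ e₂, V, hzV, h1, fun y hy ↦ h2 y fun h ↦ hy (hCU h), ?_⟩
    rintro t ⟨r, hr⟩
    refine ⟨smap ((properPushforward k s).map (boxMap π₁ π₂ ((properPushforward k p₁).map e₁)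
      ((properPushforward k p₂).map e₂))) ⊤ r, fun z ↦ ?_⟩
    rw [hΛ, gm_psVal_smap, kunnethStalk_stmap, gm_smap, hr, hΛ]
  have hN' : ∀ z (g : stk (boxTens q₁ q₂ A B) z), ∃ t ∈ N, gm t z = g := by
    intro z g
    induction g using box_induction with
    | zero => exact ⟨0, N.zero_mem, gm_zero _⟩
    | add x y hx hy =>
      obtain ⟨t, ht, rfl⟩ := hx
      obtain ⟨t', ht', rfl⟩ := hy
      exact ⟨t + t', N.add_mem ht ht', gm_add _ _ _⟩
    | box U₁ h₁ a U₂ h₂ b =>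
      obtain ⟨a', C₁, hC₁, ha, ha'⟩ := hA.exists_compact_section (gm a (q₁ z))
      obtain ⟨b', C₂, hC₂, hb, hb'⟩ := hB.exists_compact_section (gm b (q₂ z))
      let α : sec ((properPushforward k p₁).obj A) ⊤ := psMk (f := p₁) (U := ⊤) a'
        (hasProperSupport_of_compact fun y _ ↦ ⟨Set.univ, univ_mem, C₁, hC₁, fun x _ hx ↦ by
          by_contra h
          exact hx (ha' x h)⟩)
      let β : sec ((properPushforward k p₂).obj B) ⊤ := psMk (f := p₂) (U := ⊤) b'
        (hasProperSupport_of_compact fun y _ ↦ ⟨Set.univ, univ_mem, C₂, hC₂, fun x _ hx ↦ by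
          by_contra h
          exact hx (hb' x h)⟩)
      have hα : ∀ y ∉ p₁ '' C₁, gm α y = 0 := fun y hy ↦
        (gm_eq_zero_iff_psVal (show y ∈ (⊤ : Opens Y₁) from trivial) _).2 fun x hx ↦ ha' x fun h ↦ hy ⟨x, h, hx⟩
      have hβ : ∀ y ∉ p₂ '' C₂, gm β y = 0 := fun y hy ↦
        (gm_eq_zero_iff_psVal (show y ∈ (⊤ : Opens Y₂) from trivial) _).2 fun x hx ↦ hb' x fun h ↦ hy ⟨x, h, hx⟩
      -- A closed embedding pulls compact sets back to compact sets, so the product of `α` and `β`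
      -- has compact support in `Y`, hence proper support over `W`.
      have hC : IsCompact ((fun y ↦ (π₁ y, π₂ y)) ⁻¹' ((p₁ '' C₁) ×ˢ (p₂ '' C₂))) :=
        hπ.isCompact_preimage ((hC₁.image p₁.hom.continuous).prod (hC₂.image p₂.hom.continuous))
      let η : sec (boxTens π₁ π₂ ((properPushforward k p₁).obj A)
          ((properPushforward k p₂).obj B)) ((Opens.map s).obj ⊤) :=
        res (fun y _ ↦ (show y ∈ (Opens.map π₁).obj ⊤ ⊓ (Opens.map π₂).obj ⊤ from
          ⟨trivial, trivial⟩)) (boxSec π₁ π₂ α β)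
      have hη : ∀ y, gm η y = gm (boxSec π₁ π₂ α β) y := fun y ↦
        gm_res _ _ (show y ∈ (⊤ : Opens Y) from trivial)
      let r : sec ((properPushforward k s).obj (boxTens π₁ π₂
        ((properPushforward k p₁).obj A) ((properPushforward k p₂).obj B))) ⊤ :=
        psMk η (hasProperSupport_of_compact fun y _ ↦ ⟨Set.univ, univ_mem, _, hC, fun x _ hx ↦ by
            by_contra h
            apply hx
            refine ((hη x).trans (gm_boxSec π₁ π₂ α β x)).trans ?_
            rcases not_and_or.1 h with h | h
            · rw [hα _ h, zero_tmul, map_zero]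
            · rw [hβ _ h, tmul_zero, map_zero]⟩)
      refine ⟨Λ r, ⟨r, fun z ↦ rfl⟩, ?_⟩
      refine (hΛ r z).trans ((congrArg _ (hη (ε z))).trans ?_)
      refine (kunnethStalk_gm_boxSec c₁ c₂ α β z).trans ?_
      rw [gm_boxSec, gm_boxSec]
      exact congrArg _ (congrArg₂ _ ha hb)
  intro e
  obtain ⟨U, hU, t, rfl⟩ := exists_gm e
  have hK := (hasProperSupport_psVal t).isCompact (isCompact_singleton (x := w))
    (Set.singleton_subset_iff.2 hU)
  -- The compact set is only the support in the fibre over `w`; at the other points of the fibre the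
  -- section is zero, and `h2` makes `v` vanish there as well.
  obtain ⟨v, ⟨r, hr⟩, h1, h2⟩ := exists_mem_of_bump N hN hN' (psVal t) hK (by
    rintro z ⟨-, hz⟩
    change s (ε z) ∈ U
    have hz' : s (ε z) = w := hz
    rwa [hz'])
  refine ⟨gm r w, ?_⟩
  rw [← gm_smap, gm_eq_iff_psVal (show w ∈ (⊤ : Opens W) from trivial) hU]
  intro z hz
  refine (hr z).symm.trans ?_
  by_cases h : gm (psVal t) z = 0
  · rw [h]
    refine h2 z ?_ h
    change s (ε z) ∈ U
    have hz' : s (ε z) = w := hz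
    rwa [hz']
  · exact h1 z ⟨h, hz⟩

end Kunneth

end SheafConvolution

end

noncomputable section

namespace SheafConvolution

/-! ### The Künneth isomorphism of complexes over the diagonal -/

section KunnethComplex

open Topology

variable {k : Type u} [Field k]

variable {X₁ X₂ Y₁ Y₂ Y Z W D : TopCat.{u}} {p₁ : X₁ ⟶ Y₁} {p₂ : X₂ ⟶ Y₂} {π₁ : Y ⟶ Y₁}
  {π₂ : Y ⟶ Y₂} {q₁ : Z ⟶ X₁} {q₂ : Z ⟶ X₂} {ε : Z ⟶ Y}
  (c₁ : ∀ z, p₁ (q₁ z) = π₁ (ε z)) (c₂ : ∀ z, p₂ (q₂ z) = π₂ (ε z))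
  [T2Space Y₁] [T2Space Y₂] [T2Space Y] [T2Space W] (s : Y ⟶ W)
  (hq : IsClosedEmbedding fun z ↦ (q₁ z, q₂ z)) (δ : D ⟶ W)

lemma boxMap_id_right {A A' : Shv k X₁} (φ : A ⟶ A') (B : Shv k X₂) :
    boxMap q₁ q₂ φ (𝟙 B) = ((tensor k Z).map ((pullback k q₁).map φ)).app
      ((pullback k q₂).obj B) := by
  have h : (pullback k q₂).map (𝟙 B) = 𝟙 _ := (pullback k q₂).map_id B
  rw [boxMap, h]
  exact (whisker_eq _ (((tensor k Z).obj _).map_id _)).trans (Category.comp_id _)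

lemma boxMap_id_left (A : Shv k X₁) {B B' : Shv k X₂} (ψ : B ⟶ B') :
    boxMap q₁ q₂ (𝟙 A) ψ = ((tensor k Z).obj ((pullback k q₁).obj A)).map
      ((pullback k q₂).map ψ) := by
  have h : (pullback k q₁).map (𝟙 A) = 𝟙 _ := (pullback k q₁).map_id A
  rw [boxMap, h]
  exact (eq_whisker (congrArg (fun f ↦ f.app ((pullback k q₂).obj B))
    ((tensor k Z).map_id ((pullback k q₁).obj A))) _).trans
    (Category.id_comp _)

lemma kunnethHom_naturality_left {A A' : Shv k X₁} (φ : A ⟶ A') (B : Shv k X₂) :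
    (properPushforward k s).map (((tensor k Y).map ((pullback k π₁).map
      ((properPushforward k p₁).map φ))).app ((pullback k π₂).obj
        ((properPushforward k p₂).obj B))) ≫ kunnethHom c₁ c₂ A' B s hq =
      kunnethHom c₁ c₂ A B s hq ≫ (properPushforward k (ε ≫ s)).map
        (((tensor k Z).map ((pullback k q₁).map φ)).app ((pullback k q₂).obj B)) := by
  have h := kunnethHom_naturality c₁ c₂ s hq φ (𝟙 B)
  have h' : (properPushforward k p₂).map (𝟙 B) = 𝟙 _ := (properPushforward k p₂).map_id B
  rw [h', boxMap_id_right, boxMap_id_right] at h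
  exact h

lemma kunnethHom_naturality_right (A : Shv k X₁) {B B' : Shv k X₂} (ψ : B ⟶ B') :
    (properPushforward k s).map (((tensor k Y).obj ((pullback k π₁).obj
      ((properPushforward k p₁).obj A))).map ((pullback k π₂).map
        ((properPushforward k p₂).map ψ))) ≫ kunnethHom c₁ c₂ A B' s hq =
      kunnethHom c₁ c₂ A B s hq ≫ (properPushforward k (ε ≫ s)).map
        (((tensor k Z).obj ((pullback k q₁).obj A)).map ((pullback k q₂).map ψ)) := by
  have h := kunnethHom_naturality c₁ c₂ s hq (𝟙 A) ψ
  have h' : (properPushforward k p₁).map (𝟙 A) = 𝟙 _ := (properPushforward k p₁).map_id A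
  rw [h', boxMap_id_left, boxMap_id_left] at h
  exact h

variable [T2Space X₁] [LocallyCompactSpace X₁] [T2Space X₂] [LocallyCompactSpace X₂]

lemma isIso_pullback_map_kunnethHom {A : Shv k X₁} {B : Shv k X₂} (hA : Fine A) (hB : Fine B)
    (hπ : IsClosedEmbedding fun y ↦ (π₁ y, π₂ y))
    (hδ : ∀ d y x₁ x₂, s y = δ d → p₁ x₁ = π₁ y → p₂ x₂ = π₂ y →
      ∃ z, q₁ z = x₁ ∧ q₂ z = x₂ ∧ ε z = y) :
    IsIso ((pullback k δ).map (kunnethHom c₁ c₂ A B s hq)) := by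
  apply isIso_of_stmap_bijective
  intro d
  have h : (stmap ((pullback k δ).map (kunnethHom c₁ c₂ A B s hq)) d : _ → _) ∘ pbStalk δ _ d =
      pbStalk δ _ d ∘ stmap (kunnethHom c₁ c₂ A B s hq) (δ d) :=
    funext fun e ↦ stmap_pullback δ _ d e
  have h1 : Function.Bijective (stmap (kunnethHom c₁ c₂ A B s hq) (δ d)) :=
    ⟨injective_stmap_kunnethHom c₁ c₂ s hq (hδ d),
      surjective_stmap_kunnethHom c₁ c₂ s hq hA hB hπ (δ d)⟩
  rw [← Function.Bijective.of_comp_iff _ (pbStalk δ _ d).bijective, h]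
  exact (pbStalk δ _ d).bijective.comp h1

/-- The Künneth isomorphisms of the summands are natural in both variables, so `exists_totIso`
assembles them into an isomorphism of total complexes. -/
lemma nonempty_kunneth_complex_iso (c₁ : ∀ z, p₁ (q₁ z) = π₁ (ε z))
    (c₂ : ∀ z, p₂ (q₂ z) = π₂ (ε z)) (hq : IsClosedEmbedding fun z ↦ (q₁ z, q₂ z)) {A : CochainComplex.Plus (Shv k X₁)}
    {B : CochainComplex.Plus (Shv k X₂)} (hA : ∀ i, Fine (A.obj.X i)) (hB : ∀ i, Fine (B.obj.X i))
    (hπ : IsClosedEmbedding fun y ↦ (π₁ y, π₂ y))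
    (hδ : ∀ d y x₁ x₂, s y = δ d → p₁ x₁ = π₁ y → p₂ x₂ = π₂ y →
      ∃ z, q₁ z = x₁ ∧ q₂ z = x₂ ∧ ε z = y) :
    Nonempty ((pullback k δ).mapCochainComplexPlus.obj
      ((properPushforward k s).mapCochainComplexPlus.obj (totTensor k Y
        ((pullback k π₁).mapCochainComplexPlus.obj
          ((properPushforward k p₁).mapCochainComplexPlus.obj A))
        ((pullback k π₂).mapCochainComplexPlus.obj
          ((properPushforward k p₂).mapCochainComplexPlus.obj B)))) ≅
      (pullback k δ).mapCochainComplexPlus.obj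
      ((properPushforward k (ε ≫ s)).mapCochainComplexPlus.obj (totTensor k Z
        ((pullback k q₁).mapCochainComplexPlus.obj A)
        ((pullback k q₂).mapCochainComplexPlus.obj B)))) := by
  obtain ⟨a, ha⟩ := A.2
  obtain ⟨b, hb⟩ := B.2
  have ha' : A.obj.IsStrictlyGE a := ha
  have hb' : B.obj.IsStrictlyGE b := hb
  have hi := fun i j ↦ isIso_pullback_map_kunnethHom c₁ c₂ s hq δ (hA i) (hB j) hπ hδ
  refine Exists.elim (exists_totIso (F := tensor k Y) (F' := tensor k Z)
    (K := (((pullback k π₁).mapHomologicalComplex (ComplexShape.up ℤ)).obj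
      (((properPushforward k p₁).mapHomologicalComplex (ComplexShape.up ℤ)).obj A.obj)))
    (L := (((pullback k π₂).mapHomologicalComplex (ComplexShape.up ℤ)).obj
      (((properPushforward k p₂).mapHomologicalComplex (ComplexShape.up ℤ)).obj B.obj)))
    (K' := ((pullback k q₁).mapHomologicalComplex (ComplexShape.up ℤ)).obj A.obj)
    (L' := ((pullback k q₂).mapHomologicalComplex (ComplexShape.up ℤ)).obj B.obj)
    (G := properPushforward k s ⋙ pullback k δ) (G' := properPushforward k (ε ≫ s) ⋙ pullback k δ)
    a b a b (fun i j ↦ @asIso _ _ _ _ _ (hi i j))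
    (fun i j ↦ ?_) (fun i j ↦ ?_)) fun Φ _ ↦ ?_
  · exact ((pullback k δ).map_comp _ _).symm.trans ((congrArg (pullback k δ).map
      (kunnethHom_naturality_left c₁ c₂ s hq (A.obj.d i (i + 1)) (B.obj.X j))).trans
      ((pullback k δ).map_comp _ _))
  · exact ((pullback k δ).map_comp _ _).symm.trans ((congrArg (pullback k δ).map
      (kunnethHom_naturality_right c₁ c₂ s hq (A.obj.X i) (B.obj.d j (j + 1)))).trans
      ((pullback k δ).map_comp _ _))
  · exact ⟨ObjectProperty.isoMk _ Φ⟩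

end KunnethComplex

end SheafConvolution

end

noncomputable section

namespace SheafConvolution

/-! ### Recognizing constant sheaves on closed sets by one section -/

section CharSection

open Topology TensorProduct

variable {k : Type u} [Field k] {X Y Z : TopCat.{u}}

/-- The global section `h` of `F` spans the stalks of `F`, and the set of the points at which it
does not vanish is `W`. -/
structure IsCharSection {F : Shv k X} (h : sec F ⊤) (W : Set X) : Prop where
  exists_smul (x : X) (e : stk F x) : ∃ c : k, e = c • gm h x
  gm_ne_zero_iff (x : X) : gm h x ≠ 0 ↔ x ∈ W

/-- The constant section `1` of the constant sheaf. -/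
lemma exists_isCharSection_constantSheaf :
    ∃ h : sec ((constantSheaf (Opens.grothendieckTopology X) (ModuleCat.{u} k)).obj
      (ModuleCat.of k k)) ⊤, IsCharSection h Set.univ := by
  let P : TopCat.Presheaf (ModuleCat.{u} k) X := (Functor.const _).obj (ModuleCat.of k k)
  let F : Shv k X := (presheafToSheaf (Opens.grothendieckTopology X) (ModuleCat.{u} k)).obj P
  let η : P ⟶ F.presheaf := CategoryTheory.toSheafify (Opens.grothendieckTopology X) P
  let h : sec F ⊤ := η.app (op ⊤) (1 : k)
  -- The multiples of `h` are the images of the constants, and sheafification is bijective on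
  -- stalks, so everything reduces to the constant presheaf.
  have hx : ∀ (x : X) (c : k), c • gm h x = (TopCat.Presheaf.stalkFunctor (ModuleCat.{u} k) x).map η
      (P.germ ⊤ x trivial c) := by
    intro x c
    rw [gm_of_mem _ (show x ∈ (⊤ : Opens X) from trivial)]
    have h1 := TopCat.Presheaf.stalkFunctor_map_germ_apply ⊤ x trivial η c
    refine Eq.trans ?_ h1.symm
    have h2 : η.app (op ⊤) c = c • h := by
      have h3 : (c : k) = c • (1 : k) := by simp
      exact (congrArg (η.app (op ⊤)) h3).trans ((η.app (op ⊤)).hom.map_smul c (1 : k))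
    rw [h2]
    exact ((F.presheaf.germ ⊤ x trivial).hom.map_smul c h).symm
  have hb : ∀ x : X, Function.Bijective ((TopCat.Presheaf.stalkFunctor (ModuleCat.{u} k) x).map η) := by
    intro x
    have h1 := TopCat.Presheaf.stalkFunctor_map_unit_toSheafify_isIso x (ModuleCat.{u} k) P
    exact @ConcreteCategory.bijective_of_isIso _ _ _ _ _ _ _ _ _ h1
  suffices hF : IsCharSection h Set.univ from ⟨h, hF⟩
  refine ⟨fun x e ↦ ?_, fun x ↦ ⟨fun _ ↦ trivial, fun _ h0 ↦ ?_⟩⟩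
  · obtain ⟨e', rfl⟩ := (hb x).surjective e
    obtain ⟨U, hU, c, rfl⟩ := P.exists_germ_eq e'
    refine ⟨c, ?_⟩
    refine Eq.trans (congrArg _ ?_) (hx x c).symm
    exact P.germ_res_apply (homOfLE le_top) x hU (c : k)
  · have h1 : _ = (0 : stk F x) :=
      (hx x 1).symm.trans ((congrArg (fun e : stk F x ↦ (1 : k) • e) h0).trans (smul_zero (A := stk F x) _))
    have h2 : P.germ ⊤ x trivial (1 : k) = P.germ ⊤ x trivial (0 : k) := by
      apply (hb x).injective
      refine h1.trans ?_
      refine Eq.trans ?_ (congrArg _ (map_zero (P.germ ⊤ x trivial).hom).symm)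
      exact (map_zero ((TopCat.Presheaf.stalkFunctor (ModuleCat.{u} k) x).map η).hom).symm
    obtain ⟨V, hV, i, j, h3⟩ := P.germ_eq x (show x ∈ (⊤ : Opens X) from trivial)
      (show x ∈ (⊤ : Opens X) from trivial) _ _ h2
    exact one_ne_zero (α := k) h3

lemma gm_pushforward_eq_zero {f : X ⟶ Y} {F : Shv k X} {U V : Opens Y} {y : Y} (hy : y ∈ U)
    (hV : y ∈ V) (s : sec F ((Opens.map f).obj U)) (h : ∀ x, f x ∈ V → gm s x = 0) :
    gm (F := (TopCat.Sheaf.pushforward (ModuleCat.{u} k) f).obj F) (U := U) s y = 0 := by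
  let G : Shv k Y := (TopCat.Sheaf.pushforward (ModuleCat.{u} k) f).obj F
  have h1 : res (F := G) (U := U) (V := U ⊓ V) inf_le_left s = 0 := by
    refine sec_ext (F := F) (U := (Opens.map f).obj (U ⊓ V)) (t := 0) fun x hx ↦ ?_
    rw [gm_zero]
    exact (gm_res (F := F) (U := (Opens.map f).obj U) (V := (Opens.map f).obj (U ⊓ V))
      (fun _ h ↦ h.1) s hx).trans (h x hx.2)
  have h2 := gm_res (F := G) (U := U) (V := U ⊓ V) inf_le_left s (x := y) ⟨hy, hV⟩
  rw [← h2, h1, gm_zero]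

lemma gm_pushforward_eq_zero_iff {f : X ⟶ Y} (hf : IsInducing f) {F : Shv k X} {U : Opens Y}
    {x : X} (hx : f x ∈ U) (s : sec F ((Opens.map f).obj U)) :
    gm (F := (TopCat.Sheaf.pushforward (ModuleCat.{u} k) f).obj F) (U := U) s (f x) = 0 ↔
      gm s x = 0 := by
  let G : Shv k Y := (TopCat.Sheaf.pushforward (ModuleCat.{u} k) f).obj F
  constructor
  · intro h0
    obtain ⟨V, hV, hVU, hV0⟩ := exists_gm_eq_zero (F := G) (U := U) hx h0
    have h1 : res (F := G) (U := U) hVU s = 0 :=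
      sec_ext fun y hy ↦ (gm_res (F := G) (U := U) hVU s hy).trans
        ((hV0 y hy).trans (gm_zero y).symm)
    have h2 := gm_res (F := F) (U := (Opens.map f).obj U) (V := (Opens.map f).obj V)
      (fun _ h ↦ hVU h) s hV
    refine h2.symm.trans ?_
    exact (congrArg (fun t ↦ gm (F := F) (U := (Opens.map f).obj V) t x) h1).trans (gm_zero x)
  · intro h0
    obtain ⟨V, hV, hVU, hV0⟩ := exists_gm_eq_zero (U := (Opens.map f).obj U) hx h0
    obtain ⟨V', hV', hVV⟩ := hf.isOpen_iff.1 V.isOpen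
    have hmem : ∀ y, f y ∈ V' ↔ y ∈ V := fun y ↦ Set.ext_iff.1 hVV y
    exact gm_pushforward_eq_zero (V := ⟨V', hV'⟩) hx ((hmem x).2 hV) s
      fun y hy ↦ hV0 y ((hmem y).1 hy)

lemma IsCharSection.pushforward {f : X ⟶ Y} (hf : IsClosedEmbedding f) {F : Shv k X}
    {h : sec F ⊤} (hh : IsCharSection h Set.univ) :
    IsCharSection (F := (TopCat.Sheaf.pushforward (ModuleCat.{u} k) f).obj F) (h : sec F ⊤)
      (Set.range f) := by
  let G : Shv k Y := (TopCat.Sheaf.pushforward (ModuleCat.{u} k) f).obj F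
  have hout : ∀ y ∉ Set.range f, ∀ e : stk G y, e = 0 := by
    intro y hy e
    obtain ⟨U, hU, s, rfl⟩ := exists_gm e
    exact gm_pushforward_eq_zero (V := ⟨_, hf.isClosed_range.isOpen_compl⟩) hU hy s
      fun x hx ↦ (hx ⟨x, rfl⟩).elim
  refine ⟨fun y e ↦ ?_, fun y ↦ ⟨fun h0 ↦ ?_, ?_⟩⟩
  · by_cases hy : y ∈ Set.range f
    · obtain ⟨x, rfl⟩ := hy
      obtain ⟨U, hU, s, rfl⟩ := exists_gm e
      obtain ⟨c, hc⟩ := hh.exists_smul x (gm (F := F) (U := (Opens.map f).obj U) s x)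
      refine ⟨c, ?_⟩
      let t : sec G U := res (F := G) (U := ⊤) le_top h
      have ht : gm t (f x) = gm (F := G) (U := ⊤) h (f x) := gm_res _ _ hU
      have h1 : gm (F := G) (s - c • t) (f x) = 0 := by
        refine (gm_pushforward_eq_zero_iff hf.isInducing hU _).2 ?_
        refine (gm_sub (F := F) (U := (Opens.map f).obj U) s (c • t) x).trans ?_
        refine (congrArg (fun e ↦ gm (F := F) (U := (Opens.map f).obj U) s x - e)
          (gm_smul (F := F) (U := (Opens.map f).obj U) c t x)).trans ?_
        have h2 : gm (F := F) (U := (Opens.map f).obj U) t x = gm h x :=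
          gm_res (F := F) (U := ⊤) (V := (Opens.map f).obj U) le_top h hU
        rw [h2, hc, sub_self]
      rw [gm_sub, gm_smul, ht, sub_eq_zero] at h1
      exact h1
    · exact ⟨0, (hout y hy e).trans (zero_smul _ _).symm⟩
  · by_contra hy
    exact h0 (hout y hy _)
  · rintro ⟨x, rfl⟩ h0
    exact (hh.gm_ne_zero_iff x).2 trivial
      ((gm_pushforward_eq_zero_iff (U := ⊤) hf.isInducing trivial h).1 h0)

lemma exists_isCharSection_constantSheafOn {W : Set X} (hW : IsClosed W) :
    ∃ h : sec (constantSheafOn k X W) ⊤, IsCharSection h W := by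
  obtain ⟨h, hh⟩ := exists_isCharSection_constantSheaf (k := k) (X := TopCat.of W)
  let f : TopCat.of W ⟶ X := TopCat.ofHom ⟨Subtype.val, continuous_subtype_val⟩
  have hf : IsClosedEmbedding f := hW.isClosedEmbedding_subtypeVal
  have h1 := hh.pushforward hf
  have h2 : Set.range f = W := Subtype.range_val
  rw [h2] at h1
  exact ⟨_, h1⟩

/-- The stalk of `F` is the line spanned by the germ of `h` on `W` and zero elsewhere, so sending
`h` to `h'` is well defined. Every germ is a multiple of `h`, whence the continuity of the family.
-/
lemma IsCharSection.exists_hom {F G : Shv k X} {h : sec F ⊤} {W : Set X} (hh : IsCharSection h W)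
    (h' : sec G ⊤) (hh' : ∀ x ∉ W, gm h' x = 0) :
    ∃ Φ : F ⟶ G, ∀ x, stmap Φ x (gm h x) = gm h' x := by
  have h1 : ∀ x, ∃ φ : stk F x →ₗ[k] stk G x, φ (gm h x) = gm h' x := by
    intro x
    by_cases hx : x ∈ W
    · have hx' := (hh.gm_ne_zero_iff x).2 hx
      obtain ⟨φ, hφ⟩ := Module.Projective.exists_dual_eq_one k hx'
      exact ⟨(LinearMap.toSpanSingleton k _ (gm h' x)) ∘ₗ φ, by simp [hφ]⟩
    · refine ⟨0, ?_⟩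
      rw [hh' x hx, LinearMap.zero_apply]
  choose φ hφ using h1
  obtain ⟨Φ, hΦ⟩ := exists_hom_of_stalks φ (by
    intro x e
    obtain ⟨c, hc⟩ := hh.exists_smul x e
    refine ⟨⊤, c • h, ⊤, c • h', trivial, trivial, ?_, fun y _ ↦ ?_⟩
    · exact (gm_smul _ _ _).trans hc.symm
    · change _ = φ y (gm (c • h) y)
      rw [gm_smul, gm_smul, map_smul, hφ])
  exact ⟨Φ, fun x ↦ by rw [hΦ, hφ]⟩

lemma tmul_eq_zero_iff {V W : Type*} [AddCommGroup V] [Module k V] [AddCommGroup W] [Module k W]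
    {v : V} {w : W} : v ⊗ₜ[k] w = 0 ↔ v = 0 ∨ w = 0 := by
  refine ⟨fun h ↦ ?_, ?_⟩
  · by_contra! hcon
    obtain ⟨φ, hφ⟩ := Module.Projective.exists_dual_eq_one k hcon.1
    obtain ⟨ψ, hψ⟩ := Module.Projective.exists_dual_eq_one k hcon.2
    have h1 := congrArg ((TensorProduct.lid k k).toLinearMap ∘ₗ TensorProduct.map φ ψ) h
    simp [hφ, hψ] at h1
  · rintro (rfl | rfl)
    · exact zero_tmul _ _
    · exact tmul_zero _ _

/-- The product of the two sections works, because over a field a pure tensor vanishes only if one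
of its factors does. -/
lemma IsCharSection.box {X₁ X₂ : TopCat.{u}} (f : Z ⟶ X₁) (g : Z ⟶ X₂) {A : Shv k X₁}
    {B : Shv k X₂} {a : sec A ⊤} {b : sec B ⊤} {W₁ : Set X₁} {W₂ : Set X₂}
    (ha : IsCharSection a W₁) (hb : IsCharSection b W₂) :
    ∃ h : sec (boxTens f g A B) ⊤, IsCharSection h {z | f z ∈ W₁ ∧ g z ∈ W₂} := by
  refine ⟨res (fun z _ ↦ (show z ∈ (Opens.map f).obj ⊤ ⊓ (Opens.map g).obj ⊤ from
    ⟨trivial, trivial⟩)) (boxSec f g a b), ⟨fun z e ↦ ?_, fun z ↦ ?_⟩⟩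
  · rw [gm_res _ _ (show z ∈ (⊤ : Opens Z) from trivial)]
    induction e using box_induction with
    | zero => exact ⟨0, (zero_smul _ _).symm⟩
    | add x y hx hy =>
      obtain ⟨c, rfl⟩ := hx
      obtain ⟨c', rfl⟩ := hy
      exact ⟨c + c', (add_smul _ _ _).symm⟩
    | box U₁ h₁ a' U₂ h₂ b' =>
      obtain ⟨c, hc⟩ := ha.exists_smul _ (gm a' (f z))
      obtain ⟨c', hc'⟩ := hb.exists_smul _ (gm b' (g z))
      refine ⟨c * c', ?_⟩
      rw [gm_boxSec, gm_boxSec, hc, hc', smul_tmul_smul, map_smul]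
  · rw [gm_res _ _ (show z ∈ (⊤ : Opens Z) from trivial), gm_boxSec, ne_eq,
      LinearEquiv.map_eq_zero_iff, tmul_eq_zero_iff, not_or]
    exact and_congr (ha.gm_ne_zero_iff _) (hb.gm_ne_zero_iff _)

end CharSection

end SheafConvolution

end

noncomputable section

namespace SheafConvolution

/-! ### Extending germs of cocycles -/

section CocycleExtension

open Topology Filter

variable {k : Type u} [Field k] {X Z : TopCat.{u}}

/-- The germs of the kernel of `β` extend to global sections of the kernel. -/
def KerExtends {B C : Shv k Z} (β : B ⟶ C) : Prop :=
  ∀ (z : Z) (e : stk B z), stmap β z e = 0 →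
    ∃ t : sec B ⊤, (∀ y, stmap β y (gm t y) = 0) ∧ gm t z = e

/-- The germs of the kernel of `β` at two distinct points outside of `W` extend to a common global
section of the kernel. -/
def KerExtendsPair {B C : Shv k Z} (β : B ⟶ C) (W : Set Z) : Prop :=
  ∀ (z z' : Z), z ≠ z' → z ∉ W → z' ∉ W → ∀ (e : stk B z) (e' : stk B z'), stmap β z e = 0 →
    stmap β z' e' = 0 → ∃ t : sec B ⊤, (∀ y, stmap β y (gm t y) = 0) ∧ gm t z = e ∧ gm t z' = e'

lemma CSoft.exists_gm_eq {F : Shv k Z} (hF : CSoft F) {z : Z} (e : stk F z) :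
    ∃ t : sec F ⊤, gm t z = e := by
  obtain ⟨U, hU, s, rfl⟩ := exists_gm e
  obtain ⟨t, ht⟩ := hF {z} isCompact_singleton U (Set.singleton_subset_iff.2 hU) s
  exact ⟨t, ht z rfl⟩

lemma CSoft.exists_gm_eq_pair [T2Space Z] {F : Shv k Z} (hF : CSoft F) {z z' : Z} (hz : z ≠ z')
    (e : stk F z) (e' : stk F z') : ∃ t : sec F ⊤, gm t z = e ∧ gm t z' = e' := by
  obtain ⟨V, V', hV, hV', hzV, hzV', hd⟩ := t2_separation hz
  obtain ⟨U, hU, hUV, s, rfl⟩ := exists_gm_le e (V := ⟨V, hV⟩) hzV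
  obtain ⟨U', hU', hUV', s', rfl⟩ := exists_gm_le e' (V := ⟨V', hV'⟩) hzV'
  obtain ⟨r, hr, hr'⟩ := exists_glue s s' fun x hx hx' ↦
    (Set.disjoint_left.1 hd (hUV hx) (hUV' hx')).elim
  obtain ⟨t, ht⟩ := hF {z, z'} (Set.toFinite _).isCompact (U ⊔ U') (by
    rintro y (rfl | rfl)
    · exact Or.inl hU
    · exact Or.inr hU') r
  exact ⟨t, (ht z (Or.inl rfl)).trans (hr z hU), (ht z' (Or.inr rfl)).trans (hr' z' hU')⟩

section

variable {A B C : Shv k Z} {α : A ⟶ B} {β : B ⟶ C}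

lemma KerExtends.of_exact (hA : CSoft A) (h : ∀ z, Function.Exact (stmap α z) (stmap β z)) :
    KerExtends β := by
  intro z e he
  obtain ⟨e', rfl⟩ := (h z e).1 he
  obtain ⟨t, rfl⟩ := hA.exists_gm_eq e'
  exact ⟨smap α ⊤ t, fun y ↦ by rw [gm_smap, (h y).apply_apply_eq_zero], gm_smap _ _ _⟩

lemma KerExtendsPair.of_exact [T2Space Z] (hA : CSoft A)
    (h : ∀ z, Function.Exact (stmap α z) (stmap β z)) (W : Set Z) : KerExtendsPair β W := by
  intro z z' hz _ _ e e' he he'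
  obtain ⟨e, rfl⟩ := (h z e).1 he
  obtain ⟨e', rfl⟩ := (h z' e').1 he'
  obtain ⟨t, rfl, rfl⟩ := hA.exists_gm_eq_pair hz e e'
  exact ⟨smap α ⊤ t, fun y ↦ by rw [gm_smap, (h y).apply_apply_eq_zero], gm_smap _ _ _,
    gm_smap _ _ _⟩

end

/-- The global section `h` of `B` spans the stalks of the kernel of `β`, and the set of the points
at which it does not vanish is `W`. -/
structure IsKerSection {B C : Shv k Z} (β : B ⟶ C) (h : sec B ⊤) (W : Set Z) : Prop where
  stmap_gm (z : Z) : stmap β z (gm h z) = 0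
  exists_smul (z : Z) (e : stk B z) (he : stmap β z e = 0) : ∃ c : k, e = c • gm h z
  gm_ne_zero_iff (z : Z) : gm h z ≠ 0 ↔ z ∈ W

variable {B C : Shv k Z} {β : B ⟶ C} {h : sec B ⊤} {W : Set Z}

lemma IsKerSection.kerExtends (hh : IsKerSection β h W) : KerExtends β := by
  intro z e he
  obtain ⟨c, rfl⟩ := hh.exists_smul z e he
  exact ⟨c • h, fun y ↦ by rw [gm_smul, map_smul, hh.stmap_gm, smul_zero], gm_smul _ _ _⟩

lemma IsKerSection.eq_zero (hh : IsKerSection β h W) {z : Z} (hz : z ∉ W) {e : stk B z}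
    (he : stmap β z e = 0) : e = 0 := by
  obtain ⟨c, rfl⟩ := hh.exists_smul z e he
  rw [not_not.1 (fun h0 ↦ hz ((hh.gm_ne_zero_iff z).1 h0)), smul_zero]

/-- Off `W` the kernel has zero stalks, so the zero section does. On `W` the values at two points of
a connected piece are not independent, which is why the property excludes `W`. -/
lemma IsKerSection.kerExtendsPair (hh : IsKerSection β h W) : KerExtendsPair β W := by
  intro z z' _ hz hz' e e' he he'
  refine ⟨0, fun y ↦ by rw [gm_zero, map_zero], ?_, ?_⟩
  · rw [gm_zero, hh.eq_zero hz he]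
  · rw [gm_zero, hh.eq_zero hz' he']

end CocycleExtension

/-! ### Gluing and lifting along a real line -/

section Line

open Topology Filter

variable {k : Type u} [Field k] (X : TopCat.{u})

/-- The product of a space with the real line. -/
abbrev lineProd : TopCat.{u} := TopCat.of (X × ℝ)

/-- The projection from the product of a space with the real line. -/
def lineProj : lineProd X ⟶ X := TopCat.ofHom ⟨Prod.fst, continuous_fst⟩

variable {X}

/-- The sections agree near `(x, c)`, so together they define a section over the union of a
neighbourhood of this point with the half-spaces below and above `c`. This contains the whole line
over `x`, and c-softness extends from a compact segment. -/
lemma exists_glue_line {A : Shv k (lineProd X)} (hA : CSoft A) (x : X) {c : ℝ} (v v' : sec A ⊤)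
    (h : gm v ((x, c) : lineProd X) = gm v' ((x, c) : lineProd X)) (a d : ℝ) :
    ∃ r : sec A ⊤, (∀ τ ∈ Set.Icc a d, τ ≤ c →
      gm r ((x, τ) : lineProd X) = gm v ((x, τ) : lineProd X)) ∧
      ∀ τ ∈ Set.Icc a d, c ≤ τ → gm r ((x, τ) : lineProd X) = gm v' ((x, τ) : lineProd X) := by
  classical
  obtain ⟨N, hxN, -, -, hN⟩ := exists_gm_eq (U := ⊤) (V := ⊤) trivial trivial h
  let L : Opens (lineProd X) := ⟨{z | z.2 < c}, isOpen_lt continuous_snd continuous_const⟩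
  let R : Opens (lineProd X) := ⟨{z | c < z.2}, isOpen_lt continuous_const continuous_snd⟩
  obtain ⟨r, hr⟩ := exists_section (F := A) (N ⊔ L ⊔ R)
    (fun z ↦ if z.2 ≤ c then gm v z else gm v' z) (by
      rintro z ((hz | hz) | hz)
      · refine ⟨N, hz, res le_top v, fun y hy _ ↦ ?_⟩
        rw [gm_res _ _ hy]
        split_ifs
        · rfl
        · exact hN y hy
      · refine ⟨L, hz, res le_top v, fun y hy _ ↦ ?_⟩
        rw [gm_res _ _ hy, if_pos (le_of_lt hy)]
      · refine ⟨R, hz, res le_top v', fun y hy _ ↦ ?_⟩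
        rw [gm_res _ _ hy, if_neg (not_le_of_gt hy)])
  have hmem : ∀ τ : ℝ, ((x, τ) : lineProd X) ∈ N ⊔ L ⊔ R := by
    intro τ
    rcases lt_trichotomy τ c with hτ | rfl | hτ
    · exact Or.inl (Or.inr hτ)
    · exact Or.inl (Or.inl hxN)
    · exact Or.inr hτ
  obtain ⟨t, ht⟩ := hA ((fun τ : ℝ ↦ ((x, τ) : X × ℝ)) '' Set.Icc a d)
    (isCompact_Icc.image (by fun_prop)) _ (by
      rintro _ ⟨τ, -, rfl⟩
      exact hmem τ) r
  refine ⟨t, fun τ hτ hc ↦ ?_, fun τ hτ hc ↦ ?_⟩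
  · rw [ht _ ⟨τ, hτ, rfl⟩, hr _ (hmem τ)]
    exact if_pos hc
  · rw [ht _ ⟨τ, hτ, rfl⟩, hr _ (hmem τ)]
    rcases hc.eq_or_lt with rfl | hc
    · exact (if_pos le_rfl).trans h
    · exact if_neg (not_le_of_gt hc)

/-- Lifting along a morphism over a compact interval in a fibre. -/
lemma exists_lift_Icc {A B : Shv k (lineProd X)} {α : A ⟶ B} (hA : CSoft A) (hα : KerExtends α)
    (x : X) {a b : ℝ} (hab : a ≤ b) {O : Opens (lineProd X)} (w : sec B O)
    (hO : ∀ τ : ℝ, ((x, τ) : lineProd X) ∈ O)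
    (hw : ∀ τ : ℝ, gm w ((x, τ) : lineProd X) ∈
      LinearMap.range (stmap α ((x, τ) : lineProd X))) :
    ∃ v : sec A ⊤, ∀ τ ∈ Set.Icc a b, stmap α _ (gm v ((x, τ) : lineProd X)) =
      gm w ((x, τ) : lineProd X) := by
  have h1 : ∀ τ : ℝ, ∃ v : sec A ⊤, stmap α _ (gm v ((x, τ) : lineProd X)) =
      gm w ((x, τ) : lineProd X) := by
    intro τ
    obtain ⟨e, he⟩ := hw τ
    obtain ⟨v, rfl⟩ := hA.exists_gm_eq e
    exact ⟨v, he⟩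
  choose v hv using h1
  let c : Set.Icc a b → Set (Set.Icc a b) := fun i ↦ {τ | stmap α _ (gm (v i) ((x, (τ : ℝ)) : lineProd X)) =
      gm w ((x, (τ : ℝ)) : lineProd X)}
  have hc : ∀ i, IsOpen (c i) := by
    intro i
    have h2 := (isOpen_setOf_gm_eq (smap α ⊤ (v i)) w).preimage
      (show Continuous fun τ : Set.Icc a b ↦ ((x, (τ : ℝ)) : X × ℝ) by fun_prop)
    convert h2 using 1
    ext τ
    change _ ↔ _ ∧ _ ∧ gm (smap α ⊤ (v i)) _ = _
    rw [gm_smap]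
    exact ⟨fun h ↦ ⟨trivial, hO τ, h⟩, fun h ↦ h.2.2⟩
  -- The interval is subdivided so that a single `v i` lifts `w` on each piece. At each division
  -- point the next lift is corrected by a global section of the kernel to match the previous one.
  obtain ⟨t, ht0, htm, ⟨m, hm⟩, htc⟩ := exists_monotone_Icc_subset_open_cover_Icc hab hc
    (fun i _ ↦ Set.mem_iUnion.2 ⟨i, hv i⟩)
  have key : ∀ n, ∃ r : sec A ⊤, ∀ τ ∈ Set.Icc a (t n : ℝ),
      stmap α _ (gm r ((x, τ) : lineProd X)) = gm w ((x, τ) : lineProd X) := by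
    intro n
    induction n with
    | zero =>
      refine ⟨v a, fun τ hτ ↦ ?_⟩
      rw [ht0, Set.Icc_self] at hτ
      rw [hτ]
      exact hv a
    | succ n ih =>
      obtain ⟨r, hr⟩ := ih
      obtain ⟨i, hi⟩ := htc n
      have hle : (t n : ℝ) ≤ t (n + 1) := htm (Nat.le_succ n)
      have h3 : stmap α _ (gm (r - v i) ((x, (t n : ℝ)) : lineProd X)) = 0 := by
        rw [gm_sub, map_sub, hr _ ⟨(t n).2.1, le_rfl⟩, sub_eq_zero]
        exact (hi ⟨le_rfl, hle⟩).symm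
      obtain ⟨q, hq, hq'⟩ := hα _ _ h3
      obtain ⟨r', h4, h5⟩ := exists_glue_line hA x (c := t n) r (v i + q) (by
        rw [gm_add, hq', gm_sub]
        abel) a (t (n + 1))
      refine ⟨r', fun τ hτ ↦ ?_⟩
      rcases le_total τ (t n) with h | h
      · rw [h4 τ hτ h, hr τ ⟨hτ.1, h⟩]
      · rw [h5 τ hτ h, gm_add, map_add, hq, add_zero]
        exact hi (a := ⟨τ, hτ.1, hτ.2.trans (t (n + 1)).2.2⟩) ⟨h, hτ.2⟩
  obtain ⟨r, hr⟩ := key m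
  rw [hm m le_rfl] at hr
  exact ⟨r, hr⟩

end Line

end SheafConvolution

end

noncomputable section

namespace SheafConvolution

/-! ### The direct image with proper supports along a real line -/

section LinePushforward

open Topology Filter

variable {k : Type u} [Field k] {X : TopCat.{u}} [T2Space X] [LocallyCompactSpace X]

/-- In the fibre over `x`, both `W` and the support of `s` lie inside `(-R, R)`. A lift on `[-R, R]`
takes kernel values at the two ends, which lie off `W`, so one global section of the kernel removes
both. What remains vanishes near the ends and can be cut off to a lift with proper support. -/
lemma exists_lift_lineProj {A B : Shv k (lineProd X)} {α : A ⟶ B} {W : Set (lineProd X)}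
    (hA : CSoft A) (hα : KerExtends α) (hα' : KerExtendsPair α W) {x : X}
    (hW : Bornology.IsBounded {τ : ℝ | ((x, τ) : lineProd X) ∈ W}) {V : Opens X} (hx : x ∈ V)
    (s : sec ((properPushforward k (lineProj X)).obj B) V)
    (hs : ∀ τ : ℝ, gm (psVal s) ((x, τ) : lineProd X) ∈
      LinearMap.range (stmap α ((x, τ) : lineProd X))) :
    gm s x ∈ LinearMap.range (stmap ((properPushforward k (lineProj X)).map α) x) := by
  have hK := (hasProperSupport_psVal s).isCompact (isCompact_singleton (x := x))
    (Set.singleton_subset_iff.2 hx)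
  have hK' : Bornology.IsBounded {τ : ℝ | gm (psVal s) ((x, τ) : lineProd X) ≠ 0} := by
    refine (hK.image (f := fun z : X × ℝ ↦ z.2) continuous_snd).isBounded.subset ?_
    intro τ hτ
    exact ⟨((x, τ) : X × ℝ), ⟨hτ, rfl⟩, rfl⟩
  obtain ⟨R, hR0, hR⟩ := (hW.union hK').subset_ball_lt 0 0
  have hWR : ∀ τ : ℝ, R ≤ |τ| → ((x, τ) : lineProd X) ∉ W := fun τ hτ h ↦ by
    have := hR (Or.inl h)
    rw [mem_ball_zero_iff, Real.norm_eq_abs] at this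
    exact absurd this (not_lt.2 hτ)
  have hwR : ∀ τ : ℝ, R ≤ |τ| → gm (psVal s) ((x, τ) : lineProd X) = 0 := fun τ hτ ↦ by
    by_contra h
    have := hR (Or.inr h)
    rw [mem_ball_zero_iff, Real.norm_eq_abs] at this
    exact absurd this (not_lt.2 hτ)
  obtain ⟨v, hv⟩ := exists_lift_Icc hA hα x (a := -R) (b := R) (by linarith)
    (O := (Opens.map (lineProj X)).obj V) (psVal s) (fun τ ↦ hx) hs
  have ha : R ≤ |-R| := by rw [abs_neg]; exact le_abs_self R
  have hb : R ≤ |R| := le_abs_self R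
  obtain ⟨q, hq, hqa, hqb⟩ := hα' ((x, -R) : lineProd X) ((x, R) : lineProd X)
    (fun h ↦ by
      have := congrArg Prod.snd h
      change -R = R at this
      linarith) (hWR _ ha) (hWR _ hb) _ _
    ((hv (-R) ⟨le_rfl, by linarith⟩).trans (hwR _ ha))
    ((hv R ⟨by linarith, le_rfl⟩).trans (hwR _ hb))
  have h1 : ∀ τ ∈ Set.Icc (-R) R, stmap α _ (gm (v - q) ((x, τ) : lineProd X)) =
      gm (psVal s) ((x, τ) : lineProd X) := fun τ hτ ↦ by
    rw [gm_sub, map_sub, hq, sub_zero]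
    exact hv τ hτ
  have hza : gm (v - q) ((x, -R) : lineProd X) = 0 := by rw [gm_sub, hqa, sub_self]
  have hzb : gm (v - q) ((x, R) : lineProd X) = 0 := by rw [gm_sub, hqb, sub_self]
  obtain ⟨Na, hxa, -, hNa⟩ := exists_gm_eq_zero (U := ⊤) trivial hza
  obtain ⟨Nb, hxb, -, hNb⟩ := exists_gm_eq_zero (U := ⊤) trivial hzb
  -- Over `V'` the corrected lift vanishes at the heights `-R` and `R`, that is on the boundary of
  -- the strip along which it is cut.
  let V' : Opens X := V ⊓ ⟨(fun y : X ↦ ((y, -R) : X × ℝ)) ⁻¹' Na, Na.isOpen.preimage (by fun_prop)⟩ ⊓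
    ⟨(fun y : X ↦ ((y, R) : X × ℝ)) ⁻¹' Nb, Nb.isOpen.preimage (by fun_prop)⟩
  have hxV' : x ∈ V' := ⟨⟨hx, hxa⟩, hxb⟩
  let O : Opens (lineProd X) := ⟨{z | -R < z.2 ∧ z.2 < R},
    (isOpen_lt continuous_const continuous_snd).inter (isOpen_lt continuous_snd continuous_const)⟩
  have hO : closure (O : Set (lineProd X)) ⊆ {z | -R ≤ z.2 ∧ z.2 ≤ R} :=
    closure_minimal (fun z hz ↦ ⟨hz.1.le, hz.2.le⟩)
      ((isClosed_le continuous_const continuous_snd).inter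
        (isClosed_le continuous_snd continuous_const))
  obtain ⟨r, hr, hr'⟩ := exists_cut (V := (Opens.map (lineProj X)).obj V')
    (res le_top (v - q)) O (by
      rintro ⟨y, τ⟩ hz hzc hzO
      rw [gm_res _ _ hz]
      obtain ⟨h2, h3⟩ := hO hzc
      rcases h2.eq_or_lt with h4 | h4
      · have h5 : -R = τ := h4
        subst h5
        exact hNa _ hz.1.2
      · rcases h3.eq_or_lt with h5 | h5
        · have h6 : τ = R := h5
          subst h6
          exact hNb _ hz.2
        · exact (hzO ⟨h4, h5⟩).elim)
  have hp : HasProperSupport (lineProj X) A (U := V') r := by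
    refine hasProperSupport_of_compact fun y _ ↦ ?_
    obtain ⟨N, hN, hyN⟩ := exists_compact_mem_nhds y
    refine ⟨N, hyN, N ×ˢ Set.Icc (-R) R, hN.prod isCompact_Icc, fun z hz hz' ↦ ⟨hz, ?_⟩⟩
    by_contra h
    refine hz' (hr' z fun h' ↦ h ⟨h'.1.le, h'.2.le⟩)
  refine ⟨gm (psMk r hp) x, ?_⟩
  rw [← gm_smap, gm_eq_iff_psVal hxV' hx]
  rintro ⟨y, τ⟩ hz
  have hy : y = x := hz
  subst hy
  rw [gm_psVal_smap, psVal_psMk]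
  by_cases hτ : ((y, τ) : lineProd X) ∈ O
  · rw [hr _ hxV' hτ, gm_res _ _ (show ((y, τ) : lineProd X) ∈ (Opens.map (lineProj X)).obj V' from hxV')]
    exact h1 τ ⟨hτ.1.le, hτ.2.le⟩
  · rw [hr' _ hτ, map_zero]
    refine (hwR τ ?_).symm
    by_contra! h
    exact hτ (abs_lt.1 h)

/-- Exactness of the direct image with proper supports along `X × ℝ → X`. -/
lemma exact_stmap_lineProj {A B C : Shv k (lineProd X)} {α : A ⟶ B} {β : B ⟶ C}
    {W : Set (lineProd X)} (hA : CSoft A) (hα : KerExtends α) (hα' : KerExtendsPair α W)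
    (hW : ∀ x : X, Bornology.IsBounded {τ : ℝ | ((x, τ) : lineProd X) ∈ W})
    (h : ∀ z, Function.Exact (stmap α z) (stmap β z)) (x : X) :
    Function.Exact (stmap ((properPushforward k (lineProj X)).map α) x)
      (stmap ((properPushforward k (lineProj X)).map β) x) := by
  intro e
  constructor
  · intro he
    obtain ⟨V, hV, s, rfl⟩ := exists_gm e
    rw [← gm_smap, gm_eq_zero_iff_psVal hV] at he
    refine exists_lift_lineProj hA hα hα' (hW x) hV s fun τ ↦ ?_
    have h1 := he ((x, τ) : lineProd X) rfl
    rw [gm_psVal_smap] at h1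
    exact (h _ _).1 h1
  · rintro ⟨e, rfl⟩
    have h0 : α ≫ β = 0 := hom_ext_stmap fun z ↦ by
      rw [stmap_comp, stmap_zero]
      exact LinearMap.ext fun v ↦ (h z).apply_apply_eq_zero v
    rw [← LinearMap.comp_apply, ← stmap_comp, ← Functor.map_comp, h0, Functor.map_zero, stmap_zero,
      LinearMap.zero_apply]

variable {B C : Shv k (lineProd X)} {β : B ⟶ C} {h : sec B ⊤} {a b : X → ℝ}

lemma IsKerSection.hasProperSupport (ha : Continuous a) (hb : Continuous b)
    (hh : IsKerSection β h {z | a z.1 ≤ z.2 ∧ z.2 ≤ b z.1}) :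
    HasProperSupport (lineProj X) B (U := ⊤) h := by
  refine hasProperSupport_of_compact fun y _ ↦ ?_
  obtain ⟨N, hN, hyN⟩ := exists_compact_mem_nhds y
  obtain ⟨R, hR⟩ := (hN.image ha).isBounded.bddBelow
  obtain ⟨R', hR'⟩ := (hN.image hb).isBounded.bddAbove
  refine ⟨N, hyN, N ×ˢ Set.Icc R R', hN.prod isCompact_Icc, fun z hz hz' ↦ ⟨hz, ?_⟩⟩
  have h1 := (hh.gm_ne_zero_iff z).1 hz'
  exact ⟨(hR ⟨z.1, hz, rfl⟩).trans h1.1, h1.2.trans (hR' ⟨z.1, hz, rfl⟩)⟩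

/-- On a fibre, a section of the kernel is a locally constant multiple of `h` over the interval and
zero outside. The interval is connected, so the multiple is constant; over an empty interval, both
sections vanish. -/
lemma IsKerSection.lineProj (ha : Continuous a) (hb : Continuous b)
    (hh : IsKerSection β h {z | a z.1 ≤ z.2 ∧ z.2 ≤ b z.1}) :
    IsKerSection ((properPushforward k (lineProj X)).map β)
      (psMk (f := SheafConvolution.lineProj X) (U := ⊤) h (hh.hasProperSupport ha hb))
        {x | a x ≤ b x} := by
  have htop : ∀ x : X, x ∈ (⊤ : Opens X) := fun _ ↦ trivial
  refine ⟨fun x ↦ ?_, fun x e he ↦ ?_, fun x ↦ ?_⟩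
  · rw [← gm_smap]
    refine (gm_eq_zero_iff_psVal (htop x) _).2 fun z _ ↦ ?_
    rw [gm_psVal_smap]
    exact hh.stmap_gm z
  · obtain ⟨V, hV, s, rfl⟩ := exists_gm e
    rw [← gm_smap, gm_eq_zero_iff_psVal hV] at he
    have he' : ∀ τ : ℝ, stmap β _ (gm (psVal s) ((x, τ) : lineProd X)) = 0 := fun τ ↦ by
      rw [← gm_psVal_smap]
      exact he _ rfl
    -- The coefficient is read off at the left end; when the interval is empty its value does not
    -- matter.
    obtain ⟨c, hc⟩ := hh.exists_smul _ _ (he' (a x))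
    refine ⟨c, ?_⟩
    have key : ∀ τ : ℝ, gm (psVal s) ((x, τ) : lineProd X) = c • gm h ((x, τ) : lineProd X) := by
      intro τ
      by_cases hτ : a x ≤ τ ∧ τ ≤ b x
      · let u : k → Set ℝ := fun c' ↦
          {τ | gm (psVal s) ((x, τ) : lineProd X) = c' • gm h ((x, τ) : lineProd X)}
        have hu : ∀ c', IsOpen (u c') := by
          intro c'
          have h2 := (isOpen_setOf_gm_eq (psVal s) (c' • h)).preimage
            (show Continuous fun τ : ℝ ↦ ((x, τ) : X × ℝ) by fun_prop)
          convert h2 using 1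
          ext τ
          change _ ↔ _ ∧ _ ∧ _ = gm (c' • h) _
          rw [gm_smul]
          exact ⟨fun h ↦ ⟨hV, trivial, h⟩, fun h ↦ h.2.2⟩
        have hne : ∀ τ ∈ Set.Icc (a x) (b x), ∀ c', τ ∈ u c → τ ∈ u c' → c' = c := by
          intro τ hτ c' h1 h2
          have h3 := (h1 : _ = _).symm.trans h2
          exact (smul_left_injective k ((hh.gm_ne_zero_iff _).2 hτ) h3).symm
        rcases isPreconnected_iff_subset_of_disjoint.1 isPreconnected_Icc (u c)
          (⋃ c' : {c' // c' ≠ c}, u c') (hu c) (isOpen_iUnion fun c' ↦ hu c')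
          (fun τ _ ↦ by
            obtain ⟨c', hc'⟩ := hh.exists_smul _ _ (he' τ)
            by_cases h : c' = c
            · exact Or.inl (h ▸ hc')
            · exact Or.inr (Set.mem_iUnion.2 ⟨⟨c', h⟩, hc'⟩))
          (Set.eq_empty_of_forall_notMem fun τ hτ ↦ by
            obtain ⟨c', hc'⟩ := Set.mem_iUnion.1 hτ.2.2
            exact c'.2 (hne τ hτ.1 c' hτ.2.1 hc')) with h1 | h1
        · exact h1 hτ
        · have hax : a x ∈ Set.Icc (a x) (b x) := ⟨le_rfl, hτ.1.trans hτ.2⟩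
          obtain ⟨c', hc'⟩ := Set.mem_iUnion.1 (h1 hax)
          exact (c'.2 (hne _ hax c' hc hc')).elim
      · rw [hh.eq_zero hτ (he' τ), not_not.1 (fun h0 ↦ hτ ((hh.gm_ne_zero_iff _).1 h0)), smul_zero]
    rw [← gm_smul, gm_eq_iff_psVal hV (htop x)]
    rintro ⟨y, τ⟩ hz
    have hy : y = x := hz
    subst hy
    rw [map_smul]
    exact (key τ).trans (gm_smul _ _ _).symm
  · rw [ne_eq, gm_eq_zero_iff_psVal (htop x)]
    constructor
    · intro h1
      by_contra h2
      refine h1 ?_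
      rintro ⟨y, τ⟩ hz
      have hy : y = x := hz
      subst hy
      by_contra h3
      have h4 := (hh.gm_ne_zero_iff _).1 h3
      exact h2 (h4.1.trans h4.2)
    · intro h1 h2
      exact (hh.gm_ne_zero_iff ((x, a x) : lineProd X)).2 ⟨le_rfl, h1⟩ (h2 _ rfl)

end LinePushforward

end SheafConvolution

end

noncomputable section

namespace SheafConvolution

/-! ### Resolutions of constant sheaves on closed sets -/

section Resolution

open HomologicalComplex

variable {k : Type u} [Field k] {X : TopCat.{u}}

lemma exactAt_iff_stmap (K : CochainComplex (Shv k X) ℤ) (i j l : ℤ) (hi : i + 1 = j)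
    (hl : j + 1 = l) :
    K.ExactAt j ↔ ∀ x, Function.Exact (stmap (K.d i j) x) (stmap (K.d j l) x) := by
  rw [K.exactAt_iff' i j l (by simp [← hi]) (by simp [← hl]), exact_iff_stmap]
  rfl

lemma quasiIso_iff_of_isZero_of_ne_zero {C : Type*} [Category* C] [Abelian C]
    {D K : CochainComplex C ℤ} [K.IsStrictlyGE 0] (hD : ∀ n ≠ 0, IsZero (D.X n)) (φ : D ⟶ K) :
    QuasiIso φ ↔ (∀ n ≠ 0, K.ExactAt n) ∧ ∃ w : φ.f 0 ≫ K.d 0 1 = 0,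
      (ShortComplex.mk (φ.f 0) (K.d 0 1) w).Exact ∧ Mono (φ.f 0) := by
  have hw : φ.f 0 ≫ K.d 0 1 = 0 := by
    rw [φ.comm, (hD 1 (by decide)).eq_of_tgt (D.d 0 1) 0, zero_comp]
  have h0 : QuasiIsoAt φ 0 ↔ ∃ w : φ.f 0 ≫ K.d 0 1 = 0,
      (ShortComplex.mk (φ.f 0) (K.d 0 1) w).Exact ∧ Mono (φ.f 0) := by
    rw [quasiIsoAt_iff' φ (-1) 0 1 (by simp) (by simp)]
    have h1 := ShortComplex.quasiIso_iff_of_zeros ((shortComplexFunctor' C _ (-1) 0 1).map φ)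
      ((hD (-1) (by decide)).eq_of_src _ _) ((hD 1 (by decide)).eq_of_tgt _ _)
      ((K.isZero_of_isStrictlyGE 0 (-1)).eq_of_src _ _)
    exact h1.trans ⟨fun h ↦ ⟨hw, h⟩, fun ⟨_, h⟩ ↦ h⟩
  have h1 : ∀ n ≠ 0, (QuasiIsoAt φ n ↔ K.ExactAt n) := fun n hn ↦
    quasiIsoAt_iff_exactAt φ n (by
      rw [exactAt_iff]
      exact ShortComplex.exact_of_isZero_X₂ _ (hD n hn))
  rw [quasiIso_iff, ← h0]
  constructor
  · exact fun h ↦ ⟨fun n hn ↦ (h1 n hn).1 (h n), h 0⟩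
  · rintro ⟨h2, h3⟩ n
    by_cases hn : n = 0
    · exact hn ▸ h3
    · exact (h1 n hn).2 (h2 n hn)

lemma quasiIso_iff_of_isZero {D K : CochainComplex (Shv k X) ℤ} [K.IsStrictlyGE 0]
    (hD : ∀ n ≠ 0, IsZero (D.X n)) (φ : D ⟶ K) :
    QuasiIso φ ↔ (∀ n ≠ 0, K.ExactAt n) ∧
      (∀ x, Function.Exact (stmap (φ.f 0) x) (stmap (K.d 0 1) x)) ∧
      ∀ x, Function.Injective (stmap (φ.f 0) x) := by
  rw [quasiIso_iff_of_isZero_of_ne_zero hD φ]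
  refine and_congr_right fun _ ↦ ?_
  constructor
  · rintro ⟨w, h1, h2⟩
    exact ⟨(exact_iff_stmap _).1 h1, (mono_iff_stmap _).1 h2⟩
  · rintro ⟨h1, h2⟩
    have hw : φ.f 0 ≫ K.d 0 1 = 0 := hom_ext_stmap fun x ↦ by
      rw [stmap_comp, stmap_zero]
      exact LinearMap.ext fun v ↦ (h1 x).apply_apply_eq_zero v
    exact ⟨hw, (exact_iff_stmap (ShortComplex.mk (φ.f 0) (K.d 0 1) hw)).2 h1,
      (mono_iff_stmap _).2 h2⟩

lemma IsCharSection.of_isIso {F G : Shv k X} (φ : F ⟶ G) [IsIso φ] {h : sec F ⊤} {W : Set X}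
    (hh : IsCharSection h W) : IsCharSection (smap φ ⊤ h) W := by
  have h1 : ∀ x, Function.Bijective (stmap φ x) := fun x ↦
    ConcreteCategory.bijective_of_isIso ((stalkAt k x).map φ)
  refine ⟨fun x e ↦ ?_, fun x ↦ ?_⟩
  · obtain ⟨e, rfl⟩ := (h1 x).surjective e
    obtain ⟨c, rfl⟩ := hh.exists_smul x e
    exact ⟨c, by rw [gm_smap, map_smul]⟩
  · rw [gm_smap, ← hh.gm_ne_zero_iff, ne_eq, ne_eq, map_eq_zero_iff _ (h1 x).injective]

lemma IsCharSection.isKerSection {D K : CochainComplex (Shv k X) ℤ} [K.IsStrictlyGE 0]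
    (hD : ∀ n ≠ 0, IsZero (D.X n)) (φ : D ⟶ K) [hφ : QuasiIso φ] {g : sec (D.X 0) ⊤} {W : Set X}
    (hg : IsCharSection g W) : IsKerSection (K.d 0 1) (smap (φ.f 0) ⊤ g) W := by
  obtain ⟨-, h1, h2⟩ := (quasiIso_iff_of_isZero hD φ).1 hφ
  refine ⟨fun x ↦ ?_, fun x e he ↦ ?_, fun x ↦ ?_⟩
  · rw [gm_smap, (h1 x).apply_apply_eq_zero]
  · obtain ⟨e, rfl⟩ := (h1 x e).1 he
    obtain ⟨c, rfl⟩ := hg.exists_smul x e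
    exact ⟨c, by rw [gm_smap, map_smul]⟩
  · rw [gm_smap, ← hg.gm_ne_zero_iff, ne_eq, ne_eq, map_eq_zero_iff _ (h2 x)]

/-- The sheaf `F` and the kernel in degree 0 have generating sections with the same nonvanishing set
`W`; sending `g` to `h` identifies `F` with this kernel. -/
lemma exists_quasiIso_singlePlus {K : CochainComplex.Plus (Shv k X)} (hK : K.obj.IsStrictlyGE 0)
    (hex : ∀ n ≠ 0, K.obj.ExactAt n) {h : sec (K.obj.X 0) ⊤} {W : Set X}
    (hh : IsKerSection (K.obj.d 0 1) h W) {F : Shv k X} {g : sec F ⊤} (hg : IsCharSection g W) :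
    ∃ φ : singlePlus F ⟶ K, QuasiIso φ.hom := by
  obtain ⟨Φ, hΦ⟩ := hg.exists_hom h fun x hx ↦ not_not.1 fun h0 ↦ hx ((hh.gm_ne_zero_iff x).1 h0)
  have h1 : Φ ≫ K.obj.d 0 1 = 0 := by
    refine hom_ext_stmap fun x ↦ LinearMap.ext fun e ↦ ?_
    obtain ⟨c, rfl⟩ := hg.exists_smul x e
    rw [stmap_comp, LinearMap.comp_apply, map_smul, hΦ, map_smul, hh.stmap_gm, smul_zero,
      stmap_zero, LinearMap.zero_apply]
  let ψ : (HomologicalComplex.single (Shv k X) (ComplexShape.up ℤ) 0).obj F ⟶ K.obj :=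
    mkHomFromSingle Φ (fun n hn ↦ by
      obtain rfl : 1 = n := by simpa using hn
      exact h1)
  refine ⟨ObjectProperty.homMk ψ, ?_⟩
  refine (quasiIso_iff_of_isZero (k := k) (X := X) (D := (HomologicalComplex.single (Shv k X)
    (ComplexShape.up ℤ) 0).obj F) (fun n hn ↦ isZero_single_obj_X _ _ _ _ hn) ψ).2 ?_
  have hψ : ψ.f 0 = (singleObjXSelf (ComplexShape.up ℤ) 0 F).hom ≫ Φ := mkHomFromSingle_f _ _
  have hb : ∀ x, Function.Bijective (stmap (singleObjXSelf (ComplexShape.up ℤ) 0 F).hom x) :=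
    fun x ↦ ConcreteCategory.bijective_of_isIso
      ((stalkAt k x).map (singleObjXSelf (ComplexShape.up ℤ) 0 F).hom)
  refine ⟨hex, fun x e ↦ ⟨fun he ↦ ?_, ?_⟩, fun x ↦ ?_⟩
  · obtain ⟨c, rfl⟩ := hh.exists_smul x e he
    obtain ⟨e', he'⟩ := (hb x).surjective (c • gm g x)
    refine ⟨e', ?_⟩
    rw [hψ, stmap_comp, LinearMap.comp_apply, he', map_smul, hΦ]
  · rintro ⟨e, rfl⟩
    rw [hψ, stmap_comp, LinearMap.comp_apply, ← LinearMap.comp_apply, ← stmap_comp, h1, stmap_zero,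
      LinearMap.zero_apply]
  · rw [hψ, stmap_comp, LinearMap.coe_comp]
    refine Function.Injective.comp ?_ (hb x).injective
    rw [injective_iff_map_eq_zero]
    intro e he
    obtain ⟨c, rfl⟩ := hg.exists_smul x e
    rw [map_smul, hΦ] at he
    by_cases hx : x ∈ W
    · rw [(smul_eq_zero.1 he).resolve_right ((hh.gm_ne_zero_iff x).2 hx), zero_smul]
    · rw [not_not.1 fun h0 ↦ hx ((hg.gm_ne_zero_iff x).1 h0), smul_zero]

/-- The direct image with proper supports along `X × ℝ → X` of a c-soft resolution of the constant
sheaf on a closed set whose fibres are compact intervals. -/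
lemma exists_quasiIso_lineProj [T2Space X] [LocallyCompactSpace X]
    {E : CochainComplex.Plus (Shv k (lineProd X))} (hE : E.obj.IsStrictlyGE 0)
    (hs : ∀ i, CSoft (E.obj.X i)) (hex : ∀ n ≠ 0, E.obj.ExactAt n) {h : sec (E.obj.X 0) ⊤}
    {a b : X → ℝ} (ha : Continuous a) (hb : Continuous b)
    (hh : IsKerSection (E.obj.d 0 1) h {z | a z.1 ≤ z.2 ∧ z.2 ≤ b z.1}) {F : Shv k X}
    {g : sec F ⊤} (hg : IsCharSection g {x | a x ≤ b x}) :
    ∃ φ : singlePlus F ⟶ (properPushforward k (lineProj X)).mapCochainComplexPlus.obj E,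
      QuasiIso φ.hom := by
  have hE' : ((properPushforward k (lineProj X)).mapCochainComplexPlus.obj E).obj.IsStrictlyGE 0 :=
    inferInstanceAs (CochainComplex.IsStrictlyGE
      (((properPushforward k (lineProj X)).mapHomologicalComplex _).obj E.obj) 0)
  refine exists_quasiIso_singlePlus hE' (fun n hn ↦ ?_) (hh.lineProj ha hb) hg
  rcases lt_or_gt_of_ne hn with hn | hn
  · rw [exactAt_iff]
    exact ShortComplex.exact_of_isZero_X₂ _ (@CochainComplex.isZero_of_isStrictlyGE _ _ _
      ((properPushforward k (lineProj X)).mapCochainComplexPlus.obj E).obj 0 n hn hE')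
  · obtain ⟨m, rfl⟩ : ∃ m : ℕ, n = m + 1 := ⟨(n - 1).toNat, by lia⟩
    rw [exactAt_iff_stmap _ (m : ℤ) _ _ rfl rfl]
    have h1 := (exactAt_iff_stmap E.obj (m : ℤ) _ _ rfl rfl).1 (hex _ hn.ne')
    -- In degree 0 the kernel is governed by `h`; in higher degrees it is the image of the preceding
    -- c-soft term.
    have h2 : KerExtends (E.obj.d (m : ℤ) (m + 1)) ∧ KerExtendsPair (E.obj.d (m : ℤ) (m + 1))
        {z : lineProd X | a z.1 ≤ z.2 ∧ z.2 ≤ b z.1} := by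
      cases m with
      | zero => exact ⟨hh.kerExtends, hh.kerExtendsPair⟩
      | succ m =>
        have h3 := (exactAt_iff_stmap E.obj (m : ℤ) ((m : ℤ) + 1) _ rfl rfl).1 (hex _ (by lia))
        rw [Nat.cast_add, Nat.cast_one]
        exact ⟨KerExtends.of_exact (hs _) h3, KerExtendsPair.of_exact (hs _) h3 _⟩
    exact exact_stmap_lineProj (hs _) h2.1 h2.2
      (fun x ↦ (Metric.isBounded_Icc (a x) (b x)).subset fun τ hτ ↦ hτ) h1

end Resolution

end SheafConvolution

end

noncomputable section

namespace SheafConvolution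

/-! ### The generating function of the fibrewise sum -/

section GeneratingFunctionSum

variable {n : ℕ} {M : Type u} [TopologicalSpace M] [ChartedSpace (EuclideanSpace ℝ (Fin n)) M]

lemma fderiv_add_eq_zero_iff {E E₁ E₂ : Type*} [NormedAddCommGroup E] [NormedSpace ℝ E]
    [NormedAddCommGroup E₁] [NormedSpace ℝ E₁] [NormedAddCommGroup E₂] [NormedSpace ℝ E₂]
    (e : E ≃L[ℝ] E₁ × E₂) {f₁ : E₁ → ℝ} {f₂ : E₂ → ℝ} (h₁ : Differentiable ℝ f₁)
    (h₂ : Differentiable ℝ f₂) (ξ : E) :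
    fderiv ℝ (fun η ↦ f₁ (e η).1 + f₂ (e η).2) ξ = 0 ↔
      fderiv ℝ f₁ (e ξ).1 = 0 ∧ fderiv ℝ f₂ (e ξ).2 = 0 := by
  have he := e.hasFDerivAt (x := ξ)
  have h : HasFDerivAt (fun η ↦ f₁ (e η).1 + f₂ (e η).2)
      ((fderiv ℝ f₁ (e ξ).1).comp ((ContinuousLinearMap.fst ℝ E₁ E₂).comp (e : E →L[ℝ] E₁ × E₂)) +
      (fderiv ℝ f₂ (e ξ).2).comp ((ContinuousLinearMap.snd ℝ E₁ E₂).comp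
        (e : E →L[ℝ] E₁ × E₂))) ξ :=
    ((h₁ _).hasFDerivAt.comp ξ he.fst).add ((h₂ _).hasFDerivAt.comp ξ he.snd)
  rw [h.fderiv]
  constructor
  · intro h0
    constructor
    · ext v
      have := DFunLike.congr_fun h0 (e.symm (v, 0))
      simpa using this
    · ext v
      have := DFunLike.congr_fun h0 (e.symm (0, v))
      simpa using this
  · rintro ⟨h1, h2⟩
    rw [h1, h2]
    simp

lemma contDiff_fst_comp {E E₁ E₂ : Type*} [NormedAddCommGroup E] [NormedSpace ℝ E]
    [NormedAddCommGroup E₁] [NormedSpace ℝ E₁] [NormedAddCommGroup E₂] [NormedSpace ℝ E₂]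
    (e : E ≃L[ℝ] E₁ × E₂) : ContDiff ℝ ∞ fun ξ ↦ (e ξ).1 :=
  contDiff_fst.comp e.contDiff

lemma contDiff_snd_comp {E E₁ E₂ : Type*} [NormedAddCommGroup E] [NormedSpace ℝ E]
    [NormedAddCommGroup E₁] [NormedSpace ℝ E₁] [NormedAddCommGroup E₂] [NormedSpace ℝ E₂]
    (e : E ≃L[ℝ] E₁ × E₂) : ContDiff ℝ ∞ fun ξ ↦ (e ξ).2 :=
  contDiff_snd.comp e.contDiff

variable {N : ℕ} {S : M × EuclideanSpace ℝ (Fin N) → ℝ}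

lemma differentiable_of_contMDiff
    (hS : ContMDiff ((𝓡 n).prod (𝓡 N)) 𝓘(ℝ, ℝ) ∞ S) (m : M) :
    Differentiable ℝ fun η ↦ S (m, η) := by
  have h : ContMDiff (𝓡 N) 𝓘(ℝ, ℝ) ∞ fun η ↦ S (m, η) :=
    hS.comp (contMDiff_const.prodMk contMDiff_id)
  exact (contMDiff_iff_contDiff.1 h).differentiable (by simp)

lemma mdifferentiableAt_of_contMDiff
    (hS : ContMDiff ((𝓡 n).prod (𝓡 N)) 𝓘(ℝ, ℝ) ∞ S) (ξ : EuclideanSpace ℝ (Fin N)) (m : M) :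
    MDifferentiableAt (𝓡 n) 𝓘(ℝ, ℝ) (fun m ↦ S (m, ξ)) m := by
  have h : ContMDiff (𝓡 n) 𝓘(ℝ, ℝ) ∞ fun m ↦ S (m, ξ) :=
    hS.comp (contMDiff_id.prodMk contMDiff_const)
  exact (h m).mdifferentiableAt (by simp)

/-- The variables ξ₁ and ξ₂ are independent, so the fibre derivative of the sum vanishes exactly
when both fibre derivatives do; the base derivatives add. -/
lemma IsGeneratingFunction.fiberSum {l₁ l₂ : ℕ} {S₁ : M × EuclideanSpace ℝ (Fin l₁) → ℝ}
    {S₂ : M × EuclideanSpace ℝ (Fin l₂) → ℝ} {L₁ L₂ : Set (Cotangent n M)}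
    (h₁ : IsGeneratingFunction S₁ L₁) (h₂ : IsGeneratingFunction S₂ L₂) :
    IsGeneratingFunction (fiberSumFunction S₁ S₂) (fiberwiseSum L₁ L₂) := by
  have hbase : ∀ m ξ, baseDeriv (n := n) (fiberSumFunction S₁ S₂) m ξ =
      baseDeriv S₁ m (EuclideanSpace.finAddEquivProd ξ).1 +
        baseDeriv S₂ m (EuclideanSpace.finAddEquivProd ξ).2 := fun m ξ ↦
    mfderiv_add (mdifferentiableAt_of_contMDiff h₁.smooth (EuclideanSpace.finAddEquivProd ξ).1 m)
      (mdifferentiableAt_of_contMDiff h₂.smooth (EuclideanSpace.finAddEquivProd ξ).2 m)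
  have hfib : ∀ m ξ, fderiv ℝ (fun η ↦ fiberSumFunction S₁ S₂ (m, η)) ξ = 0 ↔ _ := fun m ξ ↦
    fderiv_add_eq_zero_iff EuclideanSpace.finAddEquivProd
      (differentiable_of_contMDiff h₁.smooth m)
      (differentiable_of_contMDiff h₂.smooth m) ξ
  refine ⟨?_, ?_⟩
  · have h1 : ContDiff ℝ ∞ fun ξ : EuclideanSpace ℝ (Fin (l₁ + l₂)) ↦
        (EuclideanSpace.finAddEquivProd ξ).1 :=
      contDiff_fst_comp EuclideanSpace.finAddEquivProd
    have h2 : ContDiff ℝ ∞ fun ξ : EuclideanSpace ℝ (Fin (l₁ + l₂)) ↦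
        (EuclideanSpace.finAddEquivProd ξ).2 :=
      contDiff_snd_comp EuclideanSpace.finAddEquivProd
    exact (h₁.smooth.comp (contMDiff_fst.prodMk (h1.contMDiff.comp contMDiff_snd))).add
      (h₂.smooth.comp (contMDiff_fst.prodMk (h2.contMDiff.comp contMDiff_snd)))
  · ext ⟨m, p⟩
    rw [h₁.eq, h₂.eq]
    constructor
    · rintro ⟨p₁, p₂, ⟨ξ₁, h1, h1'⟩, ⟨ξ₂, h2, h2'⟩, hp⟩
      refine ⟨EuclideanSpace.finAddEquivProd.symm (ξ₁, ξ₂), ?_, ?_⟩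
      · rw [hfib]
        simpa using ⟨h1, h2⟩
      · rw [hbase, ContinuousLinearEquiv.apply_symm_apply]
        exact hp.trans (congrArg₂ _ h1' h2')
    · rintro ⟨ξ, h1, h2⟩
      rw [hfib] at h1
      rw [hbase] at h2
      exact ⟨baseDeriv S₁ m _, baseDeriv S₂ m _, ⟨_, h1.1, rfl⟩, ⟨_, h1.2, rfl⟩, h2⟩

end GeneratingFunctionSum

end SheafConvolution

end

noncomputable section

namespace SheafConvolution

/-! ### Injective resolutions and external tensor products of resolutions -/

section ConvolutionIso

open HomologicalComplex Topology

variable {k : Type u} [Field k]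

/-- An isomorphism of composite functors, applied degreewise to bounded below complexes. -/
def mapPlusIso {C D D' E : Type*} [Category* C] [Category* D] [Category* D'] [Category* E]
    [Preadditive C] [Preadditive D] [Preadditive D'] [Preadditive E]
    {F : C ⥤ D} {G : D ⥤ E} {F' : C ⥤ D'} {G' : D' ⥤ E} [F.Additive] [G.Additive]
    [F'.Additive] [G'.Additive] (e : F ⋙ G ≅ F' ⋙ G') (K : CochainComplex.Plus C) :
    G.mapCochainComplexPlus.obj (F.mapCochainComplexPlus.obj K) ≅
      G'.mapCochainComplexPlus.obj (F'.mapCochainComplexPlus.obj K) :=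
  ObjectProperty.isoMk _ (HomologicalComplex.Hom.isoOfComponents (fun n ↦ e.app (K.obj.X n))
    (fun i j _ ↦ (e.hom.naturality (K.obj.d i j)).symm))

lemma exists_injective_resolution {X : TopCat.{u}} (F : Shv k X) :
    ∃ (I : CochainComplex.Plus (Shv k X)) (φ : singlePlus F ⟶ I),
      (∀ n, Injective (I.obj.X n)) ∧ QuasiIso φ.hom ∧ I.obj.IsStrictlyGE 0 := by
  have h0 : (singlePlus F).obj.IsStrictlyGE 0 := inferInstanceAs
    (((CochainComplex.singleFunctor (Shv k X) 0).obj F).IsStrictlyGE 0)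
  obtain ⟨J, hJ, b, hb⟩ := CochainComplex.Plus.exists_quasiIso_injective
    (singlePlus (k := k) (X := X) F) 0
  have hJ' : J.obj.IsStrictlyGE 0 := hJ
  exact ⟨(InjectiveObject.ι (Shv k X)).mapCochainComplexPlus.obj J, b,
    fun n ↦ inferInstanceAs (Injective (J.obj.X n).obj), hb,
    inferInstanceAs (CochainComplex.IsStrictlyGE
      (((InjectiveObject.ι (Shv k X)).mapHomologicalComplex _).obj J.obj) 0)⟩

variable {X₁ X₂ Z : TopCat.{u}} (q₁ : Z ⟶ X₁) (q₂ : Z ⟶ X₂)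

lemma isZero_totTensor {K L : CochainComplex.Plus (Shv k Z)} {n : ℤ}
    (h : ∀ i j, i + j = n → IsZero (K.obj.X i) ∨ IsZero (L.obj.X j)) :
    IsZero ((totTensor k Z K L).obj.X n) := by
  rw [IsZero.iff_id_eq_zero]
  refine mapBifunctor.hom_ext fun i j hij ↦ IsZero.eq_of_src ?_ _ _
  rcases h i j hij with h | h
  · exact ((tensor k Z).map_isZero h).obj _
  · exact ((tensor k Z).obj _).map_isZero h

lemma isStrictlyGE_totTensor {K L : CochainComplex.Plus (Shv k Z)} (hK : K.obj.IsStrictlyGE 0)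
    (hL : L.obj.IsStrictlyGE 0) : (totTensor k Z K L).obj.IsStrictlyGE 0 := by
  rw [CochainComplex.isStrictlyGE_iff]
  refine fun n hn ↦ isZero_totTensor fun i j hij ↦ ?_
  by_cases hi : i < 0
  · exact Or.inl (K.obj.isZero_of_isStrictlyGE 0 i hi)
  · exact Or.inr (L.obj.isZero_of_isStrictlyGE 0 j (by lia))

lemma isZero_pullback_singlePlus {X Y : TopCat.{u}} (f : X ⟶ Y) (F : Shv k Y) {n : ℤ}
    (hn : n ≠ 0) : IsZero (((pullback k f).mapCochainComplexPlus.obj (singlePlus F)).obj.X n) :=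
  (pullback k f).map_isZero (isZero_single_obj_X _ _ _ _ hn)

/-- In total degree 0 the vanishing of the first factor in nonzero degrees leaves only the summand
(0, 0). -/
lemma isIso_totι_zero {K L : CochainComplex.Plus (Shv k Z)} (hK : ∀ n ≠ 0, IsZero (K.obj.X n)) :
    IsIso (totι K.obj L.obj (tensor k Z) 0 0 0 (add_zero 0)) := by
  refine ⟨totπ K.obj L.obj (tensor k Z) 0 0 0 (add_zero 0), totι_totπ_self _ _ _ _ _ _ _, ?_⟩
  refine mapBifunctor.hom_ext fun i j (hij : i + j = 0) ↦ ?_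
  by_cases hi : i = 0
  · subst hi
    obtain rfl : j = 0 := by lia
    refine (Category.assoc _ _ _).symm.trans ((eq_whisker (totι_totπ_self _ _ _ _ _ _ _) _).trans ?_)
    exact (Category.id_comp _).trans (Category.comp_id _).symm
  · exact (((tensor k Z).map_isZero (hK i hi)).obj _).eq_of_src _ _

lemma exists_isCharSection_totTensor {F₁ : Shv k X₁} {F₂ : Shv k X₂} {g₁ : sec F₁ ⊤}
    {g₂ : sec F₂ ⊤} {W₁ : Set X₁} {W₂ : Set X₂} (h₁ : IsCharSection g₁ W₁)
    (h₂ : IsCharSection g₂ W₂) :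
    ∃ g : sec ((totTensor k Z ((pullback k q₁).mapCochainComplexPlus.obj (singlePlus F₁))
      ((pullback k q₂).mapCochainComplexPlus.obj (singlePlus F₂))).obj.X 0) ⊤,
      IsCharSection g {z | q₁ z ∈ W₁ ∧ q₂ z ∈ W₂} := by
  have h3 := h₁.of_isIso (singleObjXSelf (ComplexShape.up ℤ) 0 F₁).inv
  have h4 := h₂.of_isIso (singleObjXSelf (ComplexShape.up ℤ) 0 F₂).inv
  obtain ⟨g, hg⟩ := h3.box q₁ q₂ h4
  have := isIso_totι_zero (k := k) (Z := Z)
    (K := (pullback k q₁).mapCochainComplexPlus.obj (singlePlus F₁))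
    (L := (pullback k q₂).mapCochainComplexPlus.obj (singlePlus F₂))
    fun n hn ↦ isZero_pullback_singlePlus q₁ F₁ hn
  exact ⟨_, @IsCharSection.of_isIso _ _ _ _ _ _ this _ _ hg⟩

/-- The external tensor product of resolutions of two sheaves is a resolution of the external
tensor product of the sheaves. -/
lemma exists_isKerSection_totTensor {F₁ : Shv k X₁} {F₂ : Shv k X₂} {g₁ : sec F₁ ⊤}
    {g₂ : sec F₂ ⊤} {W₁ : Set X₁} {W₂ : Set X₂} (h₁ : IsCharSection g₁ W₁)
    (h₂ : IsCharSection g₂ W₂) {A₁ : CochainComplex.Plus (Shv k X₁)}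
    {A₂ : CochainComplex.Plus (Shv k X₂)} (φ₁ : singlePlus F₁ ⟶ A₁) (φ₂ : singlePlus F₂ ⟶ A₂)
    [QuasiIso φ₁.hom] [QuasiIso φ₂.hom]
    (hE : (totTensor k Z ((pullback k q₁).mapCochainComplexPlus.obj A₁)
      ((pullback k q₂).mapCochainComplexPlus.obj A₂)).obj.IsStrictlyGE 0) :
    (∀ n ≠ 0, (totTensor k Z ((pullback k q₁).mapCochainComplexPlus.obj A₁)
      ((pullback k q₂).mapCochainComplexPlus.obj A₂)).obj.ExactAt n) ∧
    ∃ h, IsKerSection ((totTensor k Z ((pullback k q₁).mapCochainComplexPlus.obj A₁)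
      ((pullback k q₂).mapCochainComplexPlus.obj A₂)).obj.d 0 1) h
        {z | q₁ z ∈ W₁ ∧ q₂ z ∈ W₂} := by
  have hq1 := quasiIso_map_pullback q₁ φ₁
  have hq2 := quasiIso_map_pullback q₂ φ₂
  have hφ := quasiIso_totTensorMap (k := k) (X := Z) ((pullback k q₁).mapCochainComplexPlus.map φ₁)
    ((pullback k q₂).mapCochainComplexPlus.map φ₂)
  have hD : ∀ n ≠ 0, IsZero ((totTensor k Z
      ((pullback k q₁).mapCochainComplexPlus.obj (singlePlus F₁))
      ((pullback k q₂).mapCochainComplexPlus.obj (singlePlus F₂))).obj.X n) := by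
    refine fun n hn ↦ isZero_totTensor fun i j hij ↦ ?_
    by_cases hi : i = 0
    · exact Or.inr (isZero_pullback_singlePlus q₂ F₂ (by lia))
    · exact Or.inl (isZero_pullback_singlePlus q₁ F₁ hi)
  obtain ⟨g, hg⟩ := exists_isCharSection_totTensor q₁ q₂ h₁ h₂
  exact ⟨((quasiIso_iff_of_isZero (k := k) (X := Z) hD _).1 hφ).1, _,
    hg.isKerSection hD _ (hφ := hφ)⟩

end ConvolutionIso

end SheafConvolution

end

noncomputable section

namespace SheafConvolution

/-! ### The convolution of canonical sheaves -/

section ConvolutionOfCanonicalSheaves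

open HomologicalComplex Topology

variable (k : Type u) [Field k] {M : Type u} [TopologicalSpace M]

variable (M) in
/-- The space `(M × ℝ^(l₁ + l₂) × ℝ) × ℝ`, whose points `((m, ξ, t), t₁)` parametrize the pairs of
points `(m, ξ₁, t₁)` and `(m, ξ₂, t - t₁)` over the same point of `M`. -/
abbrev fiberPairs (l₁ l₂ : ℕ) : TopCat.{u} :=
  lineProd (TopCat.of (M × EuclideanSpace ℝ (Fin (l₁ + l₂)) × ℝ))

variable (M) in
/-- `((m, ξ, t), t₁) ↦ (m, ξ₁, t₁)`. -/
def pairFst (l₁ l₂ : ℕ) :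
    fiberPairs M l₁ l₂ ⟶ TopCat.of (M × EuclideanSpace ℝ (Fin l₁) × ℝ) :=
  TopCat.ofHom ⟨fun z ↦ (z.1.1, (EuclideanSpace.finAddEquivProd z.1.2.1).1, z.2), by fun_prop⟩

variable (M) in
/-- `((m, ξ, t), t₁) ↦ (m, ξ₂, t - t₁)`. -/
def pairSnd (l₁ l₂ : ℕ) :
    fiberPairs M l₁ l₂ ⟶ TopCat.of (M × EuclideanSpace ℝ (Fin l₂) × ℝ) :=
  TopCat.ofHom ⟨fun z ↦ (z.1.1, (EuclideanSpace.finAddEquivProd z.1.2.1).2, z.1.2.2 - z.2),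
    by fun_prop⟩

variable (M) in
/-- `((m, ξ, t), t₁) ↦ (m, m, t₁, t - t₁)`. -/
def pairBase (l₁ l₂ : ℕ) : fiberPairs M l₁ l₂ ⟶ TopCat.of (M × M × ℝ × ℝ) :=
  TopCat.ofHom ⟨fun z ↦ (z.1.1, z.1.1, z.2, z.1.2.2 - z.2), by fun_prop⟩

lemma pairBase_comp_sumMap (l₁ l₂ : ℕ) :
    pairBase M l₁ l₂ ≫ sumMap M = lineProj _ ≫ fiberProj M (l₁ + l₂) ≫ diagMap M := by
  refine TopCat.hom_ext (ContinuousMap.ext fun z ↦ ?_)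
  exact Prod.ext rfl (Prod.ext rfl (add_sub_cancel z.2 z.1.2.2))

lemma isClosedEmbedding_pair [T2Space M] (l₁ l₂ : ℕ) :
    IsClosedEmbedding fun z ↦ (pairFst M l₁ l₂ z, pairSnd M l₁ l₂ z) := by
  -- A continuous left inverse into a Hausdorff target makes the map a closed embedding: `m` and t₁
  -- are read from the first factor, and t is the sum of the two last coordinates.
  refine Function.LeftInverse.isClosedEmbedding (f := fun x ↦
    ((x.1.1, EuclideanSpace.finAddEquivProd.symm (x.1.2.1, x.2.2.1), x.1.2.2 + x.2.2.2),
      x.1.2.2)) (fun z ↦ ?_) ?_ ?_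
  · exact Prod.ext (Prod.ext rfl (Prod.ext
      (EuclideanSpace.finAddEquivProd.symm_apply_apply z.1.2.1) (add_sub_cancel z.2 z.1.2.2))) rfl
  · fun_prop
  · exact (pairFst M l₁ l₂).hom.continuous.prodMk (pairSnd M l₁ l₂).hom.continuous

lemma isClosedEmbedding_projOne_projTwo [T2Space M] :
    IsClosedEmbedding fun y ↦ (projOne M y, projTwo M y) := by
  refine Function.LeftInverse.isClosedEmbedding (f := fun x ↦
    (x.1.1, x.2.1, x.1.2, x.2.2)) (fun z ↦ rfl) ?_ ?_
  · fun_prop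
  · exact (projOne M).hom.continuous.prodMk (projTwo M).hom.continuous

lemma isClosedEmbedding_diagMap [T2Space M] : IsClosedEmbedding (diagMap M) := by
  refine Function.LeftInverse.isClosedEmbedding (f := fun x ↦ (x.1, x.2.2)) (fun z ↦ rfl) ?_ ?_
  · fun_prop
  · exact (diagMap M).hom.continuous

/-- Over the diagonal, the two points lie over the same `m` and so form a point of the fibre
product. This is the fibre condition for the injectivity of the Künneth morphism. -/
lemma exists_pair {l₁ l₂ : ℕ} (d : TopCat.of (M × ℝ)) (y : TopCat.of (M × M × ℝ × ℝ))
    (x₁ : TopCat.of (M × EuclideanSpace ℝ (Fin l₁) × ℝ))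
    (x₂ : TopCat.of (M × EuclideanSpace ℝ (Fin l₂) × ℝ)) (h : sumMap M y = diagMap M d)
    (h₁ : fiberProj M l₁ x₁ = projOne M y) (h₂ : fiberProj M l₂ x₂ = projTwo M y) :
    ∃ z, pairFst M l₁ l₂ z = x₁ ∧ pairSnd M l₁ l₂ z = x₂ ∧ pairBase M l₁ l₂ z = y := by
  obtain ⟨m₁, m₂, t₁, t₂⟩ := y
  obtain ⟨n₁, ξ₁, s₁⟩ := x₁
  obtain ⟨n₂, ξ₂, s₂⟩ := x₂
  obtain ⟨m, t⟩ := d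
  obtain rfl : m₁ = m := congrArg Prod.fst h
  obtain rfl : m₂ = m₁ := congrArg (fun x ↦ x.2.1) h
  obtain rfl : n₁ = m₂ := congrArg Prod.fst h₁
  obtain rfl : n₂ = n₁ := congrArg Prod.fst h₂
  obtain rfl : s₁ = t₁ := congrArg Prod.snd h₁
  obtain rfl : s₂ = t₂ := congrArg Prod.snd h₂
  have he := EuclideanSpace.finAddEquivProd.apply_symm_apply (ξ₁, ξ₂)
  refine ⟨((n₂, EuclideanSpace.finAddEquivProd.symm (ξ₁, ξ₂), s₁ + s₂), s₁), ?_, ?_, ?_⟩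
  · exact congrArg (fun w ↦ (n₂, w.1, s₁)) he
  · exact (congrArg (fun w ↦ (n₂, w.2, s₁ + s₂ - s₁)) he).trans
      (congrArg (fun t ↦ (n₂, ξ₂, t)) (add_sub_cancel_left s₁ s₂))
  · exact Prod.ext rfl (Prod.ext rfl (Prod.ext rfl (add_sub_cancel_left s₁ s₂)))

lemma isClosed_superlevelSet {N : ℕ} {S : M × EuclideanSpace ℝ (Fin N) → ℝ}
    (hS : Continuous S) : IsClosed (superlevelSet S) :=
  isClosed_le continuous_const (by fun_prop)

/-- The direct image along `pairBase ≫ sumMap`, restricted to the diagonal, is the direct image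
along the two projections. -/
lemma nonempty_pushforward_diag_iso [T2Space M] (l₁ l₂ : ℕ) :
    Nonempty (properPushforward k (pairBase M l₁ l₂ ≫ sumMap M) ⋙ pullback k (diagMap M) ≅
      properPushforward k (lineProj _) ⋙ properPushforward k (fiberProj M (l₁ + l₂))) := by
  obtain ⟨e⟩ := nonempty_properPushforward_pullback_iso (k := k) (diagMap M)
    isClosedEmbedding_diagMap
  refine ⟨Functor.isoWhiskerRight (eqToIso (congrArg (properPushforward k)
    (pairBase_comp_sumMap l₁ l₂)) ≪≫
    (properPushforwardComp _ _).symm ≪≫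
    Functor.isoWhiskerLeft _ (properPushforwardComp _ _).symm) _ ≪≫
    Functor.associator _ _ _ ≪≫ Functor.isoWhiskerLeft _ (Functor.associator _ _ _ ≪≫
      Functor.isoWhiskerLeft _ e ≪≫ Functor.rightUnitor _)⟩

variable [T2Space M] [LocallyCompactSpace M] {l₁ l₂ : ℕ}
  {S₁ : M × EuclideanSpace ℝ (Fin l₁) → ℝ} {S₂ : M × EuclideanSpace ℝ (Fin l₂) → ℝ}

/-- The external tensor product of injective resolutions of the sheaves `k_{N_{S₁}}` and
`k_{N_{S₂}}` computes the sheaf `F_S` for `S = S₁ + S₂`. -/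
lemma nonempty_canonicalSheaf_fiberSumFunction_iso (hS₁ : Continuous S₁) (hS₂ : Continuous S₂)
    {A₁ : CochainComplex.Plus (Shv k (TopCat.of (M × EuclideanSpace ℝ (Fin l₁) × ℝ)))}
    {A₂ : CochainComplex.Plus (Shv k (TopCat.of (M × EuclideanSpace ℝ (Fin l₂) × ℝ)))}
    (φ₁ : singlePlus (constantSheafOn k _ (superlevelSet S₁)) ⟶ A₁)
    (φ₂ : singlePlus (constantSheafOn k _ (superlevelSet S₂)) ⟶ A₂)
    [QuasiIso φ₁.hom] [QuasiIso φ₂.hom] (hA₁ : ∀ i, Fine (A₁.obj.X i))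
    (hA₂ : ∀ i, Fine (A₂.obj.X i)) (h₁ : A₁.obj.IsStrictlyGE 0) (h₂ : A₂.obj.IsStrictlyGE 0) :
    Nonempty (canonicalSheaf k (fiberSumFunction S₁ S₂) ≅ DerivedCategory.Plus.Q.obj
      ((properPushforward k (fiberProj M (l₁ + l₂))).mapCochainComplexPlus.obj
      ((properPushforward k (lineProj _)).mapCochainComplexPlus.obj
        (totTensor k _ ((pullback k (pairFst M l₁ l₂)).mapCochainComplexPlus.obj A₁)
          ((pullback k (pairSnd M l₁ l₂)).mapCochainComplexPlus.obj A₂))))) := by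
  have hE : (totTensor k _ ((pullback k (pairFst M l₁ l₂)).mapCochainComplexPlus.obj A₁)
      ((pullback k (pairSnd M l₁ l₂)).mapCochainComplexPlus.obj A₂)).obj.IsStrictlyGE 0 :=
    isStrictlyGE_totTensor
      (inferInstanceAs (CochainComplex.IsStrictlyGE
        (((pullback k (pairFst M l₁ l₂)).mapHomologicalComplex _).obj A₁.obj) 0))
      (inferInstanceAs (CochainComplex.IsStrictlyGE
        (((pullback k (pairSnd M l₁ l₂)).mapHomologicalComplex _).obj A₂.obj) 0))
  have hs : ∀ i, CSoft ((totTensor k _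
      ((pullback k (pairFst M l₁ l₂)).mapCochainComplexPlus.obj A₁)
      ((pullback k (pairSnd M l₁ l₂)).mapCochainComplexPlus.obj A₂)).obj.X i) :=
    CSoft.totTensor fun i j ↦ (Fine.hasBump_tens _ _
      (isClosedEmbedding_pair l₁ l₂).isInducing (hA₁ i) (hA₂ j)).cSoft
  obtain ⟨g₁, hg₁⟩ := exists_isCharSection_constantSheafOn (k := k)
    (X := TopCat.of (M × EuclideanSpace ℝ (Fin l₁) × ℝ)) (isClosed_superlevelSet hS₁)
  obtain ⟨g₂, hg₂⟩ := exists_isCharSection_constantSheafOn (k := k)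
    (X := TopCat.of (M × EuclideanSpace ℝ (Fin l₂) × ℝ)) (isClosed_superlevelSet hS₂)
  have hS : Continuous (fiberSumFunction S₁ S₂) := by
    unfold fiberSumFunction
    fun_prop
  obtain ⟨g, hg⟩ := exists_isCharSection_constantSheafOn (k := k)
    (X := TopCat.of (M × EuclideanSpace ℝ (Fin (l₁ + l₂)) × ℝ)) (isClosed_superlevelSet hS)
  obtain ⟨hex, h, hh⟩ := exists_isKerSection_totTensor (pairFst M l₁ l₂) (pairSnd M l₁ l₂)
    hg₁ hg₂ φ₁ φ₂ hE
  let a : M × EuclideanSpace ℝ (Fin (l₁ + l₂)) × ℝ → ℝ :=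
    fun x ↦ -S₁ (x.1, (EuclideanSpace.finAddEquivProd x.2.1).1)
  let b : M × EuclideanSpace ℝ (Fin (l₁ + l₂)) × ℝ → ℝ :=
    fun x ↦ S₂ (x.1, (EuclideanSpace.finAddEquivProd x.2.1).2) + x.2.2
  -- The two inequalities bound t₁ from below and from above, so the fibres over (m, ξ, t) are
  -- compact intervals; `hV` says that they are nonempty exactly over the superlevel set of the sum.
  have hW : {z : fiberPairs M l₁ l₂ | pairFst M l₁ l₂ z ∈ superlevelSet S₁ ∧
      pairSnd M l₁ l₂ z ∈ superlevelSet S₂} = {z | a z.1 ≤ z.2 ∧ z.2 ≤ b z.1} := by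
    ext z
    refine and_congr ?_ ?_
    · change 0 ≤ S₁ _ + z.2 ↔ -S₁ _ ≤ z.2
      exact neg_le_iff_add_nonneg'.symm
    · change 0 ≤ S₂ _ + (z.1.2.2 - z.2) ↔ z.2 ≤ S₂ _ + z.1.2.2
      rw [← add_sub_assoc, sub_nonneg]
      rfl
  have hV : superlevelSet (fiberSumFunction S₁ S₂) = {x | a x ≤ b x} := by
    ext x
    change 0 ≤ S₁ _ + S₂ _ + x.2.2 ↔ -S₁ _ ≤ S₂ _ + x.2.2
    rw [neg_le_iff_add_nonneg', add_assoc]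
  rw [hW] at hh
  have hg' : IsCharSection g {x | a x ≤ b x} := by
    rw [← hV]
    exact hg
  obtain ⟨φ, hφ⟩ := exists_quasiIso_lineProj hE hs hex (a := a) (b := b) (by fun_prop)
    (by fun_prop) hh hg'
  exact nonempty_derivedProperPushforward_single_iso (fiberProj M (l₁ + l₂)) φ
    fun i ↦ CSoft.properPushforward _ (hs i)

/-- Injective resolutions turn every derived functor of the convolution into an operation on
complexes; then come the Künneth isomorphism `e₄`, the factorization `Θ` over the diagonal, and the
interval computation `e₅`. Only the continuity of the two functions enters. -/
theorem nonempty_convolution_canonicalSheaf_iso (hS₁ : Continuous S₁) (hS₂ : Continuous S₂) :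
    Nonempty (convolution (canonicalSheaf k S₁) (canonicalSheaf k S₂) ≅
      canonicalSheaf k (fiberSumFunction S₁ S₂)) := by
  obtain ⟨A₁, φ₁, hI₁, hφ₁, h₁⟩ := exists_injective_resolution
    (constantSheafOn k (TopCat.of (M × EuclideanSpace ℝ (Fin l₁) × ℝ)) (superlevelSet S₁))
  obtain ⟨A₂, φ₂, hI₂, hφ₂, h₂⟩ := exists_injective_resolution
    (constantSheafOn k (TopCat.of (M × EuclideanSpace ℝ (Fin l₂) × ℝ)) (superlevelSet S₂))
  have hA₁ : ∀ i, Fine (A₁.obj.X i) := fun i ↦ Fine.of_injective _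
  have hA₂ : ∀ i, Fine (A₂.obj.X i) := fun i ↦ Fine.of_injective _
  obtain ⟨e₁⟩ := nonempty_derivedProperPushforward_single_iso (fiberProj M l₁) φ₁
    fun i ↦ CSoft.of_injective (A₁.obj.X i)
  obtain ⟨e₂⟩ := nonempty_derivedProperPushforward_single_iso (fiberProj M l₂) φ₂
    fun i ↦ CSoft.of_injective (A₂.obj.X i)
  obtain ⟨e⟩ := nonempty_derivedTensor_iso
    ((derivedPullback k (projOne M)).mapIso e₁ ≪≫ derivedPullbackQIso _ _)
    ((derivedPullback k (projTwo M)).mapIso e₂ ≪≫ derivedPullbackQIso _ _)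
  obtain ⟨e₃⟩ := nonempty_derivedProperPushforward_iso (sumMap M) (K := totTensor k _
      ((pullback k (projOne M)).mapCochainComplexPlus.obj
        ((properPushforward k (fiberProj M l₁)).mapCochainComplexPlus.obj A₁))
      ((pullback k (projTwo M)).mapCochainComplexPlus.obj
        ((properPushforward k (fiberProj M l₂)).mapCochainComplexPlus.obj A₂)))
    (CSoft.totTensor fun i j ↦ (Fine.hasBump_tens _ _
      isClosedEmbedding_projOne_projTwo.isInducing ((hA₁ i).properPushforward _)
      ((hA₂ j).properPushforward _)).cSoft)
  obtain ⟨e₄⟩ := nonempty_kunneth_complex_iso (q₁ := pairFst M l₁ l₂) (q₂ := pairSnd M l₁ l₂)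
    (ε := pairBase M l₁ l₂) (p₁ := fiberProj M l₁) (p₂ := fiberProj M l₂) (π₁ := projOne M)
    (π₂ := projTwo M) (s := sumMap M) (δ := diagMap M) (c₁ := fun _ ↦ rfl) (c₂ := fun _ ↦ rfl)
    (hq := isClosedEmbedding_pair l₁ l₂) (hA := hA₁) (hB := hA₂)
    (hπ := isClosedEmbedding_projOne_projTwo) (hδ := exists_pair)
  obtain ⟨Θ⟩ := nonempty_pushforward_diag_iso k (M := M) l₁ l₂
  obtain ⟨e₅⟩ := nonempty_canonicalSheaf_fiberSumFunction_iso k hS₁ hS₂ φ₁ φ₂ hA₁ hA₂ h₁ h₂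
  exact ⟨(derivedPullback k (diagMap M)).mapIso
    ((derivedProperPushforward k (sumMap M)).mapIso e ≪≫ e₃) ≪≫ derivedPullbackQIso _ _ ≪≫
    DerivedCategory.Plus.Q.mapIso (e₄ ≪≫ mapPlusIso Θ _) ≪≫ e₅.symm⟩

end ConvolutionOfCanonicalSheaves

end SheafConvolution

end

theorem mainTheorem12 (n : ℕ) (M : Type u) [TopologicalSpace M] [T2Space M]
    [SecondCountableTopology M] [ChartedSpace (EuclideanSpace ℝ (Fin n)) M]
    [IsManifold (𝓡 n) ∞ M] (k : Type u) [Field k] (l₁ l₂ : ℕ)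
    (S₁ : M × EuclideanSpace ℝ (Fin l₁) → ℝ) (S₂ : M × EuclideanSpace ℝ (Fin l₂) → ℝ)
    (L₁ L₂ : Set (SheafConvolution.Cotangent n M))
    (h₁ : SheafConvolution.IsGeneratingFunction S₁ L₁)
    (h₂ : SheafConvolution.IsGeneratingFunction S₂ L₂) :
    Nonempty (SheafConvolution.convolution (SheafConvolution.canonicalSheaf k S₁)
        (SheafConvolution.canonicalSheaf k S₂) ≅
      SheafConvolution.canonicalSheaf k (SheafConvolution.fiberSumFunction S₁ S₂)) ∧
    SheafConvolution.IsGeneratingFunction (SheafConvolution.fiberSumFunction S₁ S₂)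
      (SheafConvolution.fiberwiseSum L₁ L₂) ∧
    SheafConvolution.IsCanonicalSheafOf k
      (SheafConvolution.convolution (SheafConvolution.canonicalSheaf k S₁)
        (SheafConvolution.canonicalSheaf k S₂))
      (SheafConvolution.fiberwiseSum L₁ L₂) := by
  -- Charts make `M` locally compact, which the c-soft theory requires.
  have := ChartedSpace.locallyCompactSpace (EuclideanSpace ℝ (Fin n)) M
  have e := SheafConvolution.nonempty_convolution_canonicalSheaf_iso k h₁.smooth.continuous
    h₂.smooth.continuous
  exact ⟨e, h₁.fiberSum h₂, _, _, h₁.fiberSum h₂, e⟩
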